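/- Let $k$ be a field. A pointed rational function of degree $n\ge 0$ over a domain $R$ is a pair $f=\frac AB$ with $A\in R[X]$ monic of degree $n$, $B\in R[X]$ of degree $<n$, and $\mathrm{res}(f):=\mathrm{res}_{n,n}(A,B)\in R^\times$; for $n=0$ the only one is $\frac10$. For $R=k$ these are the pointed endomorphisms of $\mathbf P^1_k$ (base point $\infty$), and composition of endomorphisms is $$\tfrac AB\circ\tfrac CD=\frac{\sum_{i=0}^m a_iC^iD^{m-i}}{\sum_{i=0}^m b_iC^iD^{m-i}}\qquad(m=\deg A,\ A=\sum a_iX^i,\ B=\sum b_iX^i).$$ Let $[\mathbf P^1,\mathbf P^1]^{\mathrm N}$ be the set of pointed rational functions over $k$ modulo the equivalence relation generated by $F(0)\sim F(1)$, for $F$ a pointed rational function over $k[T]$ and $F(t)$ its value at $T=t$. It is graded by the degree and carries two laws, induced from rational functions: composition $\circ$, and the naive sum $\frac{A_1}{B_1}\oplus^{\mathrm N}\frac{A_2}{B_2}=\frac{A_1A_2-V_1B_2}{B_1A_2+U_1B_2}$, where $A_1U_1+B_1V_1=1$ and $\deg V_1<\deg A_1$. The Bézout form $\mathrm{B\acute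 ez}(f)$ of $f=\frac AB$ of degree $n$ is the bilinear form on $k^n$ with Gram matrix $(c_{p,q})_{1\le p,q\le n}$, where $\frac{A(X)B(Y)-A(Y)B(X)}{X-Y}=\sum_{p,q} c_{p,q}X^{p-1}Y^{q-1}$. Two non-degenerate symmetric $k$-bilinear forms $b,b'$ are stably isomorphic if $b\oplus b''\simeq b'\oplus b''$ for some such form $b''$. Let $\mathrm{MW}^{\mathrm s}_n(k)$ be the set of stable isomorphism classes of rank $n$, and for $n\ge1$ let $\mathrm{MW}^{\mathrm s}_n(k)\times_{k^\times/k^{\times2}}k^\times$ be the set of pairs $(b,\lambda)$ such that the class of $\lambda$ is the discriminant of $b$ (the class of a Gram determinant); for $n=0$ let it consist of the single pair $(0,1)$. On $M=\coprod_{n\ge0}\mathrm{MW}^{\mathrm s}_n(k)\times_{k^\times/k^{\times2}}k^\times$ put $$(b_1,\lambda_1)\oplus(b_2,\lambda_2)=(b_1\oplus b_2,\ \lambda_1\lambda_2),\qquad (b_1,\lambda_1)\circ(b_2,\lambda_2)=\bigl(b_1\otimes b_2,\ \lambda_1^{\dim b_2}\lambda_2^{(\dim b_1)^2}\bigr).$$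 **Theorem.** $([\mathbf P^1,\mathbf P^1]^{\mathrm N},\oplus^{\mathrm N},\circ)$ and $(M,\oplus,\circ)$ are graded bi-monoids: each of the two laws is associative and has a neutral element (namely $\frac10$ and $X$, respectively $(0,1)$ and $(\langle1\rangle,1)$), and the degree is additive for the first law and multiplicative for the second. For $f$ of degree $n$, the Bézout form is symmetric and non-degenerate, with $\det\mathrm{B\acute ez}(f)=(-1)^{n(n-1)/2}\,\mathrm{res}(f)$. The map $$f\longmapsto\bigl[\mathrm{B\acute ez}(f),\ \det\mathrm{B\acute ez}(f)\bigr]=\bigl[\mathrm{B\acute ez}(f),\ (-1)^{n(n-1)/2}\,\mathrm{res}(f)\bigr]$$ induces a bijection $[\mathbf P^1,\mathbf P^1]^{\mathrm N}\to M$ which preserves the degree, carries $\oplus^{\mathrm N}$ to $\oplus$ and $\circ$ to $\circ$, and preserves both neutral elements. The resultants themselves also satisfy $\mathrm{res}(f\circ g)=\mathrm{res}(f)^{\deg g}\,\mathrm{res}(g)^{(\deg f)^2}$ for all pointed rational functions $f,g$ over $k$. -/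

import Mathlib

noncomputable section

namespace NaiveP1

open Polynomial

/-! ### Pointed rational functions -/

/-- A pointed rational function `A / B` over `R`, of some degree `n`: `A` is monic of degree `n`,
`B` has degree `< n`, and the resultant `res_{n,n}(A, B)` is invertible. For `R` a domain these are
the `R`-points of `∐ₙ 𝓕ₙ`. For `R = k` a field they are the pointed endomorphisms of the projective
line over `k` (base point `∞ = [1 : 0]`), and for `R = k[T]` the pointed naive homotopies. In degree
`0` the only point is `1 / 0`, the constant map to `∞`. -/
@[ext]
structure PtRat (R : Type*) [CommRing R] where
  num : R[X]
  den : R[X]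
  monic : num.Monic
  degree_lt : den.degree < num.degree
  isUnit_res : IsUnit (num.resultant den num.natDegree num.natDegree)

namespace PtRat

variable {R S : Type*} [CommRing R] [CommRing S]

/-- The degree `n` of `A / B`. -/
def deg (f : PtRat R) : ℕ := f.num.natDegree

/-- The resultant `res_{n,n}(A, B)`. -/
def res (f : PtRat R) : R := f.num.resultant f.den f.num.natDegree f.num.natDegree

theorem resultant_eq {A B : R[X]} (hA : A.Monic) (h : B.degree < A.degree) :
    A.resultant B A.natDegree A.natDegree = A.resultant B := by
  have hle : B.natDegree ≤ A.natDegree := natDegree_le_natDegree h.le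
  obtain ⟨j, hj⟩ := Nat.exists_eq_add_of_le hle
  have := resultant_add_right_deg A B A.natDegree B.natDegree j le_rfl
  rw [← hj] at this
  rw [this, coeff_natDegree, hA.leadingCoeff, one_pow, one_mul]

theorem isCoprime (f : PtRat R) : IsCoprime f.num f.den := by
  rw [← isUnit_resultant_iff_isCoprime f.monic, ← resultant_eq f.monic f.degree_lt]
  exact f.isUnit_res

theorem nontrivial (f : PtRat R) : Nontrivial R := by
  by_contra h
  rw [not_nontrivial_iff_subsingleton] at h
  have := f.degree_lt
  simp [Subsingleton.elim f.num f.den] at this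

/-- The resultant condition follows from (and is equivalent to) comaximality of `A` and `B`. -/
def ofCoprime (A B : R[X]) (hA : A.Monic) (hB : B.degree < A.degree) (h : IsCoprime A B) :
    PtRat R where
  num := A
  den := B
  monic := hA
  degree_lt := hB
  isUnit_res := by
    rw [resultant_eq hA hB]
    exact (isUnit_resultant_iff_isCoprime hA).2 h

/-- Base change of a rational function along a ring homomorphism. -/
def map [Nontrivial S] (φ : R →+* S) (f : PtRat R) : PtRat S :=
  ofCoprime (f.num.map φ) (f.den.map φ) (f.monic.map φ)
    (by
      rw [f.monic.degree_map φ]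
      exact degree_map_le.trans_lt f.degree_lt)
    (f.isCoprime.map (mapRingHom φ))

theorem exists_bezout (f : PtRat R) :
    ∃ p : R[X] × R[X], f.num * p.1 + f.den * p.2 = 1 ∧ p.2.degree < f.num.degree := by
  have := f.nontrivial
  obtain ⟨a, b, h⟩ := f.isCoprime
  refine ⟨(a + f.den * (b /ₘ f.num), b %ₘ f.num), ?_, degree_modByMonic_lt _ f.monic⟩
  have := modByMonic_add_div b f.num
  linear_combination h + f.den * this

theorem bezout_unique (f : PtRat R) {U V U' V' : R[X]}
    (h : f.num * U + f.den * V = 1) (hV : V.degree < f.num.degree)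
    (h' : f.num * U' + f.den * V' = 1) (hV' : V'.degree < f.num.degree) : U = U' ∧ V = V' := by
  have := f.nontrivial
  have hdvd : f.num ∣ V - V' := f.isCoprime.dvd_of_dvd_mul_left
    ⟨U' - U, by linear_combination h - h'⟩
  have hVV : V - V' = 0 := by
    by_contra hne
    exact f.monic.not_dvd_of_degree_lt hne
      ((degree_sub_le V V').trans_lt (max_lt hV hV')) hdvd
  have hV0 : V = V' := sub_eq_zero.1 hVV
  refine ⟨f.monic.isRegular.left ?_, hV0⟩
  subst hV0
  show f.num * U = f.num * U'
  linear_combination h - h'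

/-- The polynomial `U` of the unique Bézout relation `A U + B V = 1` with `deg V < n` (then also
`deg U ≤ n - 2` if `n ≥ 1`, and `U = 1`, `V = 0` if `n = 0`). -/
def bezU (f : PtRat R) : R[X] := f.exists_bezout.choose.1
/-- The polynomial `V` of the unique Bézout relation `A U + B V = 1` with `deg V < n`. -/
def bezV (f : PtRat R) : R[X] := f.exists_bezout.choose.2

theorem bezout (f : PtRat R) : f.num * f.bezU + f.den * f.bezV = 1 :=
  f.exists_bezout.choose_spec.1

theorem degree_bezV_lt (f : PtRat R) : f.bezV.degree < f.num.degree :=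
  f.exists_bezout.choose_spec.2

theorem degree_bezU_le (f : PtRat R) : f.bezU.degree ≤ f.num.degree := by
  have := f.nontrivial
  have h1 : (f.num * f.bezU).degree ≤ f.num.degree + f.num.degree := by
    rw [show f.num * f.bezU = 1 - f.den * f.bezV by linear_combination f.bezout]
    refine (degree_sub_le _ _).trans (max_le ?_ ?_)
    · rw [degree_one, degree_eq_natDegree f.monic.ne_zero]
      exact_mod_cast Nat.zero_le _
    · exact (degree_mul_le _ _).trans (add_le_add f.degree_lt.le f.degree_bezV_lt.le)
  rw [mul_comm, f.monic.degree_mul, add_comm] at h1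
  rw [degree_eq_natDegree f.monic.ne_zero] at h1 ⊢
  exact (WithBot.add_le_add_iff_left (WithBot.coe_ne_bot)).1 h1

theorem degree_mul_lt_left {A₁ A₂ P Q : R[X]} (h₂ : A₂.Monic)
    (hA : A₁.Monic) (hP : P.degree ≤ A₁.degree) (hQ : Q.degree < A₂.degree) :
    (P * Q).degree < (A₁ * A₂).degree := by
  have : Nontrivial R := by
    by_contra h
    rw [not_nontrivial_iff_subsingleton] at h
    simp [Subsingleton.elim Q A₂] at hQ
  rw [h₂.degree_mul]
  refine (degree_mul_le _ _).trans_lt ?_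
  rcases eq_or_ne P 0 with rfl | hP0
  · rw [degree_zero, WithBot.bot_add, ← h₂.degree_mul]
    exact bot_lt_iff_ne_bot.2 fun h => (hA.mul h₂).ne_zero (degree_eq_bot.1 h)
  · exact WithBot.add_lt_add_of_le_of_lt (fun h => hP0 (degree_eq_bot.1 h)) hP hQ

/-- The naive sum `A₁/B₁ ⊕ᴺ A₂/B₂ = A₃/B₃`: the first column of the matrix product
`[A₁, -V₁; B₁, U₁] * [A₂, -V₂; B₂, U₂]`. -/
def naiveSum (f g : PtRat R) : PtRat R :=
  have hlt : (f.bezV * g.den).degree < (f.num * g.num).degree :=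
    degree_mul_lt_left g.monic f.monic f.degree_bezV_lt.le g.degree_lt
  ofCoprime (f.num * g.num - f.bezV * g.den) (f.den * g.num + f.bezU * g.den)
    ((f.monic.mul g.monic).sub_of_left hlt)
    (by
      rw [degree_sub_eq_left_of_degree_lt hlt]
      refine (degree_add_le _ _).trans_lt (max_lt ?_ ?_)
      · rw [mul_comm, mul_comm f.num]
        exact degree_mul_lt_left f.monic g.monic le_rfl f.degree_lt
      · exact degree_mul_lt_left g.monic f.monic f.degree_bezU_le g.degree_lt)
    ⟨f.bezU * g.bezU - f.den * g.bezV, f.num * g.bezV + f.bezV * g.bezU, by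
      linear_combination (f.num * f.bezU + f.den * f.bezV) * g.bezout + f.bezout⟩

/-- The degree `n` homogenization of `P`, evaluated at `(C, D)`: `∑_{i ≤ n} pᵢ Cⁱ D^{n-i}`. -/
def homEval (n : ℕ) (P C D : R[X]) : R[X] :=
  ∑ i ∈ Finset.range (n + 1), Polynomial.C (P.coeff i) * C ^ i * D ^ (n - i)

theorem homEval_eq (n : ℕ) (P C D : R[X]) :
    homEval n P C D = MvPolynomial.aeval ![C, D] (P.homogenize n) := by
  rw [homEval, homogenize, map_sum, Finset.Nat.sum_antidiagonal_eq_sum_range_succ_mk]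
  refine Finset.sum_congr rfl fun i _ => ?_
  rw [MvPolynomial.aeval_monomial, Finsupp.update_eq_add_single (by simp),
    Finsupp.prod_add_index (by simp) (by simp [pow_add])]
  simp [mul_assoc]

theorem homEval_map (φ : R →+* S) (n : ℕ) (P C D : R[X]) :
    (homEval n P C D).map φ = homEval n (P.map φ) (C.map φ) (D.map φ) := by
  simp [homEval, Polynomial.map_sum]

theorem degree_term_lt {C D : R[X]} (hC : C.Monic) (hD : D.degree < C.degree) (i j : ℕ) :
    (C ^ i * D ^ (j + 1)).degree < (C ^ (i + (j + 1))).degree := by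
  induction j with
  | zero => 
    rw [zero_add, pow_add, pow_one, pow_one]
    exact degree_mul_lt_left hC (hC.pow i) le_rfl hD
  | succ j ih =>
    rw [pow_succ D, ← mul_assoc, ← add_assoc i, pow_succ C (i + _)]
    exact degree_mul_lt_left hC (hC.pow _) ih.le hD

theorem degree_homEval_lt {P C D : R[X]} (hC : C.Monic) (hD : D.degree < C.degree) (n : ℕ)
    (hn : P.coeff n = 0) : (homEval n P C D).degree < (C ^ n).degree := by
  have : Nontrivial R := by
    by_contra h
    rw [not_nontrivial_iff_subsingleton] at h
    simp [Subsingleton.elim D C] at hD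
  rw [homEval, Finset.sum_range_succ, hn]
  simp only [map_zero, zero_mul, add_zero]
  refine (degree_sum_le _ _).trans_lt ?_
  rw [Finset.sup_lt_iff (bot_lt_iff_ne_bot.2 fun h => (hC.pow n).ne_zero (degree_eq_bot.1 h))]
  intro i hi
  rw [Finset.mem_range] at hi
  obtain ⟨j, rfl⟩ := Nat.exists_eq_add_of_lt hi
  rw [mul_assoc]
  rw [← smul_eq_C_mul]
  refine (degree_smul_le _ _).trans_lt ?_
  have := degree_term_lt hC hD i j
  rwa [show i + j + 1 - i = j + 1 by omega, show i + j + 1 = i + (j + 1) by omega]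

theorem homEval_split {P C D : R[X]} (n : ℕ) (hP : P.Monic) (hn : P.natDegree = n) :
    homEval n P C D = C ^ n + homEval n (P - X ^ n) C D := by
  have h1 : P.coeff n = 1 := by rw [← hn]; exact hP
  simp only [homEval, Finset.sum_range_succ, coeff_sub, coeff_X_pow, h1]
  simp only [if_pos, sub_self, map_zero, zero_mul, add_zero, map_one, one_mul, Nat.sub_self,
    pow_zero, mul_one]
  rw [add_comm]
  congr 1
  refine Finset.sum_congr rfl fun i hi => ?_
  rw [Finset.mem_range] at hi
  rw [if_neg hi.ne, sub_zero]

theorem dvd_homEval {P C D : R[X]} (n : ℕ) (hn : P.coeff n = 0) : D ∣ homEval n P C D := by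
  rw [homEval, Finset.sum_range_succ, hn]
  simp only [map_zero, zero_mul, add_zero]
  refine Finset.dvd_sum fun i hi => ?_
  rw [Finset.mem_range] at hi
  exact Dvd.dvd.mul_left (dvd_pow_self D (by omega)) _

theorem coeff_num (f : PtRat R) : f.num.coeff f.deg = 1 := f.monic

theorem coeff_sub_X_pow (f : PtRat R) : (f.num - X ^ f.deg).coeff f.deg = 0 := by
  rw [coeff_sub, f.coeff_num, coeff_X_pow, if_pos rfl, sub_self]

theorem coeff_den (f : PtRat R) : f.den.coeff f.deg = 0 :=
  coeff_eq_zero_of_degree_lt (f.degree_lt.trans_le degree_le_natDegree)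

theorem isCoprime_homEval (f g : PtRat R) :
    IsCoprime (homEval f.deg f.num g.num g.den) (homEval f.deg f.den g.num g.den) := by
  obtain ⟨a, b, h⟩ := f.isCoprime
  set N := max a.natDegree b.natDegree
  set A := homEval f.deg f.num g.num g.den with hA
  set B := homEval f.deg f.den g.num g.den with hB
  have key : homEval N a g.num g.den * A + homEval N b g.num g.den * B = g.den ^ (N + f.deg) := by
    rw [hA, hB]
    simp only [homEval_eq, ← map_mul]
    rw [← homogenize_mul a f.num (m := N) (n := f.deg) (le_max_left _ _) le_rfl,
      ← homogenize_mul b f.den (m := N) (n := f.deg) (le_max_right _ _)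
      (natDegree_le_natDegree f.degree_lt.le), ← map_add, ← homogenize_add, h]
    simp
  have h1 : IsCoprime A (g.den ^ (N + f.deg)) := by
    refine IsCoprime.pow_right ?_
    obtain ⟨q, hq⟩ := dvd_homEval (C := g.num) (D := g.den) f.deg f.coeff_sub_X_pow
    rw [hA, homEval_split f.deg f.monic rfl, hq]
    exact IsCoprime.add_mul_left_left (g.isCoprime.pow_left) q
  obtain ⟨x, y, hxy⟩ := h1
  rw [← key] at hxy
  exact ⟨x + y * homEval N a g.num g.den, y * homEval N b g.num g.den, by
    linear_combination hxy⟩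

/-- Composition `f ∘ g` of the endomorphisms given by `f = A / B` (of degree `m`) and `g = C / D`:
it is represented by `(∑ aᵢ Cⁱ D^{m-i}) / (∑ bᵢ Cⁱ D^{m-i})`. -/
def comp (f g : PtRat R) : PtRat R :=
  have hlt : (homEval f.deg (f.num - X ^ f.deg) g.num g.den).degree < (g.num ^ f.deg).degree :=
    degree_homEval_lt g.monic g.degree_lt _ f.coeff_sub_X_pow
  ofCoprime (homEval f.deg f.num g.num g.den) (homEval f.deg f.den g.num g.den)
    (by
      rw [homEval_split f.deg f.monic rfl]
      exact (g.monic.pow _).add_of_left hlt)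
    (by
      rw [homEval_split f.deg f.monic rfl, degree_add_eq_left_of_degree_lt hlt]
      exact degree_homEval_lt g.monic g.degree_lt _ f.coeff_den)
    (isCoprime_homEval f g)

/-- The identity `X / 1`. -/
def ident [Nontrivial R] : PtRat R :=
  ofCoprime X 1 monic_X (by rw [degree_X, degree_one]; exact zero_lt_one) isCoprime_one_right

/-- The constant map `1 / 0` to the base point `∞`. -/
def infty [Nontrivial R] : PtRat R :=
  ofCoprime 1 0 monic_one (by simp) isCoprime_one_left

theorem deg_map [Nontrivial S] (φ : R →+* S) (f : PtRat R) : (f.map φ).deg = f.deg :=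
  f.monic.natDegree_map φ

theorem map_comp [Nontrivial S] (φ : R →+* S) (f g : PtRat R) :
    (f.comp g).map φ = (f.map φ).comp (g.map φ) := by
  have h := f.deg_map φ
  ext1
  · show (homEval _ _ _ _).map φ = homEval (f.map φ).deg _ _ _
    rw [h, homEval_map]; rfl
  · show (homEval _ _ _ _).map φ = homEval (f.map φ).deg _ _ _
    rw [h, homEval_map]; rfl

theorem bez_map [Nontrivial S] (φ : R →+* S) (f : PtRat R) :
    f.bezU.map φ = (f.map φ).bezU ∧ f.bezV.map φ = (f.map φ).bezV := by
  refine (f.map φ).bezout_unique ?_ ?_ (f.map φ).bezout (f.map φ).degree_bezV_lt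
  · have := congrArg (Polynomial.map φ) f.bezout
    rwa [Polynomial.map_add, Polynomial.map_mul, Polynomial.map_mul, Polynomial.map_one] at this
  · show _ < (f.num.map φ).degree
    rw [f.monic.degree_map φ]
    exact degree_map_le.trans_lt f.degree_bezV_lt

theorem map_naiveSum [Nontrivial S] (φ : R →+* S) (f g : PtRat R) :
    (f.naiveSum g).map φ = (f.map φ).naiveSum (g.map φ) := by
  obtain ⟨hU, hV⟩ := f.bez_map φ
  ext1
  · show Polynomial.map φ (f.num * g.num - f.bezV * g.den) = 
      f.num.map φ * g.num.map φ - (f.map φ).bezV * g.den.map φ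
    rw [← hV]; simp
  · show Polynomial.map φ (f.den * g.num + f.bezU * g.den) = 
      f.den.map φ * g.num.map φ + (f.map φ).bezU * g.den.map φ
    rw [← hU]; simp

/-- The polynomial `δ(X, Y) = (A(X) B(Y) - A(Y) B(X)) / (X - Y)`, as a polynomial in `X` whose
coefficients are polynomials in `Y`. -/
def bezPoly (f : PtRat R) : R[X][X] :=
  (f.num.map C * C f.den - C f.num * f.den.map C) /ₘ (X - C X)

/-- The division defining `δ` is exact. -/
theorem bezPoly_mul (f : PtRat R) :
    (X - C X) * f.bezPoly = f.num.map C * C f.den - C f.num * f.den.map C := by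
  rw [bezPoly, mul_divByMonic_eq_iff_isRoot]
  simp [IsRoot, eval_map, mul_comm, eval₂_C_X]

/-- The Gram matrix of the Bézout form: the coefficients of `X^p Y^q`, `0 ≤ p, q < n`, in `δ`. -/
def bez (f : PtRat R) : Matrix (Fin f.deg) (Fin f.deg) R :=
  .of fun p q => (f.bezPoly.coeff p).coeff q

end PtRat

/-! ### Pointed naive homotopy classes -/

section classes
variable {k : Type*} [Field k]

/-- An elementary pointed naive homotopy from `f` to `g`: a point over `k[T]` with value `f` at
`T = 0` and `g` at `T = 1`. -/
def Homotopic (f g : PtRat k) : Prop :=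
  ∃ F : PtRat k[X], F.map (evalRingHom 0) = f ∧ F.map (evalRingHom 1) = g

variable (k) in
/-- The set `[ℙ¹, ℙ¹]ᴺ` of pointed naive homotopy classes: the quotient by the equivalence relation
generated by elementary homotopies. -/
def PP : Type _ := Quot (Homotopic (k := k))

namespace PP

/-- The class of a rational function. -/
def mk (f : PtRat k) : PP k := Quot.mk _ f

theorem map_C_eval (a : k) (g : PtRat k) : (g.map (C : k →+* k[X])).map (evalRingHom a) = g := by
  have : (evalRingHom a).comp C = RingHom.id k := by ext; simp
  ext1
  · show (g.num.map C).map (evalRingHom a) = g.num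
    rw [Polynomial.map_map, this, Polynomial.map_id]
  · show (g.den.map C).map (evalRingHom a) = g.den
    rw [Polynomial.map_map, this, Polynomial.map_id]

/-- The law `⊕ᴺ` on homotopy classes. -/
def naiveSum : PP k → PP k → PP k :=
  Quot.map₂ PtRat.naiveSum
    (by
      rintro f _ _ ⟨G, rfl, rfl⟩
      exact ⟨(f.map C).naiveSum G, by rw [PtRat.map_naiveSum, map_C_eval],
        by rw [PtRat.map_naiveSum, map_C_eval]⟩)
    (by
      rintro _ _ g ⟨F, rfl, rfl⟩
      exact ⟨F.naiveSum (g.map C), by rw [PtRat.map_naiveSum, map_C_eval],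
        by rw [PtRat.map_naiveSum, map_C_eval]⟩)

/-- Composition of homotopy classes. -/
def comp : PP k → PP k → PP k :=
  Quot.map₂ PtRat.comp
    (by
      rintro f _ _ ⟨G, rfl, rfl⟩
      exact ⟨(f.map C).comp G, by rw [PtRat.map_comp, map_C_eval],
        by rw [PtRat.map_comp, map_C_eval]⟩)
    (by
      rintro _ _ g ⟨F, rfl, rfl⟩
      exact ⟨F.comp (g.map C), by rw [PtRat.map_comp, map_C_eval],
        by rw [PtRat.map_comp, map_C_eval]⟩)

/-- The neutral element of `⊕ᴺ`. -/
def zero : PP k := mk PtRat.infty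

/-- The class of the identity, neutral for composition. -/
def one : PP k := mk PtRat.ident

/-- The degree of a homotopy class. -/
def deg : PP k → ℕ :=
  Quot.lift PtRat.deg (by
    rintro _ _ ⟨F, rfl, rfl⟩
    rw [PtRat.deg_map, PtRat.deg_map])

end PP
end classes

/-! ### Non-degenerate symmetric bilinear forms up to stable isometry -/
section congruence

open Matrix
open scoped Kronecker

variable {k : Type*} [Field k] {ι κ τ ι' κ' : Type*} [Fintype ι] [Fintype κ] [Fintype τ] [Fintype ι']
  [Fintype κ'] [DecidableEq ι] [DecidableEq κ] [DecidableEq τ] [DecidableEq ι'] [DecidableEq κ']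

/-- The matrices `S` and `T` are congruent: `S = ᵗP T P` with `P` invertible (with inverse `Q`). -/
def Congr (S : Matrix ι ι k) (T : Matrix κ κ k) : Prop :=
  ∃ (P : Matrix κ ι k) (Q : Matrix ι κ k), P * Q = 1 ∧ Q * P = 1 ∧ Pᵀ * T * P = S

namespace Congr

theorem refl (S : Matrix ι ι k) : Congr S S := ⟨1, 1, by simp, by simp, by simp⟩

theorem symm {S : Matrix ι ι k} {T : Matrix κ κ k} (h : Congr S T) : Congr T S := by
  obtain ⟨P, Q, h1, h2, rfl⟩ := h
  refine ⟨Q, P, h2, h1, ?_⟩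
  calc Qᵀ * (Pᵀ * T * P) * Q = (P * Q)ᵀ * T * (P * Q) := by
        simp only [transpose_mul, Matrix.mul_assoc]
    _ = T := by simp [h1]

theorem trans {S : Matrix ι ι k} {T : Matrix κ κ k} {U : Matrix τ τ k}
    (h : Congr S T) (h' : Congr T U) : Congr S U := by
  obtain ⟨P, Q, h1, h2, rfl⟩ := h
  obtain ⟨P', Q', h1', h2', rfl⟩ := h'
  refine ⟨P' * P, Q * Q', ?_, ?_, ?_⟩
  · rw [Matrix.mul_assoc, ← Matrix.mul_assoc P, h1, Matrix.one_mul, h1']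
  · rw [Matrix.mul_assoc, ← Matrix.mul_assoc Q', h2', Matrix.one_mul, h2]
  · simp only [transpose_mul, Matrix.mul_assoc]

theorem submatrix (S : Matrix ι ι k) (e : κ ≃ ι) : Congr (S.submatrix e e) S := by
  refine ⟨(1 : Matrix ι ι k).submatrix id e, (1 : Matrix ι ι k).submatrix e id, ?_, ?_, ?_⟩
  · rw [submatrix_mul_equiv]; simp
  · rw [← submatrix_mul _ _ _ _ _ Function.bijective_id]; simp
  · ext i j
    simp [Matrix.mul_apply, Matrix.one_apply]

theorem of_equiv {S : Matrix ι ι k} {T : Matrix κ κ k} (e : ι ≃ κ)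
    (h : ∀ i j, S i j = T (e i) (e j)) : Congr S T := by
  have : S = T.submatrix e e := by ext i j; exact h i j
  rw [this]
  exact submatrix T e

theorem fromBlocks {S : Matrix ι ι k} {T : Matrix κ κ k} {S' : Matrix ι' ι' k}
    {T' : Matrix κ' κ' k} (h : Congr S S') (h' : Congr T T') :
    Congr (fromBlocks S 0 0 T) (fromBlocks S' 0 0 T') := by
  obtain ⟨P, Q, h1, h2, rfl⟩ := h
  obtain ⟨P', Q', h1', h2', rfl⟩ := h'
  refine ⟨Matrix.fromBlocks P 0 0 P', Matrix.fromBlocks Q 0 0 Q', ?_, ?_, ?_⟩ <;>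
    simp [fromBlocks_multiply, fromBlocks_transpose, h1, h2, h1', h2']

theorem kronecker {S : Matrix ι ι k} {T : Matrix κ κ k} {S' : Matrix ι' ι' k}
    {T' : Matrix κ' κ' k} (h : Congr S S') (h' : Congr T T') :
    Congr (S ⊗ₖ T) (S' ⊗ₖ T') := by
  obtain ⟨P, Q, h1, h2, rfl⟩ := h
  obtain ⟨P', Q', h1', h2', rfl⟩ := h'
  refine ⟨P ⊗ₖ P', Q ⊗ₖ Q', ?_, ?_, ?_⟩
  · rw [← mul_kronecker_mul, h1, h1', one_kronecker_one]
  · rw [← mul_kronecker_mul, h2, h2', one_kronecker_one]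
  · rw [← kroneckerMap_transpose, ← mul_kronecker_mul, ← mul_kronecker_mul]

theorem card_eq {S : Matrix ι ι k} {T : Matrix κ κ k} (h : Congr S T) :
    Fintype.card ι = Fintype.card κ := by
  obtain ⟨P, Q, h1, h2, -⟩ := h
  exact (square_of_invertible P Q h1 h2).symm

end Congr
end congruence

/-- A non-degenerate symmetric bilinear form on `kⁿ`, given by its Gram matrix. -/
structure SymForm (k : Type*) [Field k] where
  dim : ℕ
  mat : Matrix (Fin dim) (Fin dim) k
  symm : mat.IsSymm
  nondeg : IsUnit mat.det

namespace SymForm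
open Matrix
open scoped Kronecker
variable {k : Type*} [Field k]

/-- Isomorphism of bilinear forms. -/
def Isometric (b c : SymForm k) : Prop := Congr b.mat c.mat

/-- The orthogonal sum, with block diagonal Gram matrix. -/
def osum (b c : SymForm k) : SymForm k where
  dim := b.dim + c.dim
  mat := Matrix.reindex finSumFinEquiv finSumFinEquiv (Matrix.fromBlocks b.mat 0 0 c.mat)
  symm := by
    rw [Matrix.IsSymm, Matrix.transpose_reindex, Matrix.fromBlocks_transpose, b.symm, c.symm]
    simp
  nondeg := by
    rw [Matrix.det_reindex_self, Matrix.det_fromBlocks_zero₂₁]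
    exact b.nondeg.mul c.nondeg

/-- The tensor product, with Gram matrix the Kronecker product. -/
def tensor (b c : SymForm k) : SymForm k where
  dim := b.dim * c.dim
  mat := Matrix.reindex finProdFinEquiv finProdFinEquiv (b.mat ⊗ₖ c.mat)
  symm := by
    rw [Matrix.IsSymm, Matrix.transpose_reindex, ← Matrix.kroneckerMap_transpose, b.symm, c.symm]
  nondeg := by
    rw [Matrix.det_reindex_self, Matrix.det_kronecker]
    exact (b.nondeg.pow _).mul (c.nondeg.pow _)

/-- The form of rank `0`. -/
def zero : SymForm k where
  dim := 0
  mat := 0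
  symm := Matrix.isSymm_zero
  nondeg := by simp

/-- The form `⟨1⟩`. -/
def one : SymForm k where
  dim := 1
  mat := 1
  symm := Matrix.isSymm_one
  nondeg := by simp

/-- The determinant of the Gram matrix. -/
def det (b : SymForm k) : kˣ := b.nondeg.unit

theorem det_osum (b c : SymForm k) : (b.osum c).det = b.det * c.det := by
  ext
  show (osum b c).mat.det = b.mat.det * c.mat.det
  rw [osum, Matrix.det_reindex_self, Matrix.det_fromBlocks_zero₂₁]

theorem det_tensor (b c : SymForm k) :
    (b.tensor c).det = b.det ^ c.dim * c.det ^ b.dim := by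
  ext
  show (tensor b c).mat.det = b.mat.det ^ c.dim * c.mat.det ^ b.dim
  rw [tensor, Matrix.det_reindex_self, Matrix.det_kronecker, Fintype.card_fin, Fintype.card_fin]

theorem osum_congr_aux (b c : SymForm k) :
    Congr (b.osum c).mat (Matrix.fromBlocks b.mat 0 0 c.mat) :=
  Congr.submatrix _ _

theorem tensor_congr_aux (b c : SymForm k) : Congr (b.tensor c).mat (b.mat ⊗ₖ c.mat) :=
  Congr.submatrix _ _

namespace Isometric

theorem refl (b : SymForm k) : Isometric b b := Congr.refl _
theorem symm {b c : SymForm k} (h : Isometric b c) : Isometric c b := Congr.symm h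
theorem trans {b c d : SymForm k} (h : Isometric b c) (h' : Isometric c d) : Isometric b d :=
  Congr.trans h h'

theorem dim_eq {b c : SymForm k} (h : Isometric b c) : b.dim = c.dim := by
  simpa using Congr.card_eq h

theorem osum {b b' c c' : SymForm k} (h : Isometric b b') (h' : Isometric c c') :
    Isometric (b.osum c) (b'.osum c') :=
  ((osum_congr_aux b c).trans (h.fromBlocks h')).trans (osum_congr_aux b' c').symm

theorem tensor {b b' c c' : SymForm k} (h : Isometric b b') (h' : Isometric c c') :
    Isometric (b.tensor c) (b'.tensor c') :=
  ((tensor_congr_aux b c).trans (Congr.kronecker h h')).trans (tensor_congr_aux b' c').symm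

theorem osum_comm (b c : SymForm k) : Isometric (b.osum c) (c.osum b) := by
  refine ((osum_congr_aux b c).trans ?_).trans (osum_congr_aux c b).symm
  refine Congr.of_equiv (Equiv.sumComm _ _) ?_
  rintro (i | i) (j | j) <;> simp

theorem osum_assoc (b c d : SymForm k) :
    Isometric ((b.osum c).osum d) (b.osum (c.osum d)) := by
  refine ((osum_congr_aux _ d).trans ((osum_congr_aux b c).fromBlocks (.refl _))).trans
    (Congr.trans ?_ (((Congr.refl _).fromBlocks (osum_congr_aux c d)).symm.trans
      (osum_congr_aux b _).symm))
  refine Congr.of_equiv (Equiv.sumAssoc _ _ _) ?_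
  rintro ((i | i) | i) ((j | j) | j) <;> simp

theorem tensor_comm (b c : SymForm k) : Isometric (b.tensor c) (c.tensor b) := by
  refine ((tensor_congr_aux b c).trans ?_).trans (tensor_congr_aux c b).symm
  refine Congr.of_equiv (Equiv.prodComm _ _) ?_
  rintro ⟨i, i'⟩ ⟨j, j'⟩
  simp [Matrix.kroneckerMap_apply, mul_comm]

theorem osum_tensor (b c d : SymForm k) :
    Isometric ((b.osum c).tensor d) ((b.tensor d).osum (c.tensor d)) := by
  refine ((tensor_congr_aux _ d).trans ((osum_congr_aux b c).kronecker (.refl _))).trans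
    (Congr.trans ?_ (((tensor_congr_aux b d).fromBlocks (tensor_congr_aux c d)).symm.trans
      (osum_congr_aux _ _).symm))
  refine Congr.of_equiv (Equiv.sumProdDistrib _ _ _) ?_
  rintro ⟨i | i, i'⟩ ⟨j | j, j'⟩ <;> simp [Matrix.kroneckerMap_apply]

theorem det_eq {b c : SymForm k} (h : Isometric b c) : ∃ u : kˣ, b.det = u ^ 2 * c.det := by
  have hd := h.dim_eq
  obtain ⟨n, S, hS, hS'⟩ := b
  obtain ⟨m, T, hT, hT'⟩ := c
  obtain rfl : n = m := hd
  obtain ⟨P, Q, h1, h2, h3⟩ := h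
  have hu : IsUnit P.det := by
    rw [isUnit_iff_exists_inv]
    exact ⟨Q.det, by rw [← Matrix.det_mul, h1, Matrix.det_one]⟩
  refine ⟨hu.unit, ?_⟩
  ext
  show S.det = P.det ^ 2 * T.det
  change Pᵀ * T * P = S at h3
  rw [← h3, Matrix.det_mul, Matrix.det_mul, Matrix.det_transpose]
  ring

end Isometric

/-- Two forms are stably isometric if they become isometric after adding some form. -/
def StablyIsometric (b c : SymForm k) : Prop :=
  ∃ d : SymForm k, Isometric (b.osum d) (c.osum d)

namespace StablyIsometric

theorem refl (b : SymForm k) : StablyIsometric b b := ⟨zero, .refl _⟩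

theorem symm {b c : SymForm k} (h : StablyIsometric b c) : StablyIsometric c b := by
  obtain ⟨d, h⟩ := h
  exact ⟨d, h.symm⟩

theorem aux {b b' d : SymForm k} (h : Isometric (b.osum d) (b'.osum d)) (c : SymForm k) :
    Isometric ((b.osum c).osum d) ((b'.osum c).osum d) := by
  have key (x : SymForm k) : Isometric ((x.osum c).osum d) ((x.osum d).osum c) :=
    (Isometric.osum_assoc x c d).trans
      (((Isometric.refl x).osum (Isometric.osum_comm c d)).trans (Isometric.osum_assoc x d c).symm)
  exact (key b).trans ((h.osum (.refl c)).trans (key b').symm)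

theorem trans {b c d : SymForm k} (h : StablyIsometric b c) (h' : StablyIsometric c d) :
    StablyIsometric b d := by
  obtain ⟨x, h⟩ := h
  obtain ⟨y, h'⟩ := h'
  refine ⟨x.osum y, ?_⟩
  have h1 := h.osum (Isometric.refl y)
  have h2 := aux h' x
  exact (Isometric.osum_assoc b x y).symm.trans
    (h1.trans (h2.trans (Isometric.osum_assoc d x y)))

theorem osum_left {b b' : SymForm k} (h : StablyIsometric b b') (c : SymForm k) :
    StablyIsometric (b.osum c) (b'.osum c) := by
  obtain ⟨d, h⟩ := h
  exact ⟨d, aux h c⟩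

theorem of_isometric {b c : SymForm k} (h : Isometric b c) : StablyIsometric b c :=
  ⟨zero, h.osum (.refl _)⟩

theorem osum_right {c c' : SymForm k} (b : SymForm k) (h : StablyIsometric c c') :
    StablyIsometric (b.osum c) (b.osum c') :=
  (of_isometric (.osum_comm b c)).trans ((h.osum_left b).trans (of_isometric (.osum_comm c' b)))

theorem tensor_left {b b' : SymForm k} (h : StablyIsometric b b') (c : SymForm k) :
    StablyIsometric (b.tensor c) (b'.tensor c) := by
  obtain ⟨d, h⟩ := h
  exact ⟨d.tensor c, (Isometric.osum_tensor b d c).symm.trans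
    ((h.tensor (.refl c)).trans (Isometric.osum_tensor b' d c))⟩

theorem tensor_right {c c' : SymForm k} (b : SymForm k) (h : StablyIsometric c c') :
    StablyIsometric (b.tensor c) (b.tensor c') :=
  (of_isometric (.tensor_comm b c)).trans
    ((h.tensor_left b).trans (of_isometric (.tensor_comm c' b)))

theorem dim_eq {b c : SymForm k} (h : StablyIsometric b c) : b.dim = c.dim := by
  obtain ⟨d, h⟩ := h
  exact Nat.add_right_cancel h.dim_eq

theorem det_eq {b c : SymForm k} (h : StablyIsometric b c) :
    (QuotientGroup.mk b.det : kˣ ⧸ Subgroup.square kˣ) = QuotientGroup.mk c.det := by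
  obtain ⟨d, h⟩ := h
  obtain ⟨u, hu⟩ := h.det_eq
  rw [det_osum, det_osum, ← mul_assoc] at hu
  rw [mul_right_cancel hu, QuotientGroup.eq, Subgroup.mem_square]
  refine ⟨u⁻¹, ?_⟩
  rw [inv_mul_eq_iff_eq_mul, sq, mul_mul_mul_comm, mul_assoc u]
  simp [mul_comm]

end StablyIsometric

end SymForm

section MWs
variable (k : Type*) [Field k]

/-- Stable isometry as a setoid. -/
def stableSetoid : Setoid (SymForm k) where
  r := SymForm.StablyIsometric
  iseqv := ⟨.refl, .symm, .trans⟩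

/-- The stable Witt monoid `MWˢ(k)` of stable isomorphism classes of non-degenerate symmetric
bilinear forms. -/
def MWs : Type _ := Quotient (stableSetoid k)

variable {k}
namespace MWs

/-- The stable class of a form. -/
def mk (b : SymForm k) : MWs k := Quotient.mk (stableSetoid k) b

/-- Orthogonal sum of stable classes. -/
def osum : MWs k → MWs k → MWs k :=
  Quotient.map₂ SymForm.osum fun _ b' h c _ h' =>
    (SymForm.StablyIsometric.osum_left h c).trans (SymForm.StablyIsometric.osum_right b' h')

/-- Tensor product of stable classes. -/
def tensor : MWs k → MWs k → MWs k :=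
  Quotient.map₂ SymForm.tensor fun _ b' h c _ h' =>
    (SymForm.StablyIsometric.tensor_left h c).trans (SymForm.StablyIsometric.tensor_right b' h')

/-- The rank of a stable class. -/
def dim : MWs k → ℕ := Quotient.lift SymForm.dim fun _ _ h => SymForm.StablyIsometric.dim_eq h

/-- The discriminant `MWˢ(k) → kˣ / kˣ²`: the class of the determinant of a Gram matrix. -/
def disc : MWs k → kˣ ⧸ Subgroup.square kˣ :=
  Quotient.lift (fun b => QuotientGroup.mk b.det) fun _ _ h => SymForm.StablyIsometric.det_eq h

theorem dim_osum (b c : MWs k) : (b.osum c).dim = b.dim + c.dim :=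
  Quotient.inductionOn₂ b c fun _ _ => rfl

theorem dim_tensor (b c : MWs k) : (b.tensor c).dim = b.dim * c.dim :=
  Quotient.inductionOn₂ b c fun _ _ => rfl

theorem disc_osum (b c : MWs k) : (b.osum c).disc = b.disc * c.disc :=
  Quotient.inductionOn₂ b c fun b c =>
    congrArg (QuotientGroup.mk (s := Subgroup.square kˣ)) (SymForm.det_osum b c)

theorem disc_tensor (b c : MWs k) : (b.tensor c).disc = b.disc ^ c.dim * c.disc ^ b.dim :=
  Quotient.inductionOn₂ b c fun b c =>
    congrArg (QuotientGroup.mk (s := Subgroup.square kˣ)) (SymForm.det_tensor b c)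

end MWs

variable (k) in
/-- The graded set `∐ₙ MWˢₙ(k) ×_{kˣ/kˣ²} kˣ`: pairs `(b, λ)` such that the discriminant of `b` is the
class of `λ`. The component of degree `0` is by convention the single pair `(0, 1)`, as the Gram
determinant of the form of rank `0` is `1`. -/
@[ext]
structure MWdet where
  form : MWs k
  scalar : kˣ
  disc_eq : form.disc = QuotientGroup.mk scalar
  scalar_eq_one : form.dim = 0 → scalar = 1

namespace MWdet

/-- The pair `(0, 1)`, neutral for `⊕`. -/
def zero : MWdet k where
  form := MWs.mk SymForm.zero
  scalar := 1
  disc_eq := by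
    have : (SymForm.zero : SymForm k).det = 1 := by
      ext; exact Matrix.det_fin_zero (A := (0 : Matrix (Fin 0) (Fin 0) k))
    exact congrArg _ this
  scalar_eq_one _ := rfl

/-- The pair `(⟨1⟩, 1)`, neutral for `∘`. -/
def one : MWdet k where
  form := MWs.mk SymForm.one
  scalar := 1
  disc_eq := by
    have : (SymForm.one : SymForm k).det = 1 := by ext; exact Matrix.det_one
    exact congrArg _ this
  scalar_eq_one _ := rfl

/-- The degree of `(b, λ)` is the rank of `b`. -/
def deg (x : MWdet k) : ℕ := x.form.dim

/-- `(b₁, λ₁) ⊕ (b₂, λ₂) = (b₁ ⊕ b₂, λ₁ λ₂)`. -/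
def osum (x y : MWdet k) : MWdet k where
  form := x.form.osum y.form
  scalar := x.scalar * y.scalar
  disc_eq := by rw [MWs.disc_osum, x.disc_eq, y.disc_eq]; rfl
  scalar_eq_one h := by
    rw [MWs.dim_osum, Nat.add_eq_zero_iff] at h
    rw [x.scalar_eq_one h.1, y.scalar_eq_one h.2, one_mul]

/-- `(b₁, λ₁) ∘ (b₂, λ₂) = (b₁ ⊗ b₂, λ₁^{dim b₂} λ₂^{(dim b₁)²})`. -/
def comp (x y : MWdet k) : MWdet k where
  form := x.form.tensor y.form
  scalar := x.scalar ^ y.form.dim * y.scalar ^ (x.form.dim ^ 2)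
  disc_eq := by
    rw [MWs.disc_tensor, x.disc_eq, y.disc_eq, ← QuotientGroup.mk_pow, ← QuotientGroup.mk_pow,
      ← QuotientGroup.mk_mul, QuotientGroup.eq, Subgroup.mem_square]
    obtain ⟨m, hm⟩ : Even (x.form.dim * (x.form.dim - 1)) := Nat.even_mul_pred_self _
    refine ⟨y.scalar ^ m, ?_⟩
    rw [← pow_add, ← hm, inv_mul_eq_iff_eq_mul, mul_assoc, ← pow_add]
    congr 2
    rcases x.form.dim with _ | n
    · rfl
    · rw [Nat.add_sub_cancel]; ring
  scalar_eq_one h := by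
    rw [MWs.dim_tensor, Nat.mul_eq_zero] at h
    rcases h with h | h
    · rw [x.scalar_eq_one h, h]; simp
    · rw [y.scalar_eq_one h, h]; simp

end MWdet
end MWs

/-! ### Graded bi-monoids -/

/-- A graded bi-monoid: a set with two monoid laws, such that the degree is additive for the first
and multiplicative for the second. No distributivity is required. -/
structure IsGradedBimonoid {M : Type*} (deg : M → ℕ) (add : M → M → M) (zero : M)
    (comp : M → M → M) (one : M) : Prop where
  add_assoc : ∀ x y z, add (add x y) z = add x (add y z)
  zero_add : ∀ x, add zero x = x
  add_zero : ∀ x, add x zero = x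
  comp_assoc : ∀ x y z, comp (comp x y) z = comp x (comp y z)
  one_comp : ∀ x, comp one x = x
  comp_one : ∀ x, comp x one = x
  deg_zero : deg zero = 0
  deg_add : ∀ x y, deg (add x y) = deg x + deg y
  deg_one : deg one = 1
  deg_comp : ∀ x y, deg (comp x y) = deg x * deg y

end NaiveP1

end

open NaiveP1

/-! ### Monoid laws on pointed rational functions -/

noncomputable section
namespace NaiveP1
open Polynomial

namespace PtRat
variable {R : Type*} [CommRing R]

/-! The Bézout form is compatible with both laws for formal reasons, and the two sides can be
compared through generators of degree one, `X/u` and `(⟨u⟩, u)`. A sum with `X/u` adds the rank one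
term `u A(X) A(Y)` to the Bézout polynomial δ, hence a summand `⟨u⟩` (`isometric_lin_naiveSum`). For
a composite, homogenizing the identity that defines δ exhibits the Bézout polynomial of `g` as a
factor of that of `f ∘ g` (`bezPoly_comp`), hence the tensor product (`isometric_comp`).
Determinants are controlled by the Sylvester matrix (`det_bez`) and by factoring the numerator of
`f` over an algebraic closure (`res_comp`).

The map is well defined on homotopy classes because a symmetric matrix over `k[T]` with invertible
determinant has stably isometric values at 0 and 1 (`endsAgree`). Higman's trick adds metabolic
forms until the entries have degree at most one. In an invertible pencil `A₀ + T A₁` the matrix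
`A₀⁻¹ A₁` is nilpotent; if it is nonzero, a vector in both its kernel and its image splits off a
metabolic plane. Metabolic forms of a given rank are all stably isometric (`stClass_metab`), in
every characteristic. The determinant is a unit of `k[T]`, hence constant.

Euclid's algorithm and explicit deformations write each class as a sum of functions `X/u`
(`exists_word`). Dually, each stable class of forms is diagonal (`exists_mk_diagForm`), and the
scalar can be corrected by a square in one diagonal entry, which gives surjectivity.

For injectivity, degree two is treated by hand: shears of a 2×2 Gram matrix are homotopies, so `X/u
⊕ X/v` may start with any unit represented by `⟨u, v⟩`, and with any unit at all if this form is
isotropic. Iterating gives `exists_word_cons`. If two diagonal forms of rank `n` are stably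
isometric, they agree on a subspace of `kⁿ × kⁿ` of dimension at least `n`
(`exists_subspace_of_congr`). Hence either they have a common nonzero value or both are isotropic.
In either case the two words can be made to start with the same letter, which cancels stably, and
induction on the length concludes (`word_injective`). -/

@[simp] theorem deg_infty [Nontrivial R] : (infty : PtRat R).deg = 0 := natDegree_one

@[simp] theorem deg_ident [Nontrivial R] : (ident : PtRat R).deg = 1 := natDegree_X

theorem naiveSum_num (f g : PtRat R) :
    (f.naiveSum g).num = f.num * g.num - f.bezV * g.den := rfl

theorem naiveSum_den (f g : PtRat R) :
    (f.naiveSum g).den = f.den * g.num + f.bezU * g.den := rfl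

theorem comp_num (f g : PtRat R) : (f.comp g).num = homEval f.deg f.num g.num g.den := rfl

theorem comp_den (f g : PtRat R) : (f.comp g).den = homEval f.deg f.den g.num g.den := rfl

theorem natDegree_den_le (f : PtRat R) : f.den.natDegree ≤ f.deg :=
  natDegree_le_natDegree f.degree_lt.le

theorem degree_num (f : PtRat R) : f.num.degree = f.deg := by
  have := f.nontrivial
  exact degree_eq_natDegree f.monic.ne_zero

theorem deg_naiveSum (f g : PtRat R) : (f.naiveSum g).deg = f.deg + g.deg := by
  have hlt : (f.bezV * g.den).degree < (f.num * g.num).degree :=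
    degree_mul_lt_left g.monic f.monic f.degree_bezV_lt.le g.degree_lt
  rw [deg, naiveSum_num, natDegree_eq_of_degree_eq (degree_sub_eq_left_of_degree_lt hlt),
    f.monic.natDegree_mul g.monic]
  rfl

theorem deg_comp (f g : PtRat R) : (f.comp g).deg = f.deg * g.deg := by
  have hlt : (homEval f.deg (f.num - X ^ f.deg) g.num g.den).degree < (g.num ^ f.deg).degree :=
    degree_homEval_lt g.monic g.degree_lt _ f.coeff_sub_X_pow
  rw [deg, comp_num, homEval_split f.deg f.monic rfl, natDegree_add_eq_left_of_degree_lt hlt,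
    g.monic.natDegree_pow]
  rfl

/-- The second column of the product of the matrices `[A, -V; B, U]`, which have determinant 1,
satisfies the degree bound, so uniqueness of the Bézout relation identifies it. Hence the naive sum
is matrix multiplication, and associativity follows. -/
theorem bez_naiveSum (f g : PtRat R) :
    (f.naiveSum g).bezU = f.bezU * g.bezU - f.den * g.bezV ∧
      (f.naiveSum g).bezV = f.num * g.bezV + f.bezV * g.bezU := by
  have hlt : (f.bezV * g.den).degree < (f.num * g.num).degree :=
    degree_mul_lt_left g.monic f.monic f.degree_bezV_lt.le g.degree_lt
  refine (f.naiveSum g).bezout_unique (f.naiveSum g).bezout (f.naiveSum g).degree_bezV_lt ?_ ?_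
  · rw [naiveSum_num, naiveSum_den]
    linear_combination (f.num * f.bezU + f.den * f.bezV) * g.bezout + f.bezout
  · rw [naiveSum_num, degree_sub_eq_left_of_degree_lt hlt]
    refine (degree_add_le _ _).trans_lt (max_lt ?_ ?_)
    · exact degree_mul_lt_left g.monic f.monic le_rfl g.degree_bezV_lt
    · rw [mul_comm, mul_comm f.num]
      exact degree_mul_lt_left f.monic g.monic g.degree_bezU_le f.degree_bezV_lt

theorem naiveSum_assoc (f g h : PtRat R) :
    (f.naiveSum g).naiveSum h = f.naiveSum (g.naiveSum h) := by
  obtain ⟨hU, hV⟩ := bez_naiveSum f g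
  ext1
  · simp only [naiveSum_num, naiveSum_den, hV]
    ring
  · simp only [naiveSum_num, naiveSum_den, hU]
    ring

theorem bez_infty [Nontrivial R] :
    (infty : PtRat R).bezU = 1 ∧ (infty : PtRat R).bezV = 0 :=
  infty.bezout_unique infty.bezout infty.degree_bezV_lt
    (by change (1 : R[X]) * 1 + 0 * 0 = 1; simp) (by change (0 : R[X]).degree < degree 1; simp)

theorem infty_naiveSum [Nontrivial R] (f : PtRat R) : infty.naiveSum f = f := by
  ext1
  · rw [naiveSum_num, bez_infty.2]; change 1 * f.num - _ = _; simp
  · rw [naiveSum_den, bez_infty.1]; change 0 * f.num + _ = _; simp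

theorem naiveSum_infty [Nontrivial R] (f : PtRat R) : f.naiveSum infty = f := by
  ext1
  · rw [naiveSum_num]; change f.num * 1 - _ * 0 = _; simp
  · rw [naiveSum_den]; change f.den * 1 + _ * 0 = _; simp

theorem homEval_add (n : ℕ) (P Q C D : R[X]) :
    homEval n (P + Q) C D = homEval n P C D + homEval n Q C D := by
  simp only [homEval_eq, homogenize_add, map_add]

theorem homEval_sum {ι : Type*} (s : Finset ι) (n : ℕ) (P : ι → R[X]) (C D : R[X]) :
    homEval n (∑ i ∈ s, P i) C D = ∑ i ∈ s, homEval n (P i) C D := by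
  simp only [homEval_eq, homogenize_finsetSum, map_sum]

theorem homEval_mul {a b : ℕ} {P Q : R[X]} (hP : P.natDegree ≤ a) (hQ : Q.natDegree ≤ b)
    (C D : R[X]) : homEval (a + b) (P * Q) C D = homEval a P C D * homEval b Q C D := by
  simp only [homEval_eq, homogenize_mul P Q hP hQ, map_mul]

theorem homEval_one (n : ℕ) (C D : R[X]) : homEval n 1 C D = D ^ n := by
  simp [homEval_eq]

theorem homEval_C (n : ℕ) (r : R) (E D : R[X]) : homEval n (C r) E D = C r * D ^ n := by
  simp [homEval_eq]

theorem homEval_C_mul (n : ℕ) (r : R) (P E D : R[X]) :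
    homEval n (C r * P) E D = C r * homEval n P E D := by
  simp [homEval_eq]

theorem homEval_pow {a : ℕ} {P : R[X]} (hP : P.natDegree ≤ a) (C D : R[X]) (i : ℕ) :
    homEval (i * a) (P ^ i) C D = homEval a P C D ^ i := by
  induction i with
  | zero => simp [homEval_one]
  | succ i ih =>
    rw [pow_succ, add_mul, one_mul, homEval_mul (natDegree_pow_le_of_le i hP) hP, ih, pow_succ]

/-- Each term `Eⁱ F^(m-i)` has formal degree `m n`, and homogenization is multiplicative for formal
degrees. This substitution rule is associativity of composition. -/
theorem homEval_homEval {m n : ℕ} {P E F : R[X]} (hE : E.natDegree ≤ n) (hF : F.natDegree ≤ n)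
    (G H : R[X]) :
    homEval (m * n) (homEval m P E F) G H = homEval m P (homEval n E G H) (homEval n F G H) := by
  rw [homEval.eq_1 m P E F, homEval_sum, homEval.eq_1 m P]
  refine Finset.sum_congr rfl fun i hi => ?_
  rw [Finset.mem_range] at hi
  rw [mul_assoc, homEval_C_mul, show m * n = i * n + (m - i) * n by rw [← add_mul]; congr; omega,
    homEval_mul (natDegree_pow_le_of_le i hE) (natDegree_pow_le_of_le _ hF), homEval_pow hE,
    homEval_pow hF, mul_assoc]

theorem homEval_X (C D : R[X]) : homEval 1 X C D = C := by
  simp [homEval, coeff_X]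

theorem homEval_X_one {n : ℕ} {P : R[X]} (hP : P.natDegree ≤ n) : homEval n P X 1 = P := by
  rw [P.as_sum_range_C_mul_X_pow' (Nat.lt_succ_of_le hP), homEval]
  refine Finset.sum_congr rfl fun i hi => ?_
  -- The expansion of `P` also went into the coefficients on the left; it is folded back there.
  rw [← P.as_sum_range_C_mul_X_pow' (Nat.lt_succ_of_le hP), one_pow, mul_one]

theorem comp_assoc (f g h : PtRat R) : (f.comp g).comp h = f.comp (g.comp h) := by
  have hd := deg_comp f g
  ext1
  · rw [comp_num, hd, comp_num, homEval_homEval (n := g.deg) le_rfl g.natDegree_den_le]; rfl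
  · rw [comp_den, hd, comp_den, homEval_homEval (n := g.deg) le_rfl g.natDegree_den_le]; rfl

theorem ident_comp [Nontrivial R] (f : PtRat R) : ident.comp f = f := by
  ext1
  · rw [comp_num, deg_ident]; exact homEval_X _ _
  · rw [comp_den, deg_ident]; exact (homEval_one 1 f.num f.den).trans (pow_one _)

theorem comp_ident [Nontrivial R] (f : PtRat R) : f.comp ident = f := by
  ext1
  · exact homEval_X_one le_rfl
  · exact homEval_X_one f.natDegree_den_le

end PtRat

/-! ### Bi-monoid axioms for homotopy classes and for forms with a scalar -/

section
variable (k : Type*) [Field k]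

theorem isGradedBimonoid_PP :
    IsGradedBimonoid (M := PP k) PP.deg PP.naiveSum PP.zero PP.comp PP.one where
  add_assoc := by
    rintro ⟨f⟩ ⟨g⟩ ⟨h⟩; exact congrArg PP.mk (f.naiveSum_assoc g h)
  zero_add := by rintro ⟨f⟩; exact congrArg PP.mk f.infty_naiveSum
  add_zero := by rintro ⟨f⟩; exact congrArg PP.mk f.naiveSum_infty
  comp_assoc := by rintro ⟨f⟩ ⟨g⟩ ⟨h⟩; exact congrArg PP.mk (f.comp_assoc g h)
  one_comp := by rintro ⟨f⟩; exact congrArg PP.mk f.ident_comp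
  comp_one := by rintro ⟨f⟩; exact congrArg PP.mk f.comp_ident
  deg_zero := PtRat.deg_infty
  deg_add := by rintro ⟨f⟩ ⟨g⟩; exact f.deg_naiveSum g
  deg_one := PtRat.deg_ident
  deg_comp := by rintro ⟨f⟩ ⟨g⟩; exact f.deg_comp g

variable {k}
open Matrix
open scoped Kronecker

namespace SymForm

theorem Isometric.of_equiv {b c : SymForm k} (e : Fin b.dim ≃ Fin c.dim)
    (h : ∀ i j, b.mat i j = c.mat (e i) (e j)) : Isometric b c := Congr.of_equiv e h

theorem Isometric.zero_osum (b : SymForm k) : Isometric (SymForm.zero.osum b) b := by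
  refine (osum_congr_aux _ _).trans (Congr.of_equiv (Equiv.emptySum (Fin 0) _) ?_)
  rintro (i | i) (j | j)
  · exact i.elim0
  · exact i.elim0
  · exact j.elim0
  · rfl

theorem Isometric.tensor_assoc (b c d : SymForm k) :
    Isometric ((b.tensor c).tensor d) (b.tensor (c.tensor d)) := by
  refine ((tensor_congr_aux _ d).trans ((tensor_congr_aux b c).kronecker (.refl _))).trans
    (Congr.trans ?_ (((Congr.refl _).kronecker (tensor_congr_aux c d)).symm.trans
      (tensor_congr_aux b _).symm))
  refine Congr.of_equiv (Equiv.prodAssoc _ _ _) ?_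
  rintro ⟨⟨i, i'⟩, i''⟩ ⟨⟨j, j'⟩, j''⟩
  simp [Matrix.kroneckerMap_apply, mul_assoc]

theorem Isometric.one_tensor (b : SymForm k) : Isometric (SymForm.one.tensor b) b := by
  refine (tensor_congr_aux _ _).trans (Congr.of_equiv (Equiv.uniqueProd _ (Fin 1)) ?_)
  rintro ⟨i, i'⟩ ⟨j, j'⟩
  have : (SymForm.one : SymForm k).mat i j = 1 := by
    rw [Subsingleton.elim (α := Fin 1) i j]; exact Matrix.one_apply_eq (n := Fin 1) j
  rw [Matrix.kroneckerMap_apply, this, one_mul]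
  rfl

end SymForm

namespace MWs

theorem mk_eq_of_isometric {b c : SymForm k} (h : SymForm.Isometric b c) : mk b = mk c :=
  Quotient.sound (.of_isometric h)

theorem mk_eq_iff {b c : SymForm k} : mk b = mk c ↔ SymForm.StablyIsometric b c :=
  ⟨fun h => Quotient.exact h, fun h => Quotient.sound h⟩

theorem osum_comm (x y : MWs k) : x.osum y = y.osum x := by
  induction x, y using Quotient.inductionOn₂
  exact mk_eq_of_isometric (.osum_comm _ _)

theorem tensor_comm (x y : MWs k) : x.tensor y = y.tensor x := by
  induction x, y using Quotient.inductionOn₂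
  exact mk_eq_of_isometric (.tensor_comm _ _)

theorem osum_assoc (x y z : MWs k) : (x.osum y).osum z = x.osum (y.osum z) := by
  induction x, y, z using Quotient.inductionOn₃
  exact mk_eq_of_isometric (.osum_assoc _ _ _)

theorem tensor_assoc (x y z : MWs k) : (x.tensor y).tensor z = x.tensor (y.tensor z) := by
  induction x, y, z using Quotient.inductionOn₃
  exact mk_eq_of_isometric (.tensor_assoc _ _ _)

theorem zero_osum (x : MWs k) : (mk SymForm.zero).osum x = x := by
  induction x using Quotient.inductionOn
  exact mk_eq_of_isometric (.zero_osum _)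

theorem one_tensor (x : MWs k) : (mk SymForm.one).tensor x = x := by
  induction x using Quotient.inductionOn
  exact mk_eq_of_isometric (.one_tensor _)

end MWs

variable (k) in
theorem isGradedBimonoid_MWdet :
    IsGradedBimonoid (M := MWdet k) MWdet.deg MWdet.osum MWdet.zero MWdet.comp MWdet.one where
  add_assoc x y z := by
    ext1
    · exact MWs.osum_assoc _ _ _
    · exact mul_assoc _ _ _
  zero_add x := by
    ext1
    · exact MWs.zero_osum _
    · exact one_mul _
  add_zero x := by
    ext1
    · exact (MWs.osum_comm _ _).trans (MWs.zero_osum _)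
    · exact mul_one _
  comp_assoc x y z := by
    ext1
    · exact MWs.tensor_assoc _ _ _
    · change (x.scalar ^ y.form.dim * y.scalar ^ (x.form.dim ^ 2)) ^ z.form.dim *
        z.scalar ^ ((x.form.tensor y.form).dim ^ 2) = x.scalar ^ (y.form.tensor z.form).dim *
        (y.scalar ^ z.form.dim * z.scalar ^ (y.form.dim ^ 2)) ^ (x.form.dim ^ 2)
      rw [MWs.dim_tensor, MWs.dim_tensor]
      simp only [mul_pow, ← pow_mul, mul_assoc]
      congr 3 <;> ring
  one_comp x := by
    ext1
    · exact MWs.one_tensor _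
    · change 1 ^ _ * x.scalar ^ (1 ^ 2) = _
      simp
  comp_one x := by
    ext1
    · exact (MWs.tensor_comm _ _).trans (MWs.one_tensor _)
    · change x.scalar ^ 1 * 1 ^ _ = _
      simp
  deg_zero := rfl
  deg_add x y := MWs.dim_osum _ _
  deg_one := rfl
  deg_comp x y := MWs.dim_tensor _ _

end
end NaiveP1
end

/-! ### Symmetry and determinant of the Bézout matrix -/

noncomputable section
namespace NaiveP1
open Polynomial

theorem sign_revPerm (n : ℕ) : Equiv.Perm.sign (Fin.revPerm (n := n)) =
    (-1) ^ (n * (n - 1) / 2) := by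
  rw [Equiv.Perm.sign_eq_prod_prod_Ioi]
  have h (i : Fin n) : ∏ j ∈ Finset.Ioi i, (if Fin.revPerm i < Fin.revPerm j then 1 else -1 : ℤˣ) =
      (-1) ^ (n - 1 - i : ℕ) := by
    rw [Finset.prod_congr rfl (g := fun _ => (-1 : ℤˣ)), Finset.prod_const, Fin.card_Ioi]
    intro j hj
    rw [Finset.mem_Ioi] at hj
    rw [if_neg]
    simpa using hj.le
  rw [Finset.prod_congr rfl fun i _ => h i, Finset.prod_pow_eq_pow_sum,
    Fin.sum_univ_eq_sum_range (fun i => n - 1 - i) n, Finset.sum_range_reflect (fun i => i) n,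
    Finset.sum_range_id]

/-- Reversing the rows produces a lower triangular matrix with ones on the diagonal, so only the
sign of the reversal remains. -/
theorem det_antitriangular {R : Type*} [CommRing R] {n : ℕ} (T : Matrix (Fin n) (Fin n) R)
    (h0 : ∀ i j : Fin n, n ≤ i + j → T i j = 0) (h1 : ∀ i j : Fin n, i + j + 1 = n → T i j = 1) :
    T.det = (-1) ^ (n * (n - 1) / 2) := by
  have h := Matrix.det_permute Fin.revPerm T
  have hT : (T.submatrix Fin.revPerm id).det = 1 := by
    rw [Matrix.det_of_isLowerTriangular]
    · refine Finset.prod_eq_one fun i _ => h1 _ _ ?_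
      simp [Fin.val_rev]; omega
    · intro i j hij
      have h3 : (i : ℕ) < j := hij
      refine h0 _ _ ?_
      rw [Fin.revPerm_apply, Fin.val_rev]
      simp only [id]
      omega
  rw [hT, sign_revPerm] at h
  push_cast at h
  have h2 : ((-1 : R) ^ (n * (n - 1) / 2)) * (-1) ^ (n * (n - 1) / 2) = 1 := by
    rw [← mul_pow]; simp
  linear_combination (-(-1 : R) ^ (n * (n - 1) / 2)) * h - T.det * h2

namespace PtRat
variable {R S : Type*} [CommRing R] [CommRing S]

/-- `X - Y` is monic, so it cancels over any commutative ring. Closed formulas for δ are checked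
after multiplication by it. -/
theorem eq_bezPoly (f : PtRat R) {P : R[X][X]}
    (h : (X - C X) * P = f.num.map C * C f.den - C f.num * f.den.map C) : P = f.bezPoly :=
  (monic_X_sub_C (X : R[X])).isRegular.left (h.trans f.bezPoly_mul.symm)

/-- Exchanging the variables changes the sign of both `X - Y` and the numerator. -/
theorem swap_bezPoly (f : PtRat R) : Bivariate.swap f.bezPoly = f.bezPoly := by
  refine f.eq_bezPoly ?_
  have h := congrArg (Bivariate.swap (R := R)) f.bezPoly_mul
  rw [map_mul, map_sub, map_sub, map_mul, map_mul, Bivariate.swap_X, Bivariate.swap_Y,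
    Bivariate.swap_map_C, Bivariate.swap_map_C, Bivariate.swap_C, Bivariate.swap_C] at h
  linear_combination -h

theorem coeff_coeff_swap (P : R[X][X]) (i j : ℕ) :
    ((Bivariate.swap P).coeff i).coeff j = (P.coeff j).coeff i := by
  induction P using Polynomial.induction_on' with
  | add p q hp hq => simp [hp, hq]
  | monomial n a =>
    rw [Bivariate.swap_monomial, coeff_mul_C, coeff_map, coeff_C_mul, coeff_X_pow, coeff_monomial]
    rcases eq_or_ne n j with rfl | h
    · simp
    · simp [h, h.symm]

theorem coeff_bezPoly_comm (f : PtRat R) (i j : ℕ) :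
    (f.bezPoly.coeff i).coeff j = (f.bezPoly.coeff j).coeff i := by
  conv_lhs => rw [← f.swap_bezPoly, coeff_coeff_swap]

theorem bez_isSymm (f : PtRat R) : f.bez.IsSymm := by
  ext i j
  exact f.coeff_bezPoly_comm _ _

theorem coeff_num_eq_zero (f : PtRat R) {i : ℕ} (h : f.deg < i) : f.num.coeff i = 0 :=
  coeff_eq_zero_of_natDegree_lt h

theorem coeff_den_eq_zero (f : PtRat R) {i : ℕ} (h : f.deg ≤ i) : f.den.coeff i = 0 :=
  coeff_eq_zero_of_degree_lt (f.degree_lt.trans_le (f.degree_num.trans_le (by exact_mod_cast h)))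

/-- Compare coefficients of `X^(p+1)` in `(X - Y) δ`. The recursion descends in `p`. -/
theorem coeff_bezPoly_rec (f : PtRat R) (p : ℕ) :
    f.bezPoly.coeff p =
      X * f.bezPoly.coeff (p + 1) + C (f.num.coeff (p + 1)) * f.den -
        C (f.den.coeff (p + 1)) * f.num := by
  have h := congrArg (fun P => P.coeff (p + 1)) f.bezPoly_mul
  simp only [sub_mul, coeff_sub, coeff_X_mul, coeff_C_mul, coeff_mul_C, coeff_map] at h
  linear_combination h

/-- The polynomial `∑ pⱼ₊ᵢ₊₁ Xʲ`, with `n` terms. -/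
def tail (n : ℕ) (P : R[X]) (i : ℕ) : R[X] :=
  ∑ j ∈ Finset.range n, C (P.coeff (j + i + 1)) * X ^ j

theorem tail_rec {n : ℕ} {P : R[X]} (hP : P.natDegree ≤ n) (i : ℕ) :
    tail n P i = C (P.coeff (i + 1)) + X * tail n P (i + 1) := by
  have h := Finset.sum_range_succ (fun j => C (P.coeff (j + i + 1)) * X ^ j) n
  rw [Finset.sum_range_succ', coeff_eq_zero_of_natDegree_lt (show P.natDegree < n + i + 1 by omega),
    map_zero, zero_mul, add_zero (Finset.sum _ _)] at h
  rw [tail, ← h, tail, Finset.mul_sum, add_comm, pow_zero, mul_one, zero_add]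
  congr 1
  refine Finset.sum_congr rfl fun j _ => ?_
  rw [show j + 1 + i + 1 = j + (i + 1) + 1 by omega]
  ring

theorem tail_eq_zero {n : ℕ} {P : R[X]} {i : ℕ} (hP : P.natDegree ≤ i) : tail n P i = 0 :=
  Finset.sum_eq_zero fun j _ => by
    rw [coeff_eq_zero_of_natDegree_lt (by omega), map_zero, zero_mul]

theorem coeff_bezPoly_eq (f : PtRat R) (p : ℕ) :
    f.bezPoly.coeff p = f.den * tail f.deg f.num p - f.num * tail f.deg f.den p := by
  -- Downward induction on `p`, started where δ and both tails vanish.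
  have key (m : ℕ) : ∀ p, max f.deg (f.bezPoly.natDegree + 1) ≤ p + m → f.bezPoly.coeff p =
      f.den * tail f.deg f.num p - f.num * tail f.deg f.den p := by
    induction m with
    | zero =>
      intro p hp
      rw [coeff_eq_zero_of_natDegree_lt (by omega), tail_eq_zero (P := f.num),
        tail_eq_zero (P := f.den)]
      · simp
      · exact f.natDegree_den_le.trans (by omega)
      · change f.deg ≤ p; omega
    | succ m ih =>
      intro p hp
      rw [coeff_bezPoly_rec, ih (p + 1) (by omega), tail_rec (n := f.deg) (P := f.num) le_rfl p,
        tail_rec f.natDegree_den_le p]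
      ring
  exact key _ p (Nat.le_add_left _ _)

theorem coeff_bezPoly_eq_zero (f : PtRat R) {p : ℕ} (h : f.deg ≤ p) : f.bezPoly.coeff p = 0 := by
  rw [coeff_bezPoly_eq, tail_eq_zero (P := f.num) h, tail_eq_zero (f.natDegree_den_le.trans h)]
  simp

theorem sylvester_castAdd (f : PtRat R) (i : Fin (f.deg + f.deg)) (j : Fin f.deg) :
    sylvester f.num f.den f.deg f.deg i (Fin.castAdd _ j) = (f.den * X ^ (j : ℕ)).coeff i := by
  rw [sylvester, Matrix.of_apply, Fin.addCases_left, coeff_mul_X_pow']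
  simp only [Set.mem_Icc]
  by_cases h : (j : ℕ) ≤ i
  · by_cases h' : (i : ℕ) ≤ j + f.deg
    · simp [h, h']
    · rw [if_neg (by simp [h']), if_pos h, f.coeff_den_eq_zero (by omega)]
  · simp [h]

theorem sylvester_natAdd (f : PtRat R) (i : Fin (f.deg + f.deg)) (j : Fin f.deg) :
    sylvester f.num f.den f.deg f.deg i (Fin.natAdd _ j) = (f.num * X ^ (j : ℕ)).coeff i := by
  rw [sylvester, Matrix.of_apply, Fin.addCases_right, coeff_mul_X_pow']
  simp only [Set.mem_Icc]
  by_cases h : (j : ℕ) ≤ i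
  · by_cases h' : (i : ℕ) ≤ j + f.deg
    · simp [h, h']
    · rw [if_neg (by simp [h']), if_pos h, f.coeff_num_eq_zero (by omega)]
  · simp [h]

-- The columns of the Sylvester matrix are the shifts of `B`, then those of `A`. By
-- `coeff_bezPoly_eq`, the coefficients of δ are combinations of these columns with weights from the
-- tails of `A` and `-B`. So multiplication by `U = [T, 0; L, 1]` gives a block upper triangular
-- matrix with diagonal blocks the transposed Bézout matrix and a unitriangular one, while `det U =
-- det T` is the sign of an antitriangular matrix.
open Matrix in
theorem det_bez (f : PtRat R) :
    f.bez.det = (-1) ^ (f.deg * (f.deg - 1) / 2) * f.res := by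
  set n := f.deg with hn
  let T : Matrix (Fin n) (Fin n) R := .of fun i j => f.num.coeff (i + j + 1)
  let L : Matrix (Fin n) (Fin n) R := .of fun i j => -f.den.coeff (i + j + 1)
  let U : Matrix (Fin n ⊕ Fin n) (Fin n ⊕ Fin n) R := fromBlocks T 0 L 1
  let M := (sylvester f.num f.den n n).submatrix finSumFinEquiv finSumFinEquiv
  let A₁ : Matrix (Fin n) (Fin n) R := .of fun i j => (f.num * X ^ (j : ℕ)).coeff i
  let A₂ : Matrix (Fin n) (Fin n) R := .of fun i j => (f.num * X ^ (j : ℕ)).coeff (n + i)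
  have hinl (i : Fin (n + n)) (q : Fin n) :
      ∑ j : Fin n, sylvester f.num f.den n n i (Fin.castAdd _ j) * T j q +
      ∑ j : Fin n, sylvester f.num f.den n n i (Fin.natAdd _ j) * L j q =
      (f.bezPoly.coeff q).coeff i := by
    rw [coeff_bezPoly_eq, coeff_sub, tail, tail, Finset.mul_sum, Finset.mul_sum, finsetSum_coeff,
      finsetSum_coeff, Finset.sum_range, Finset.sum_range, sub_eq_add_neg, ← Finset.sum_neg_distrib]
    congr 1 <;> refine Finset.sum_congr rfl fun j _ => ?_
    · rw [sylvester_castAdd, mul_left_comm, coeff_C_mul, mul_comm]; rfl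
    · rw [sylvester_natAdd, mul_left_comm, coeff_C_mul, mul_comm, ← neg_mul]; rfl
  have hinr (i : Fin (n + n)) (q : Fin n) :
      ∑ j : Fin n, sylvester f.num f.den n n i (Fin.castAdd _ j) * (0 : Matrix (Fin n) (Fin n) R) j q +
      ∑ j : Fin n, sylvester f.num f.den n n i (Fin.natAdd _ j) * (1 : Matrix (Fin n) (Fin n) R) j q =
      (f.num * X ^ (q : ℕ)).coeff i := by
    simpa [Matrix.one_apply] using sylvester_natAdd f i q
  have hMU : M * U = fromBlocks f.bezᵀ A₁ 0 A₂ := by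
    ext (i | i) (j | j) <;> simp only [Matrix.mul_apply, Fintype.sum_sum_type]
    · exact hinl _ _
    · exact hinr _ _
    -- The rows from `n` on vanish, because by symmetry δ has degree less than `n` in `Y` too.
    · refine (hinl _ _).trans ?_
      rw [coeff_bezPoly_comm, coeff_bezPoly_eq_zero]
      · rfl
      · simp [hn]
    · exact hinr _ _
  have h := congrArg Matrix.det hMU
  rw [det_mul, det_submatrix_equiv_self, det_fromBlocks_zero₁₂, det_one, mul_one,
    det_fromBlocks_zero₂₁, det_transpose, det_of_isUpperTriangular (M := A₂),
    Finset.prod_eq_one, mul_one, det_antitriangular T] at h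
  · rw [← h, mul_comm]; rfl
  · intro i j hij
    exact f.coeff_num_eq_zero (by omega)
  · intro i j hij
    change f.num.coeff _ = 1
    rw [hij, hn, f.coeff_num]
  · intro i _
    change (f.num * X ^ (i : ℕ)).coeff (n + i) = 1
    rw [coeff_mul_X_pow, hn, f.coeff_num]
  · intro i j hij
    have hij' : (j : ℕ) < i := hij
    change (f.num * X ^ (j : ℕ)).coeff (n + i) = 0
    rw [coeff_mul_X_pow', if_pos (by omega), f.coeff_num_eq_zero (by omega)]

theorem isUnit_det_bez (f : PtRat R) : IsUnit f.bez.det := by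
  rw [det_bez]
  exact (isUnit_one.neg.pow _).mul f.isUnit_res

theorem bezPoly_map [Nontrivial S] (φ : R →+* S) (f : PtRat R) :
    (f.map φ).bezPoly = f.bezPoly.map (mapRingHom φ) := by
  symm
  refine (f.map φ).eq_bezPoly ?_
  have h := congrArg (Polynomial.map (mapRingHom φ)) f.bezPoly_mul
  have hc (P : R[X]) : (P.map C).map (mapRingHom φ) = (P.map φ).map C := by
    rw [Polynomial.map_map, Polynomial.map_map]
    congr 1
    ext; simp
  simp only [Polynomial.map_mul, Polynomial.map_sub, map_X, map_C, hc, coe_mapRingHom] at h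
  exact h

theorem map_res [Nontrivial S] (φ : R →+* S) (f : PtRat R) : (f.map φ).res = φ f.res := by
  change Polynomial.resultant (f.num.map φ) (f.den.map φ) (f.map φ).deg (f.map φ).deg = _
  rw [deg_map]
  exact resultant_map_map _ _ _ _ _

end PtRat
end NaiveP1
end

/-! ### Bézout forms of sums with X/u and of composites -/

noncomputable section
namespace NaiveP1
open Polynomial

namespace PtRat
section ring
variable {R : Type*} [CommRing R]

theorem bezPoly_expand (f : PtRat R) :
    f.bezPoly = ∑ p : Fin f.deg, ∑ q : Fin f.deg,
      C (C (f.bez p q)) * (X ^ (p : ℕ) : R[X]).map C * C (X ^ (q : ℕ)) := by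
  ext i j
  simp only [finsetSum_coeff, mul_assoc, coeff_C_mul, coeff_mul_C, coeff_map, coeff_X_pow,
    apply_ite C, C_1, C_0, ite_mul, one_mul, zero_mul]
  by_cases hi : i < f.deg
  · by_cases hj : j < f.deg
    · rw [Finset.sum_eq_single ⟨i, hi⟩, Finset.sum_eq_single ⟨j, hj⟩]
      · simp [bez]
      · intro q _ hq
        rw [if_pos rfl, coeff_X_pow, if_neg (fun h => hq (Fin.ext h.symm)), mul_zero]
      · simp
      · intro p _ hp
        rw [Finset.sum_eq_zero]
        intro q _
        rw [if_neg (fun h => hp (Fin.ext h.symm)), coeff_zero, mul_zero]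
      · simp
    · rw [f.coeff_bezPoly_comm, f.coeff_bezPoly_eq_zero (not_lt.1 hj), coeff_zero]
      refine (Finset.sum_eq_zero fun p _ => Finset.sum_eq_zero fun q _ => ?_).symm
      split_ifs
      · rw [coeff_X_pow, if_neg (fun h : j = q => hj (h ▸ q.2)), mul_zero]
      · simp
  · rw [f.coeff_bezPoly_eq_zero (not_lt.1 hi), coeff_zero]
    refine (Finset.sum_eq_zero fun p _ => Finset.sum_eq_zero fun q _ => ?_).symm
    rw [if_neg (fun h : i = p => hi (h ▸ p.2)), coeff_zero, mul_zero]

/-- The bihomogenization in degree `(m, m)` of the identity defining the Bézout polynomial. -/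
theorem bezPoly_homogeneous {T : Type*} [CommRing T] [Algebra R T] (f : PtRat R) (u v s t : T) :
    (u * t - v * s) * ∑ p : Fin f.deg, ∑ q : Fin f.deg, algebraMap R T (f.bez p q) *
        (u ^ (p : ℕ) * v ^ (f.deg - 1 - p)) * (s ^ (q : ℕ) * t ^ (f.deg - 1 - q)) =
      (∑ i ∈ Finset.range (f.deg + 1), algebraMap R T (f.num.coeff i) * u ^ i * v ^ (f.deg - i)) *
        (∑ i ∈ Finset.range (f.deg + 1), algebraMap R T (f.den.coeff i) * s ^ i * t ^ (f.deg - i)) -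
      (∑ i ∈ Finset.range (f.deg + 1), algebraMap R T (f.den.coeff i) * u ^ i * v ^ (f.deg - i)) *
        (∑ i ∈ Finset.range (f.deg + 1), algebraMap R T (f.num.coeff i) * s ^ i * t ^ (f.deg - i)) := by
  set m := f.deg with hm
  let c (i j : ℕ) : R := (f.bezPoly.coeff i).coeff j
  let θ (i j : ℕ) : T := u ^ i * v ^ (m - i) * (s ^ j * t ^ (m - j))
  have hc (i j : ℕ) (h : m ≤ i ∨ m ≤ j) : c i j = 0 := by
    rcases h with h | h
    · change (f.bezPoly.coeff i).coeff j = 0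
      rw [f.coeff_bezPoly_eq_zero h, coeff_zero]
    · change (f.bezPoly.coeff i).coeff j = 0
      rw [f.coeff_bezPoly_comm, f.coeff_bezPoly_eq_zero h, coeff_zero]
  have hab (i j : ℕ) : f.num.coeff i * f.den.coeff j - f.den.coeff i * f.num.coeff j =
      ((X * f.bezPoly).coeff i).coeff j - (X * f.bezPoly.coeff i).coeff j := by
    have h := congrArg (fun P => (P.coeff i).coeff j) f.bezPoly_mul
    simp only [sub_mul, coeff_sub, coeff_C_mul, coeff_mul_C, coeff_map] at h
    rw [h]
    ring
  have hX : ∑ i ∈ Finset.range (m + 1), ∑ j ∈ Finset.range (m + 1),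
      algebraMap R T (((X * f.bezPoly).coeff i).coeff j) * θ i j =
      ∑ i ∈ Finset.range m, ∑ j ∈ Finset.range m, algebraMap R T (c i j) * θ (i + 1) j := by
    rw [Finset.sum_range_succ']
    simp only [coeff_X_mul, coeff_X_mul_zero, coeff_zero, map_zero, zero_mul,
      Finset.sum_const_zero, add_zero]
    refine Finset.sum_congr rfl fun i _ => ?_
    rw [Finset.sum_range_succ]
    change _ + algebraMap R T (c i m) * _ = _
    rw [hc i m (Or.inr le_rfl), map_zero, zero_mul, add_zero]
  have hY : ∑ i ∈ Finset.range (m + 1), ∑ j ∈ Finset.range (m + 1),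
      algebraMap R T ((X * f.bezPoly.coeff i).coeff j) * θ i j =
      ∑ i ∈ Finset.range m, ∑ j ∈ Finset.range m, algebraMap R T (c i j) * θ i (j + 1) := by
    rw [Finset.sum_range_succ, Finset.sum_eq_zero (s := Finset.range (m + 1)), add_zero]
    · refine Finset.sum_congr rfl fun i _ => ?_
      rw [Finset.sum_range_succ']
      simp only [coeff_X_mul, coeff_X_mul_zero, map_zero, zero_mul, add_zero]
      rfl
    · intro j _
      rw [f.coeff_bezPoly_eq_zero le_rfl, mul_zero, coeff_zero, map_zero, zero_mul]
  have hsum : ∑ i ∈ Finset.range (m + 1), ∑ j ∈ Finset.range (m + 1), algebraMap R T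
      (f.num.coeff i * f.den.coeff j - f.den.coeff i * f.num.coeff j) * θ i j =
      ∑ i ∈ Finset.range m, ∑ j ∈ Finset.range m,
        algebraMap R T (c i j) * (θ (i + 1) j - θ i (j + 1)) := by
    simp only [hab, map_sub, sub_mul, mul_sub, Finset.sum_sub_distrib, hX, hY]
  -- The factor `u t - v s` appears here. The bounds on `i` and `j` make the truncated exponents `m
  -- - 1 - i` and `m - 1 - j` honest.
  have hθ {i j : ℕ} (hi : i < m) (hj : j < m) : θ (i + 1) j - θ i (j + 1) =
      (u * t - v * s) * ((u ^ i * v ^ (m - 1 - i)) * (s ^ j * t ^ (m - 1 - j))) := by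
    simp only [θ]
    rw [show m - (i + 1) = m - 1 - i by omega, show m - (j + 1) = m - 1 - j by omega,
      show m - i = m - 1 - i + 1 by omega, show m - j = m - 1 - j + 1 by omega]
    ring
  rw [Finset.sum_mul_sum, Finset.sum_mul_sum, ← Finset.sum_sub_distrib]
  simp only [← Finset.sum_sub_distrib]
  trans ∑ i ∈ Finset.range (m + 1), ∑ j ∈ Finset.range (m + 1), algebraMap R T
      (f.num.coeff i * f.den.coeff j - f.den.coeff i * f.num.coeff j) * θ i j
  · rw [hsum, Finset.mul_sum, Finset.sum_range]
    refine Finset.sum_congr rfl fun i _ => ?_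
    rw [Finset.mul_sum, Finset.sum_range]
    refine Finset.sum_congr rfl fun j _ => ?_
    rw [hθ i.2 j.2]
    change _ * (algebraMap R T (c i j) * _ * _) = _
    ring
  · refine Finset.sum_congr rfl fun i _ => Finset.sum_congr rfl fun j _ => ?_
    simp only [θ, map_sub, map_mul]
    ring

/-- Put `(u, v, s, t) = (C(X), D(X), C(Y), D(Y))`, where `g = C/D`, in `bezPoly_homogeneous`: then
`u t - v s` is `X - Y` times the Bézout polynomial of `g`. -/
theorem bezPoly_comp (f g : PtRat R) :
    (f.comp g).bezPoly = (∑ p : Fin f.deg, ∑ q : Fin f.deg, C (C (f.bez p q)) *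
        (g.num ^ (p : ℕ) * g.den ^ (f.deg - 1 - p)).map C *
        C (g.num ^ (q : ℕ) * g.den ^ (f.deg - 1 - q))) * g.bezPoly := by
  symm
  refine (f.comp g).eq_bezPoly ?_
  have h := f.bezPoly_homogeneous (T := R[X][X]) (g.num.map C) (g.den.map C) (C g.num) (C g.den)
  have h0 (r : R) : algebraMap R R[X][X] r = C (C r) := rfl
  simp only [h0] at h
  rw [comp_num, comp_den, homEval, homEval]
  simp only [Polynomial.map_sum, map_sum, Polynomial.map_mul, map_mul, Polynomial.map_pow, map_pow,
    map_C]
  refine Eq.trans ?_ (h.trans (by ring))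
  rw [mul_left_comm, g.bezPoly_mul, mul_comm, mul_comm (C g.num)]

end ring

section field
variable {k : Type*} [Field k]
open Matrix
open scoped Kronecker

/-- That the `e i` form a basis need not be checked. Their coefficient matrix `E` satisfies `Eᵀ S E
= Béz(f)`, and invertibility of the right side gives `E` a left inverse, two-sided since the index
sets have the same size. -/
theorem congr_of_expansion {ι : Type*} [Fintype ι] [DecidableEq ι] (f : PtRat k)
    (S : Matrix ι ι k) (e : ι → k[X]) (hι : Fintype.card ι = f.deg)
    (h : f.bezPoly = ∑ i, ∑ j, C (C (S i j)) * (e i).map C * C (e j)) : Congr f.bez S := by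
  let E : Matrix ι (Fin f.deg) k := .of fun i p => (e i).coeff p
  have hE : Eᵀ * S * E = f.bez := by
    ext p q
    have := congrArg (fun P => (P.coeff p).coeff q) h
    simp only [finsetSum_coeff, coeff_C_mul, coeff_mul_C, coeff_map, mul_assoc] at this
    rw [Matrix.mul_assoc]
    refine Eq.trans ?_ this.symm
    simp only [Matrix.mul_apply, transpose_apply, Finset.mul_sum]
    refine Finset.sum_congr rfl fun i _ => Finset.sum_congr rfl fun j _ => ?_
    simp only [E, of_apply]
    ring
  have h1 : (f.bez⁻¹ * Eᵀ * S) * E = 1 := by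
    rw [Matrix.mul_assoc, Matrix.mul_assoc, ← Matrix.mul_assoc Eᵀ, hE,
      nonsing_inv_mul _ f.isUnit_det_bez]
  exact ⟨E, _, (Matrix.mul_eq_one_comm_of_card_eq _ _ _ (by simpa using hι.symm)).1 h1, h1, hE⟩

/-- The Bézout form. -/
def bezForm (f : PtRat k) : SymForm k := ⟨f.deg, f.bez, f.bez_isSymm, f.isUnit_det_bez⟩

/-- The function `X / u`. -/
def lin (u : kˣ) : PtRat k :=
  ofCoprime X (C (u : k)) monic_X (by rw [degree_X, degree_C u.ne_zero]; exact zero_lt_one)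
    ⟨0, C (↑u⁻¹ : k), by rw [← C_mul]; simp⟩

theorem deg_lin (u : kˣ) : (lin u).deg = 1 := natDegree_X

theorem bez_lin (u : kˣ) : (lin u).bezU = 0 ∧ (lin u).bezV = C (↑u⁻¹ : k) :=
  (lin u).bezout_unique (lin u).bezout (lin u).degree_bezV_lt
    (by change X * 0 + C (u : k) * C (↑u⁻¹ : k) = 1; rw [← C_mul]; simp)
    (by change _ < degree X; rw [degree_X]; exact degree_C_le.trans_lt zero_lt_one)

theorem lin_naiveSum_num (u : kˣ) (g : PtRat k) :
    ((lin u).naiveSum g).num = X * g.num - C (↑u⁻¹ : k) * g.den := by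
  rw [naiveSum_num, (bez_lin u).2]; rfl

theorem lin_naiveSum_den (u : kˣ) (g : PtRat k) :
    ((lin u).naiveSum g).den = C (u : k) * g.num := by
  rw [naiveSum_den, (bez_lin u).1, zero_mul, add_zero]; rfl

theorem bezPoly_lin_naiveSum (u : kˣ) (g : PtRat k) :
    ((lin u).naiveSum g).bezPoly = C (C (u : k)) * g.num.map C * C g.num + g.bezPoly := by
  symm
  refine eq_bezPoly _ ?_
  rw [lin_naiveSum_num, lin_naiveSum_den, mul_add, g.bezPoly_mul]
  have : C (C (↑u⁻¹ : k)) * C (C (u : k)) = (1 : k[X][X]) := by simp [← C_mul]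
  simp only [Polynomial.map_sub, Polynomial.map_mul, map_X, map_C, map_sub, map_mul]
  linear_combination (C g.num * g.den.map C - g.num.map C * C g.den) * this

/-- The adapted basis is `A, 1, X, …, X^(n-1)`, with `A` the numerator of `g`. -/
theorem isometric_lin_naiveSum (u : kˣ) (g : PtRat k) :
    Congr ((lin u).naiveSum g).bez
      (fromBlocks (Matrix.diagonal fun _ : Fin 1 => (u : k)) 0 0 g.bez) := by
  refine congr_of_expansion _ _ (Sum.elim (fun _ => g.num) fun p => X ^ (p : ℕ)) ?_ ?_
  · rw [deg_naiveSum, deg_lin]; simp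
  · rw [bezPoly_lin_naiveSum, g.bezPoly_expand]
    simp

/-- The sum is `(X A - u⁻¹ B) / (u A)`. Modulo `A` the term `X A` drops out; then `u^(n+1) (-u⁻¹)^n
= (-1)^n u`, and exchanging the arguments costs the sign `(-1)^((n+1) n) = 1`. -/
theorem res_lin_naiveSum (u : kˣ) (g : PtRat k) :
    ((lin u).naiveSum g).res = (-1) ^ g.deg * u * g.res := by
  have hd : ((lin u).naiveSum g).deg = g.deg + 1 := by rw [deg_naiveSum, deg_lin, add_comm]
  have hB : g.den.natDegree ≤ g.deg := g.natDegree_den_le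
  change Polynomial.resultant _ _ ((lin u).naiveSum g).deg ((lin u).naiveSum g).deg = _
  have h1 : ((lin u).naiveSum g).num.coeff (g.deg + 1) = 1 := by
    rw [← hd]; exact coeff_num _
  have h2 : X * g.num - C (↑u⁻¹ : k) * g.den = C (-(↑u⁻¹ : k)) * g.den + g.num * X := by
    rw [C_neg]; ring
  have h3 : Polynomial.resultant g.num g.den g.deg (g.deg + 1) = g.res := by
    rw [resultant_add_right_deg _ _ _ _ _ hB, g.coeff_num, one_pow, one_mul]; rfl
  rw [hd, lin_naiveSum_den, resultant_C_mul_right,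
    resultant_add_right_deg _ g.num _ g.deg 1 le_rfl, h1,
    lin_naiveSum_num, h2, resultant_add_mul_left _ g.num X (g.deg + 1) g.deg
      (by rw [natDegree_X, add_comm]) le_rfl,
    resultant_C_mul_left]
  change _ * (_ * (_ * Polynomial.resultant g.den g.num (g.deg + 1) g.deg)) = _
  rw [resultant_comm, h3, mul_comm (g.deg + 1), (Nat.even_mul_succ_self _).neg_one_pow, neg_pow]
  have h4 : (u : k) ^ g.deg * (↑u⁻¹ : k) ^ g.deg = 1 := by rw [← mul_pow]; simp
  linear_combination (-1) ^ g.deg * u * g.res * h4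

theorem det_lin_naiveSum (u : kˣ) (g : PtRat k) :
    ((lin u).naiveSum g).bez.det = u * g.bez.det := by
  rw [det_bez, det_bez, res_lin_naiveSum, deg_naiveSum, deg_lin, add_comm 1,
    Nat.triangle_succ, pow_add]
  have h : ((-1 : k) ^ g.deg) * (-1) ^ g.deg = 1 := by rw [← mul_pow]; simp
  linear_combination (-1) ^ (g.deg * (g.deg - 1) / 2) * u * g.res * h

/-- With `g = C/D` and `m` the degree of `f`, the family `C^p D^(m-1-p) X^q` turns the factorization
of δ into a Kronecker product. -/
theorem isometric_comp (f g : PtRat k) : Congr (f.comp g).bez (f.bez ⊗ₖ g.bez) := by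
  refine congr_of_expansion _ _
    (fun i => g.num ^ (i.1 : ℕ) * g.den ^ (f.deg - 1 - i.1) * X ^ (i.2 : ℕ)) ?_ ?_
  · rw [deg_comp]; simp
  · rw [bezPoly_comp]
    conv_lhs => rw [g.bezPoly_expand]
    simp only [Fintype.sum_prod_type, Finset.sum_mul, Finset.mul_sum, kroneckerMap_apply]
    refine (Finset.sum_congr rfl fun i _ => Finset.sum_comm.trans
      (Finset.sum_congr rfl fun p _ => Finset.sum_comm)).trans (Finset.sum_comm.trans ?_)
    refine Finset.sum_congr rfl fun p _ => Finset.sum_congr rfl fun i _ =>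
      Finset.sum_congr rfl fun q _ => Finset.sum_congr rfl fun j _ => ?_
    simp only [Polynomial.map_mul, C_mul]
    ring

end field
end PtRat
end NaiveP1
end

/-! ### The resultant of a composite -/

noncomputable section
namespace NaiveP1
open Polynomial

namespace PtRat
section
variable {K : Type*} [Field K]

theorem resultant_monic_add_right {L g : K[X]} (hL : L.Monic) {d : ℕ} (hg : g.natDegree ≤ d) :
    L.resultant g L.natDegree d = L.resultant g := by
  obtain ⟨j, rfl⟩ := Nat.exists_eq_add_of_le hg
  rw [resultant_add_right_deg _ _ _ _ _ le_rfl, coeff_natDegree, hL.leadingCoeff, one_pow, one_mul]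

theorem resultant_monic_pow {L g : K[X]} (hL : L.Monic) {d : ℕ} (hg : g.natDegree ≤ d) (j : ℕ) :
    L.resultant (g ^ j) L.natDegree (j * d) = L.resultant g L.natDegree d ^ j := by
  induction j with
  | zero => rw [pow_zero, zero_mul, pow_zero, ← C_1, resultant_C_zero_right, one_pow]
  | succ j ih =>
    rw [pow_succ, pow_succ, ← ih, resultant_monic_add_right hL hg,
      resultant_monic_add_right hL (natDegree_pow_le_of_le j hg), ← resultant_mul_right _ _ _ _ le_rfl,
      resultant_monic_add_right hL (by
        rw [add_mul, one_mul]
        exact natDegree_mul_le.trans (add_le_add (natDegree_pow_le_of_le j hg) hg)),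
      resultant_monic_add_right hL natDegree_mul_le]

theorem natDegree_homEval_le {m n : ℕ} {P E F : K[X]} (hE : E.natDegree ≤ n)
    (hF : F.natDegree ≤ n) : (homEval m P E F).natDegree ≤ m * n := by
  refine natDegree_sum_le_of_forall_le _ _ fun i hi => ?_
  rw [Finset.mem_range] at hi
  rw [mul_assoc]
  refine (natDegree_C_mul_le _ _).trans (natDegree_mul_le.trans ?_)
  calc _ ≤ i * n + (m - i) * n :=
        add_le_add (natDegree_pow_le_of_le i hE) (natDegree_pow_le_of_le _ hF)
    _ = m * n := by rw [← add_mul]; congr; omega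

theorem sub_C_mul_monic {E F : K[X]} (hE : E.Monic) (hF : F.degree < E.degree) (a : K) :
    (E - C a * F).Monic ∧ (E - C a * F).natDegree = E.natDegree := by
  have h : (C a * F).degree < E.degree := by
    rw [← smul_eq_C_mul]; exact (degree_smul_le _ _).trans_lt hF
  exact ⟨hE.sub_of_left h, natDegree_eq_of_degree_eq (degree_sub_eq_left_of_degree_lt h)⟩

theorem homEval_X_sub_C (a : K) (E F : K[X]) : homEval 1 (X - C a) E F = E - C a * F := by
  rw [sub_eq_add_neg, ← C_neg, homEval_add, homEval_X, homEval_C, pow_one, C_neg]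
  ring

/-- Since `B ≡ B(a)` modulo `X - a`, the homogenization of `B` is `B(a) F^m` modulo `E - a F`;
moreover `res(E - a F, F) = res(E, F)`. -/
theorem resultant_homEval_linear {m : ℕ} {B E F : K[X]} (hE : E.Monic) (hF : F.degree < E.degree)
    (hB : B.natDegree ≤ m) (a : K) :
    (E - C a * F).resultant (homEval m B E F) E.natDegree (m * E.natDegree) =
      B.eval a ^ E.natDegree * E.resultant F E.natDegree E.natDegree ^ m := by
  obtain ⟨hL, hLd⟩ := sub_C_mul_monic hE hF a
  have hF' : F.natDegree ≤ E.natDegree := natDegree_le_natDegree hF.le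
  rcases m with _ | m
  · obtain ⟨b, rfl⟩ := natDegree_eq_zero.1 (Nat.le_zero.1 hB)
    rw [homEval_C, pow_zero, mul_one, zero_mul, resultant_C_zero_right]
    simp
  · have hQ : (B /ₘ (X - C a)).natDegree ≤ m := by
      rw [natDegree_divByMonic _ (monic_X_sub_C a), natDegree_X_sub_C]; omega
    have hdecomp : B = C (B.eval a) + (X - C a) * (B /ₘ (X - C a)) := by
      have := modByMonic_add_div B (X - C a)
      rw [modByMonic_X_sub_C_eq_C_eval] at this
      exact this.symm
    have hhom : homEval (m + 1) B E F = C (B.eval a) * F ^ (m + 1) +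
        (E - C a * F) * homEval m (B /ₘ (X - C a)) E F := by
      conv_lhs => rw [hdecomp]
      rw [homEval_add, homEval_C, add_comm m 1, homEval_mul (natDegree_X_sub_C_le a) hQ,
        homEval_X_sub_C]
    rw [hhom, resultant_add_mul_right _ _ _ _ _ (by
        rw [add_mul, one_mul]; exact add_le_add (natDegree_homEval_le le_rfl hF') le_rfl) hLd.le,
      resultant_C_mul_right]
    congr 1
    rw [← hLd, resultant_monic_pow hL (hF'.trans hLd.ge), hLd, sub_eq_add_neg,
      show E + -(C a * F) = E + F * C (-a) by rw [C_neg]; ring,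
      resultant_add_mul_left _ _ _ _ _ (by simp) hF']

/-- Homogenization turns a product of factors `X - a` into the product of the `E - a F`, and the
resultant is multiplicative in its first argument. -/
theorem resultant_homEval_prod {m : ℕ} {B E F : K[X]} (hE : E.Monic) (hF : F.degree < E.degree)
    (hB : B.natDegree ≤ m) (s : Multiset K) :
    (homEval s.card (s.map fun a => X - C a).prod E F).resultant (homEval m B E F)
        (s.card * E.natDegree) (m * E.natDegree) =
      (s.map fun a => B.eval a).prod ^ E.natDegree *
        E.resultant F E.natDegree E.natDegree ^ (m * s.card) := by
  have hF' : F.natDegree ≤ E.natDegree := natDegree_le_natDegree hF.le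
  have hprod (s : Multiset K) : homEval s.card (s.map fun a => X - C a).prod E F =
      (s.map fun a => E - C a * F).prod := by
    induction s using Multiset.induction_on with
    | empty => simp [homEval_one]
    | cons a s ih =>
      rw [Multiset.card_cons, Multiset.map_cons, Multiset.prod_cons, add_comm,
        homEval_mul (natDegree_X_sub_C_le a), ih, homEval_X_sub_C, Multiset.map_cons,
        Multiset.prod_cons]
      rw [natDegree_multiset_prod_X_sub_C_eq_card]
  have hmon (s : Multiset K) : ((s.map fun a => E - C a * F).prod).Monic :=
    monic_multiset_prod_of_monic _ _ fun a _ => (sub_C_mul_monic hE hF a).1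
  have hdeg (s : Multiset K) : ((s.map fun a => E - C a * F).prod).natDegree =
      s.card * E.natDegree := by
    induction s using Multiset.induction_on with
    | empty => simp
    | cons a s ih =>
      obtain ⟨hL, hLd⟩ := sub_C_mul_monic hE hF a
      rw [Multiset.map_cons, Multiset.prod_cons, hL.natDegree_mul (hmon s), ih, hLd,
        Multiset.card_cons]
      ring
  rw [hprod]
  induction s using Multiset.induction_on with
  | empty => simp
  | cons a s ih =>
    obtain ⟨hL, hLd⟩ := sub_C_mul_monic hE hF a
    have h := resultant_mul_left (E - C a * F) (s.map fun a => E - C a * F).prod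
      (homEval m B E F) (m * E.natDegree) (natDegree_homEval_le le_rfl hF')
    rw [hdeg, ih, hLd, resultant_homEval_linear hE hF hB] at h
    rw [Multiset.card_cons, Multiset.map_cons, Multiset.prod_cons, add_mul, one_mul, add_comm, h,
      Multiset.map_cons, Multiset.prod_cons]
    ring

theorem resultant_homEval [IsAlgClosed K] {A B E F : K[X]} (hA : A.Monic)
    (hB : B.natDegree ≤ A.natDegree) (hE : E.Monic) (hF : F.degree < E.degree) :
    (homEval A.natDegree A E F).resultant (homEval A.natDegree B E F)
        (A.natDegree * E.natDegree) (A.natDegree * E.natDegree) =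
      A.resultant B A.natDegree A.natDegree ^ E.natDegree *
        E.resultant F E.natDegree E.natDegree ^ (A.natDegree ^ 2) := by
  have hs := IsAlgClosed.splits A
  have hprod : (A.roots.map fun a => X - C a).prod = A :=
    (hs.eq_prod_roots_of_monic hA).symm
  have hcard : A.roots.card = A.natDegree := hs.natDegree_eq_card_roots.symm
  have h1 := resultant_homEval_prod (E := E) (F := F) hE hF hB A.roots
  -- The case of the identity function evaluates the product of `B` over the roots of `A` as `res(A,
  -- B)`.
  have h2 := resultant_homEval_prod (E := X) (F := 1) monic_X (by simp) hB A.roots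
  rw [hprod, hcard] at h1 h2
  have h3 : (X : K[X]).resultant 1 1 1 = 1 := by
    have := resultant_X_sub_C_left (1 : K[X]) 1 0 (by simp)
    rwa [C_0, sub_zero, eval_one] at this
  rw [natDegree_X, mul_one, homEval_X_one le_rfl, homEval_X_one hB, h3, one_pow, mul_one,
    pow_one] at h2
  rw [h1, h2, sq]

theorem res_comp (f g : PtRat K) : (f.comp g).res = f.res ^ g.deg * g.res ^ (f.deg ^ 2) := by
  apply (algebraMap K (AlgebraicClosure K)).injective
  rw [map_mul, map_pow, map_pow, ← map_res, ← map_res, ← map_res, map_comp,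
    ← deg_map (algebraMap K (AlgebraicClosure K)) f, ← deg_map (algebraMap K (AlgebraicClosure K)) g]
  generalize f.map (algebraMap K (AlgebraicClosure K)) = f
  generalize g.map (algebraMap K (AlgebraicClosure K)) = g
  change Polynomial.resultant _ _ (f.comp g).deg (f.comp g).deg = _
  rw [deg_comp]
  exact resultant_homEval f.monic f.natDegree_den_le g.monic g.degree_lt

end
end PtRat
end NaiveP1
end

/-! ### Congruence over rings, metabolic forms and stable classes -/

noncomputable section
namespace NaiveP1
open Polynomial Matrix

section congruenceRing
variable {R S : Type*} [CommRing R] [CommRing S] {ι κ τ : Type*} [Fintype ι] [Fintype κ] [Fintype τ]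
  [DecidableEq ι] [DecidableEq κ] [DecidableEq τ]

/-- Congruence of matrices over a commutative ring. -/
def RCongr (A : Matrix ι ι R) (B : Matrix κ κ R) : Prop :=
  ∃ (P : Matrix κ ι R) (Q : Matrix ι κ R), P * Q = 1 ∧ Q * P = 1 ∧ Pᵀ * B * P = A

namespace RCongr

theorem symm {A : Matrix ι ι R} {B : Matrix κ κ R} (h : RCongr A B) : RCongr B A := by
  obtain ⟨P, Q, h1, h2, rfl⟩ := h
  refine ⟨Q, P, h2, h1, ?_⟩
  calc Qᵀ * (Pᵀ * B * P) * Q = (P * Q)ᵀ * B * (P * Q) := by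
        simp only [transpose_mul, Matrix.mul_assoc]
    _ = B := by simp [h1]

theorem trans {A : Matrix ι ι R} {B : Matrix κ κ R} {C : Matrix τ τ R}
    (h : RCongr A B) (h' : RCongr B C) : RCongr A C := by
  obtain ⟨P, Q, h1, h2, rfl⟩ := h
  obtain ⟨P', Q', h1', h2', rfl⟩ := h'
  refine ⟨P' * P, Q * Q', ?_, ?_, ?_⟩
  · rw [Matrix.mul_assoc, ← Matrix.mul_assoc P, h1, Matrix.one_mul, h1']
  · rw [Matrix.mul_assoc, ← Matrix.mul_assoc Q', h2', Matrix.one_mul, h2]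
  · simp only [transpose_mul, Matrix.mul_assoc]

theorem of_isUnit {A B P : Matrix ι ι R} (hP : IsUnit P.det) (h : Pᵀ * B * P = A) : RCongr A B :=
  ⟨P, P⁻¹, mul_nonsing_inv _ hP, nonsing_inv_mul _ hP, h⟩

theorem of_equiv (A : Matrix ι ι R) (e : κ ≃ ι) : RCongr (A.submatrix e e) A := by
  refine ⟨(1 : Matrix ι ι R).submatrix id e, (1 : Matrix ι ι R).submatrix e id, ?_, ?_, ?_⟩
  · rw [submatrix_mul_equiv]; simp
  · rw [← submatrix_mul _ _ _ _ _ Function.bijective_id]; simp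
  · ext i j
    simp [Matrix.mul_apply, Matrix.one_apply]

theorem map {A : Matrix ι ι R} {B : Matrix κ κ R} (h : RCongr A B) (φ : R →+* S) :
    RCongr (A.map φ) (B.map φ) := by
  obtain ⟨P, Q, h1, h2, rfl⟩ := h
  refine ⟨P.map φ, Q.map φ, ?_, ?_, ?_⟩
  · rw [← Matrix.map_mul, h1, Matrix.map_one _ (map_zero _) (map_one _)]
  · rw [← Matrix.map_mul, h2, Matrix.map_one _ (map_zero _) (map_one _)]
  · rw [Matrix.map_mul, Matrix.map_mul, transpose_map]

/-- Completion of the square in a block matrix whose off-diagonal part is degenerate. -/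
theorem fromBlocks_reduce {A : Matrix ι ι R} {B L : Matrix ι κ R} (W : Matrix κ κ R)
    (hA : A.IsSymm) (h1 : A * L = -B) (h2 : Bᵀ * L = 0) :
    RCongr (fromBlocks A 0 0 W) (fromBlocks A B Bᵀ W) := by
  refine .of_isUnit (P := fromBlocks 1 L 0 1) (by simp) ?_
  have h3 : Lᵀ * A = -Bᵀ := by
    rw [← transpose_neg, ← h1, transpose_mul, hA.eq]
  have h4 : Lᵀ * B = 0 := by
    rw [← transpose_transpose B, ← transpose_mul, h2, transpose_zero]
  simp [fromBlocks_transpose, fromBlocks_multiply, h1, h3, h4]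

end RCongr

/-- The matrix is symmetric with invertible determinant. -/
def SymNondeg (A : Matrix ι ι R) : Prop := A.IsSymm ∧ IsUnit A.det

namespace SymNondeg

theorem map {A : Matrix ι ι R} (h : SymNondeg A) (φ : R →+* S) : SymNondeg (A.map φ) := by
  refine ⟨h.1.map _, ?_⟩
  have := h.2.map φ
  rwa [RingHom.map_det] at this

theorem fromBlocks {A : Matrix ι ι R} {B : Matrix κ κ R} (hA : SymNondeg A) (hB : SymNondeg B) :
    SymNondeg (Matrix.fromBlocks A 0 0 B) := by
  refine ⟨?_, ?_⟩
  · rw [Matrix.IsSymm, fromBlocks_transpose, hA.1, hB.1]; simp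
  · rw [det_fromBlocks_zero₂₁]
    exact hA.2.mul hB.2

theorem of_congr {A : Matrix ι ι R} {B : Matrix κ κ R} (h : RCongr A B) (hB : SymNondeg B) :
    SymNondeg A := by
  obtain ⟨P, Q, h1, h2, rfl⟩ := h
  refine ⟨?_, ?_⟩
  · rw [Matrix.IsSymm, transpose_mul, transpose_mul, transpose_transpose, hB.1, Matrix.mul_assoc]
  · refine isUnit_det_of_right_inverse (B := Q * B⁻¹ * Qᵀ) ?_
    calc Pᵀ * B * P * (Q * B⁻¹ * Qᵀ) = Pᵀ * (B * (P * Q) * B⁻¹) * Qᵀ := by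
          simp only [Matrix.mul_assoc]
      _ = 1 := by
          rw [h1, Matrix.mul_one, mul_nonsing_inv _ hB.2, Matrix.mul_one, ← transpose_mul, h2,
            transpose_one]

theorem of_fromBlocks {A : Matrix ι ι R} {B : Matrix κ κ R}
    (h : SymNondeg (Matrix.fromBlocks A 0 0 B)) : SymNondeg B := by
  refine ⟨?_, ?_⟩
  · have := h.1
    rw [Matrix.IsSymm, fromBlocks_transpose, fromBlocks_inj] at this
    exact this.2.2.2
  · have := h.2
    rw [det_fromBlocks_zero₂₁] at this
    exact isUnit_of_mul_isUnit_right this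

end SymNondeg

/-- The metabolic form with Gram matrix `[0, 1; 1, M]`. -/
def metab (M : Matrix ι ι R) : Matrix (ι ⊕ ι) (ι ⊕ ι) R := fromBlocks 0 1 1 M

theorem metab_symNondeg {M : Matrix ι ι R} (hM : M.IsSymm) : SymNondeg (metab M) := by
  refine ⟨?_, ?_⟩
  · rw [Matrix.IsSymm, metab, fromBlocks_transpose, hM]; simp
  · refine isUnit_det_of_right_inverse (B := fromBlocks (-M) 1 1 0) ?_
    simp [metab, fromBlocks_multiply]

end congruenceRing

theorem metab_map {R S ι : Type*} [CommRing R] [CommRing S] [DecidableEq ι]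
    (M : Matrix ι ι R) (φ : R →+* S) : (metab M).map φ = metab (M.map φ) := by
  simp [metab, fromBlocks_map]

theorem fromBlocks_map_diag {R S ι κ : Type*} [CommRing R] [CommRing S]
    (A : Matrix ι ι R) (B : Matrix κ κ R) (φ : R →+* S) :
    (fromBlocks A 0 0 B).map φ = fromBlocks (A.map φ) 0 0 (B.map φ) := by
  simp [fromBlocks_map]

section stableClass
variable {k : Type*} [Field k] {ι κ : Type*} [Fintype ι] [Fintype κ] [DecidableEq ι] [DecidableEq κ]

/-- The form on `kᵐ` obtained by numbering the index set. -/
def toForm {A : Matrix ι ι k} (h : SymNondeg A) : SymForm k where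
  dim := Fintype.card ι
  mat := A.submatrix (Fintype.equivFin ι).symm (Fintype.equivFin ι).symm
  symm := h.1.submatrix _
  nondeg := by rw [det_submatrix_equiv_self]; exact h.2

theorem toForm_congr {A : Matrix ι ι k} (h : SymNondeg A) : Congr (toForm h).mat A :=
  Congr.submatrix _ _

/-- The stable class of a symmetric nondegenerate matrix. -/
def stClass {A : Matrix ι ι k} (h : SymNondeg A) : MWs k := MWs.mk (toForm h)

theorem stClass_congr {A : Matrix ι ι k} {B : Matrix κ κ k} (hA : SymNondeg A) (hB : SymNondeg B)
    (h : Congr A B) : stClass hA = stClass hB :=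
  MWs.mk_eq_of_isometric (((toForm_congr hA).trans h).trans (toForm_congr hB).symm)

theorem stClass_eq_mk {A : Matrix ι ι k} (hA : SymNondeg A) {b : SymForm k}
    (h : Congr A b.mat) : stClass hA = MWs.mk b :=
  MWs.mk_eq_of_isometric ((toForm_congr hA).trans h)

theorem stClass_fromBlocks {A : Matrix ι ι k} {B : Matrix κ κ k} (hA : SymNondeg A)
    (hB : SymNondeg B) :
    stClass (hA.fromBlocks hB) = (stClass hA).osum (stClass hB) :=
  MWs.mk_eq_of_isometric ((toForm_congr _).trans
    (((toForm_congr hA).fromBlocks (toForm_congr hB)).symm.trans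
      (SymForm.osum_congr_aux _ _).symm))

theorem MWs.osum_right_cancel {x y z : MWs k} (h : x.osum z = y.osum z) : x = y := by
  induction x using Quotient.inductionOn with | _ x => ?_
  induction y using Quotient.inductionOn with | _ y => ?_
  induction z using Quotient.inductionOn with | _ z => ?_
  obtain ⟨d, hd⟩ := MWs.mk_eq_iff.1 h
  exact MWs.mk_eq_iff.2 ⟨z.osum d, (SymForm.Isometric.osum_assoc x z d).symm.trans
    (hd.trans (SymForm.Isometric.osum_assoc y z d))⟩

theorem MWs.osum_left_cancel {x y z : MWs k} (h : z.osum x = z.osum y) : x = y := by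
  rw [MWs.osum_comm z, MWs.osum_comm z] at h
  exact MWs.osum_right_cancel h

/-- Translate the second half of the metabolic basis by the vectors `P` of the summand `D`. This
adds `Pᵀ D P` to `M` and creates a mixed block, which the isotropic first half clears without
touching `D`. -/
theorem metab_shift {D : Matrix κ κ k} (hD : D.IsSymm) {M : Matrix ι ι k} (hM : M.IsSymm)
    (P : Matrix κ ι k) :
    RCongr (fromBlocks (metab (M + Pᵀ * D * P)) 0 0 D) (fromBlocks (metab M) 0 0 D) := by
  let B : Matrix (ι ⊕ ι) κ k := fromRows 0 (Pᵀ * D)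
  let L : Matrix (ι ⊕ ι) κ k := fromRows (-(Pᵀ * D)) 0
  let E : Matrix κ (ι ⊕ ι) k := fromCols 0 P
  have hBt : Bᵀ = fromCols 0 (D * P) := by
    simp [B, transpose_fromRows, hD.eq]
  have hEt : Eᵀ = fromRows 0 Pᵀ := by
    simp [E, transpose_fromCols]
  have hsymm : (metab (M + Pᵀ * D * P)).IsSymm := by
    refine (metab_symNondeg ?_).1
    rw [Matrix.IsSymm, transpose_add, hM.eq, transpose_mul, transpose_mul, hD.eq,
      transpose_transpose, Matrix.mul_assoc]
  refine (RCongr.fromBlocks_reduce (B := B) (L := L) D hsymm ?_ ?_).trans ?_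
  · ext (i | i) j <;> simp [L, B, metab, fromBlocks_mul_fromRows]
  · rw [hBt]
    simp [L, fromCols_mul_fromRows]
  · refine RCongr.of_isUnit (P := fromBlocks 1 0 E 1) (by simp) ?_
    have h1 : D * E = Bᵀ := by rw [hBt]; simp [E, mul_fromCols]
    have h2 : Eᵀ * D = B := by rw [hEt, fromRows_mul]; simp [B]
    have h3 : metab M + Eᵀ * D * E = metab (M + Pᵀ * D * P) := by
      rw [h2]
      ext (i | i) (j | j) <;> simp [metab, B, E]
    rw [← h3]
    simp [fromBlocks_transpose, fromBlocks_multiply, h1, h2]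

/-- Add `metab (-M)` and shift by its second half, on which the form is `-M`. Nothing is divided by
2, so characteristic 2 is included. -/
theorem stClass_metab {M : Matrix ι ι k} (hM : M.IsSymm) :
    stClass (metab_symNondeg hM) = stClass (metab_symNondeg (isSymm_zero (n := ι) (α := k))) := by
  have hD := metab_symNondeg hM.neg
  let E : Matrix (ι ⊕ ι) ι k := fromRows 0 1
  have h := metab_shift hD.1 hM E
  have h0 : M + Eᵀ * metab (-M) * E = 0 := by
    ext i j
    simp [E, metab, transpose_fromRows, fromCols_mul_fromBlocks, fromCols_mul_fromRows]
  rw [h0] at h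
  refine MWs.osum_right_cancel (z := stClass hD) ?_
  rw [← stClass_fromBlocks, ← stClass_fromBlocks]
  exact (stClass_congr _ _ h).symm

end stableClass

/-! ### Isotropic vectors and nilpotent matrices -/

section linearAlgebra
variable {k : Type*} [Field k]

/-- Replace a standard basis vector at which `v` has a nonzero coordinate; by Cramer's rule that
coordinate is the determinant. -/
theorem exists_matrix_col {ι : Type} [Fintype ι] [DecidableEq ι] {v : ι → k} (hv : v ≠ 0) :
    ∃ (κ : Type) (_ : Fintype κ) (_ : DecidableEq κ) (P : Matrix ι (Unit ⊕ κ) k)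
      (Q : Matrix (Unit ⊕ κ) ι k), P * Q = 1 ∧ Q * P = 1 ∧ ∀ i, P i (Sum.inl ()) = v i := by
  obtain ⟨i₀, hi₀⟩ := Function.ne_iff.1 hv
  let P' : Matrix ι ι k := (1 : Matrix ι ι k).updateCol i₀ v
  have hdet : IsUnit P'.det := by
    have : P'.det = v i₀ := by rw [← cramer_apply, cramer_one]; rfl
    rw [this]
    exact isUnit_iff_ne_zero.2 hi₀
  let e : Unit ⊕ {a // a ≠ i₀} ≃ ι :=
    (Equiv.sumCongr (Equiv.ofUnique Unit {a // a = i₀}) (Equiv.refl _)).trans (Equiv.sumCompl _)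
  refine ⟨{a // a ≠ i₀}, inferInstance, inferInstance, P'.submatrix id e, P'⁻¹.submatrix e id,
    ?_, ?_, ?_⟩
  · rw [submatrix_mul_equiv, mul_nonsing_inv _ hdet]; simp
  · rw [← submatrix_mul _ _ _ _ _ Function.bijective_id, nonsing_inv_mul _ hdet]; simp
  · intro i
    have : e (Sum.inl ()) = i₀ := rfl
    simp [this, P']

/-- An isotropic vector completes to a basis starting with it and a dual vector. -/
theorem exists_isotropic_splitting {ι : Type} [Fintype ι] [DecidableEq ι] {A : Matrix ι ι k}
    (hA : SymNondeg A) {v : ι → k} (hv : v ≠ 0) (hiso : v ⬝ᵥ A *ᵥ v = 0) :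
    ∃ (κ : Type) (_ : Fintype κ) (_ : DecidableEq κ) (P : Matrix ι (Unit ⊕ (Unit ⊕ κ)) k)
      (Q : Matrix (Unit ⊕ (Unit ⊕ κ)) ι k), P * Q = 1 ∧ Q * P = 1 ∧
      P *ᵥ Pi.single (Sum.inl ()) 1 = v ∧
      Pᵀ *ᵥ A *ᵥ v = Pi.single (Sum.inr (Sum.inl ())) 1 := by
  obtain ⟨κ, _, _, P₁, Q₁, h1, h1', hP₁⟩ := exists_matrix_col hv
  have hcol : P₁ *ᵥ Pi.single (Sum.inl ()) 1 = v := by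
    ext i; simp [hP₁]
  let c : κ → k := fun j => (P₁ᵀ *ᵥ A *ᵥ v) (Sum.inr j)
  have hc0 : (P₁ᵀ *ᵥ A *ᵥ v) (Sum.inl ()) = 0 := by
    rw [← hiso]
    simp [Matrix.mulVec, dotProduct, hP₁]
  -- Nondegeneracy: otherwise `v` would be orthogonal to everything.
  have hc : c ≠ 0 := by
    intro hc
    have h0 : P₁ᵀ *ᵥ A *ᵥ v = 0 := by
      ext (j | j)
      · exact hc0
      · exact congrFun hc j
    have h2 : A⁻¹ *ᵥ Q₁ᵀ *ᵥ P₁ᵀ *ᵥ A *ᵥ v = v := by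
      rw [mulVec_mulVec (A *ᵥ v) Q₁ᵀ, ← transpose_mul, h1, transpose_one, one_mulVec,
        mulVec_mulVec, nonsing_inv_mul _ hA.2, one_mulVec]
    rw [h0, mulVec_zero, mulVec_zero] at h2
    exact hv h2.symm
  obtain ⟨τ, _, _, P₂, Q₂, h2, h2', hP₂⟩ := exists_matrix_col hc
  have hcol₂ : Q₂ *ᵥ c = Pi.single (Sum.inl ()) 1 := by
    have : c = P₂ *ᵥ Pi.single (Sum.inl ()) 1 := by ext i; simp [hP₂]
    rw [this, mulVec_mulVec, h2', one_mulVec]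
  -- The linear form `c`, rather than a vector, has to become the first coordinate, so the base
  -- change on the complement is the contragredient `Q₂ᵀ`.
  let G : Matrix (Unit ⊕ κ) (Unit ⊕ (Unit ⊕ τ)) k := fromBlocks 1 0 0 Q₂ᵀ
  let G' : Matrix (Unit ⊕ (Unit ⊕ τ)) (Unit ⊕ κ) k := fromBlocks 1 0 0 P₂ᵀ
  have hG : G * G' = 1 := by
    simp only [G, G', fromBlocks_multiply, ← transpose_mul, h2]
    simp
  have hG' : G' * G = 1 := by
    simp only [G, G', fromBlocks_multiply, ← transpose_mul, h2']
    simp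
  refine ⟨τ, inferInstance, inferInstance, P₁ * G, G' * Q₁, ?_, ?_, ?_, ?_⟩
  · rw [Matrix.mul_assoc, ← Matrix.mul_assoc G, hG, Matrix.one_mul, h1]
  · rw [Matrix.mul_assoc, ← Matrix.mul_assoc Q₁, h1', Matrix.one_mul, hG']
  · rw [← mulVec_mulVec, ← hcol]
    congr 1
    ext (j | j) <;> simp [G]
  · have hs : P₁ᵀ *ᵥ A *ᵥ v = Sum.elim (fun _ => 0) c := by
      ext (j | j)
      · exact hc0
      · rfl
    rw [transpose_mul, ← mulVec_mulVec, hs]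
    simp only [G, fromBlocks_transpose, fromBlocks_mulVec]
    ext (j | j)
    · simp
    · simp [hcol₂, Pi.single_apply]

/-- Apply the last nonvanishing power of `N`; its exponent is at least one because `N ≠ 0`. -/
theorem exists_mem_ker_range_of_isNilpotent {ι : Type} [Fintype ι] [DecidableEq ι]
    {N : Matrix ι ι k} (hN : IsNilpotent N) (h0 : N ≠ 0) :
    ∃ w, N *ᵥ w ≠ 0 ∧ N *ᵥ N *ᵥ w = 0 := by
  classical
  obtain ⟨m, hm, hmin⟩ : ∃ m, N ^ m = 0 ∧ ∀ j < m, N ^ j ≠ 0 :=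
    ⟨Nat.find hN, Nat.find_spec hN, fun j hj => Nat.find_min hN hj⟩
  obtain ⟨m, rfl⟩ : ∃ j, m = j + 2 := by
    rcases m with _ | _ | m
    · exact absurd (by rw [← mul_one N, ← pow_zero N, hm, mul_zero]) h0
    · exact absurd (by rw [← hm]; simp) h0
    · exact ⟨m, rfl⟩
  have h1 : N ^ (m + 1) ≠ 0 := hmin _ (by omega)
  obtain ⟨w, hw⟩ : ∃ w, N ^ (m + 1) *ᵥ w ≠ 0 := by
    by_contra! h
    exact h1 (Matrix.ext_of_mulVec_single fun i => by rw [h, zero_mulVec])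
  refine ⟨N ^ m *ᵥ w, ?_, ?_⟩
  · rwa [mulVec_mulVec, ← pow_succ']
  · rw [mulVec_mulVec, mulVec_mulVec, ← sq, ← pow_add, add_comm, hm, zero_mulVec]

/-- `det(1 + X N)` is the reversed characteristic polynomial of `-N`. A unit of `k[X]` is constant,
and the value at 0 is 1, so the characteristic polynomial is a power of `X`; Cayley–Hamilton
concludes. -/
theorem isNilpotent_of_isUnit_det {ι : Type} [Fintype ι] [DecidableEq ι] {N : Matrix ι ι k}
    (h : IsUnit (1 + (X : k[X]) • N.map C).det) : IsNilpotent N := by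
  have h1 : (1 + (X : k[X]) • N.map C).det = (-N).charpolyRev := by
    rw [charpolyRev]
    congr 1
    ext i j
    simp
  rw [h1] at h
  obtain ⟨c, hc, hc'⟩ := isUnit_iff.1 h
  have h2 : (-N).charpolyRev = 1 := by
    have := eval_charpolyRev (M := -N)
    rw [← hc', eval_C] at this
    rw [← hc', this, C_1]
  rw [← reverse_charpoly] at h2
  have h3 : (-N).charpoly = X ^ (-N).charpoly.natDegree := by
    ext i
    rw [coeff_X_pow]
    split_ifs with hi
    · rw [hi]; exact charpoly_monic _
    · rcases lt_or_ge (-N).charpoly.natDegree i with h | h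
      · exact coeff_eq_zero_of_natDegree_lt h
      · have h4 := congrArg (fun p => p.coeff ((-N).charpoly.natDegree - i)) h2
        simp only [coeff_reverse, revAt_le (Nat.sub_le _ _), coeff_one] at h4
        rw [if_neg (by omega), Nat.sub_sub_self h] at h4
        exact h4
  have h5 := aeval_self_charpoly (-N)
  rw [h3, map_pow, aeval_X] at h5
  have h6 : IsNilpotent (-N) := ⟨_, h5⟩
  simpa using h6

end linearAlgebra
end NaiveP1
end

/-! ### Homotopy invariance of the stable class -/

noncomputable section
namespace NaiveP1
open Polynomial Matrix

section invariance
variable {k : Type*} [Field k]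

/-- The two ends of a symmetric matrix over `k[X]` have the same stable class. -/
def EndsAgree {ι : Type} [Fintype ι] [DecidableEq ι] (A : Matrix ι ι k[X]) : Prop :=
  ∀ h : SymNondeg A, stClass (h.map (evalRingHom 0)) = stClass (h.map (evalRingHom 1))

variable {ι κ τ : Type} [Fintype ι] [DecidableEq ι] [Fintype κ] [DecidableEq κ] [Fintype τ]
  [DecidableEq τ]

/-- Splitting off a metabolic form does not change whether the ends agree. -/
theorem stClass_eval_metab {M : Matrix κ κ k[X]} (hM : M.IsSymm) {A : Matrix ι ι k[X]}
    (hA : SymNondeg A) {B : Matrix τ τ k[X]} (hB : SymNondeg B)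
    (h : RCongr B (fromBlocks A 0 0 (metab M))) (a : k) :
    stClass (hB.map (evalRingHom a)) = (stClass (hA.map (evalRingHom a))).osum
      (stClass (metab_symNondeg (isSymm_zero (n := κ) (α := k)))) := by
  rw [← stClass_metab (hM.map (evalRingHom a)), ← stClass_fromBlocks]
  refine stClass_congr _ _ ?_
  have := h.map (evalRingHom a)
  rwa [fromBlocks_map_diag, metab_map] at this

theorem EndsAgree.of_split {M : Matrix κ κ k[X]} (hM : M.IsSymm) {A : Matrix ι ι k[X]}
    {B : Matrix τ τ k[X]} (hB : SymNondeg B)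
    (h : RCongr B (fromBlocks A 0 0 (metab M))) (he : EndsAgree B) : EndsAgree A := by
  intro hA
  have := he hB
  rw [stClass_eval_metab hM hA hB h, stClass_eval_metab hM hA hB h] at this
  exact MWs.osum_right_cancel this

theorem EndsAgree.of_summand {M : Matrix κ κ k[X]} (hM : M.IsSymm) {A : Matrix ι ι k[X]}
    {B : Matrix τ τ k[X]} (hA : SymNondeg A)
    (h : RCongr B (fromBlocks A 0 0 (metab M))) (he : EndsAgree A) : EndsAgree B := by
  intro hB
  rw [stClass_eval_metab hM hA hB h, stClass_eval_metab hM hA hB h, he hA]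

/-- Higman's trick: the leading terms of degree `2a + e` are traded for terms of degree
at most `a + e`. -/
theorem higman (A N : Matrix ι ι k[X]) (a e : ℕ) (hN : N.IsSymm) :
    RCongr (fromBlocks (A - (X : k[X]) ^ (2 * a + e) • N)
        (fromCols ((X : k[X]) ^ a • 1) (-((X : k[X]) ^ (a + e) • N)))
        (fromRows ((X : k[X]) ^ a • 1) (-((X : k[X]) ^ (a + e) • N)))
        (metab (-((X : k[X]) ^ e • N))))
      (fromBlocks A 0 0 (metab (-((X : k[X]) ^ e • N)))) := by
  -- Chosen so that `Eᵀ * metab (-(X^e N)) * E = -X^(2a+e) N`.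
  let E : Matrix (ι ⊕ ι) ι k[X] := fromRows 0 ((X : k[X]) ^ a • 1)
  refine RCongr.of_isUnit (P := fromBlocks 1 0 E 1) (by simp) ?_
  have h1 : metab (-((X : k[X]) ^ e • N)) * E =
      fromRows ((X : k[X]) ^ a • 1) (-((X : k[X]) ^ (a + e) • N)) := by
    ext (i | i) j <;> simp [metab, E, fromBlocks_mul_fromRows, pow_add, mul_assoc]
  have h2 : Eᵀ * metab (-((X : k[X]) ^ e • N)) =
      fromCols ((X : k[X]) ^ a • 1) (-((X : k[X]) ^ (a + e) • N)) := by
    rw [← (metab_symNondeg (hN.smul ((X : k[X]) ^ e)).neg).1.eq, ← transpose_mul, h1,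
      transpose_fromRows]
    simp [hN.eq]
  have h3 : fromCols ((X : k[X]) ^ a • (1 : Matrix ι ι k[X])) (-((X : k[X]) ^ (a + e) • N)) * E =
      -((X : k[X]) ^ (2 * a + e) • N) := by
    simp only [E, fromCols_mul_fromRows, Matrix.mul_zero, zero_add, Matrix.mul_smul, Matrix.mul_one,
      smul_neg, smul_smul, ← pow_add]
    congr 3
    omega
  simp [fromBlocks_transpose, fromBlocks_multiply, h1, h2, h3, sub_eq_add_neg]

/-- Take for `N` the matrix of coefficients of top degree `d = 2a + e`, where `e` is the parity of
`d`. The new entries have degree at most `a + e`, which is below `d` as soon as `a ≥ 1`, that is, as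
long as `d ≥ 2`. -/
theorem EndsAgree.of_pencils
    (hp : ∀ (τ : Type) [Fintype τ] [DecidableEq τ] (B : Matrix τ τ k[X]),
      (∀ i j, (B i j).natDegree ≤ 1) → EndsAgree B) (d : ℕ) :
    ∀ (τ : Type) [Fintype τ] [DecidableEq τ] (B : Matrix τ τ k[X]),
      (∀ i j, (B i j).natDegree ≤ d) → EndsAgree B := by
  induction d using Nat.strong_induction_on with | _ d ih => ?_
  rcases Nat.lt_or_ge d 2 with hd | hd
  · exact fun τ _ _ B hB => hp τ B fun i j => (hB i j).trans (by omega)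
  intro τ _ _ B hB hBn
  obtain ⟨a, e, rfl, he, ha⟩ : ∃ a e, d = 2 * a + e ∧ e ≤ 1 ∧ 1 ≤ a :=
    ⟨d / 2, d % 2, by omega, by omega, by omega⟩
  let N : Matrix τ τ k[X] := B.map fun p => C (p.coeff (2 * a + e))
  have hN : N.IsSymm := hBn.1.map _
  have hcongr := higman B N a e hN
  have hM : (-((X : k[X]) ^ e • N)).IsSymm := (hN.smul _).neg
  have hn := SymNondeg.of_congr hcongr (hBn.fromBlocks (metab_symNondeg hM))
  refine EndsAgree.of_split hM hn hcongr (ih (2 * a + e - 1) (by omega) _ _ ?_) hBn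
  have hX (j : ℕ) (hj : j ≤ 2 * a + e - 1) (i i' : τ) :
      ((X : k[X]) ^ j * N i i').natDegree ≤ 2 * a + e - 1 := by
    refine natDegree_mul_le.trans ?_
    simp only [N, map_apply, natDegree_C, natDegree_X_pow]
    omega
  have h1 (j : ℕ) (hj : j ≤ 2 * a + e - 1) (i i' : τ) :
      ((X : k[X]) ^ j * (1 : Matrix τ τ k[X]) i i').natDegree ≤ 2 * a + e - 1 := by
    refine natDegree_mul_le.trans ?_
    rw [one_apply]
    split_ifs <;> simp <;> omega
  have hdiff (i i' : τ) : (B i i' - (X : k[X]) ^ (2 * a + e) * N i i').natDegree ≤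
      2 * a + e - 1 := by
    rw [natDegree_le_iff_coeff_eq_zero]
    intro n hn
    have hn' : 2 * a + e ≤ n := by omega
    rw [coeff_sub, mul_comm]
    simp only [N, map_apply, coeff_C_mul, coeff_X_pow]
    rcases hn'.eq_or_lt with rfl | h
    · simp
    · rw [if_neg (by omega), mul_zero, sub_zero,
        coeff_eq_zero_of_natDegree_lt ((hB i i').trans_lt h)]
  have hone (i i' : τ) : ((1 : Matrix τ τ k[X]) i i').natDegree ≤ 2 * a + e - 1 := by
    rw [one_apply]
    split_ifs <;> simp
  rintro (i | i | i) (j | j | j)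
  · exact hdiff i j
  · exact h1 a (by omega) i j
  · exact (natDegree_neg _).le.trans (hX _ (by omega) i j)
  · exact h1 a (by omega) i j
  · simp [metab]
  · exact hone i j
  · exact (natDegree_neg _).le.trans (hX _ (by omega) i j)
  · exact hone i j
  · exact (natDegree_neg _).le.trans (hX _ (by omega) i j)

theorem matrix_eq_pencil {σ : Type} {B : Matrix σ σ k[X]} (hB : ∀ i j, (B i j).natDegree ≤ 1) :
    B = (B.map fun p => p.coeff 0).map C + (X : k[X]) • (B.map fun p => p.coeff 1).map C := by
  ext1 i j
  refine (eq_X_add_C_of_natDegree_le_one (hB i j)).trans ?_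
  rw [Matrix.add_apply, Matrix.smul_apply, map_apply, map_apply, smul_eq_mul, mul_comm, add_comm]
  rfl

/-- The first basis vector is isotropic, pairs to 1 with the second and to 0 with the others, so the
first two span a metabolic plane. Adding multiples of the isotropic vector clears the mixed block
`β` and leaves `W` as it is, so the remaining form is still a pencil. -/
theorem EndsAgree.of_congr_splitting {B : Matrix τ τ k[X]} (hB : ∀ i j, (B i j).natDegree ≤ 1)
    {P : Matrix τ (Unit ⊕ (Unit ⊕ κ)) k} {Q : Matrix (Unit ⊕ (Unit ⊕ κ)) τ k} (hPQ : P * Q = 1)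
    (hQP : Q * P = 1) (hcol : ∀ j, ((P.map C)ᵀ * B * P.map C) j (Sum.inl ()) =
      if j = Sum.inr (Sum.inl ()) then 1 else 0)
    (ih : ∀ (A : Matrix κ κ k[X]), (∀ i j, (A i j).natDegree ≤ 1) → EndsAgree A) :
    EndsAgree B := by
  intro hBn
  let D := (P.map C)ᵀ * B * P.map C
  have hD1 : RCongr D B := by
    refine ⟨P.map C, Q.map C, ?_, ?_, rfl⟩
    · rw [← Matrix.map_mul, hPQ, Matrix.map_one _ (map_zero _) (map_one _)]
    · rw [← Matrix.map_mul, hQP, Matrix.map_one _ (map_zero _) (map_one _)]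
  have hDn := hBn.of_congr hD1
  have hDdeg (i j) : (D i j).natDegree ≤ 1 := by
    simp only [D, Matrix.mul_apply, transpose_apply, map_apply, Finset.sum_mul]
    refine natDegree_sum_le_of_forall_le _ _ fun x _ => natDegree_sum_le_of_forall_le _ _ fun y _ => ?_
    exact (natDegree_mul_C_le _ _).trans ((natDegree_C_mul_le _ _).trans (hB _ _))
  let α : Matrix Unit Unit k[X] := .of fun _ _ => D (Sum.inr (Sum.inl ())) (Sum.inr (Sum.inl ()))
  let β : Matrix Unit κ k[X] := .of fun _ j => D (Sum.inr (Sum.inl ())) (Sum.inr (Sum.inr j))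
  let W : Matrix κ κ k[X] := .of fun i j => D (Sum.inr (Sum.inr i)) (Sum.inr (Sum.inr j))
  let E : Matrix (Unit ⊕ Unit) κ k[X] := fromRows 0 β
  let F : Matrix (Unit ⊕ Unit) κ k[X] := fromRows (-β) 0
  have hα : α.IsSymm := by ext i j; rfl
  have hDe : D.submatrix (Equiv.sumAssoc Unit Unit κ) (Equiv.sumAssoc Unit Unit κ) =
      fromBlocks (metab α) E Eᵀ W := by
    have hc (j) : D j (Sum.inl ()) = if j = Sum.inr (Sum.inl ()) then 1 else 0 := hcol j
    have hr (j) : D (Sum.inl ()) j = if j = Sum.inr (Sum.inl ()) then 1 else 0 := by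
      rw [← hc, hDn.1.apply]
    ext1 i j
    rcases i with (⟨⟩ | ⟨⟩) | i <;> rcases j with (⟨⟩ | ⟨⟩) | j <;>
      simp [hc, hr, metab, E, α, β, W]
    exact hDn.1.apply _ _
  have hred : RCongr (fromBlocks (metab α) 0 0 W) (fromBlocks (metab α) E Eᵀ W) := by
    refine RCongr.fromBlocks_reduce (L := F) W (metab_symNondeg hα).1 ?_ ?_
    · ext (i | i) j <;> simp [F, E, metab, fromBlocks_mul_fromRows]
    · have : Eᵀ = fromCols 0 βᵀ := by simp [E, transpose_fromRows]
      rw [this, fromCols_mul_fromRows]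
      simp
  have hswap : RCongr (fromBlocks W 0 0 (metab α)) (fromBlocks (metab α) 0 0 W) := by
    have := RCongr.of_equiv (fromBlocks (metab α) 0 0 W) (Equiv.sumComm κ (Unit ⊕ Unit))
    simpa using this
  have hfin : RCongr B (fromBlocks W 0 0 (metab α)) := by
    have h2 := RCongr.of_equiv D (Equiv.sumAssoc Unit Unit κ)
    rw [hDe] at h2
    exact ((hswap.trans hred).trans (h2.trans hD1)).symm
  have hW : SymNondeg W := SymNondeg.of_fromBlocks
    (hBn.of_congr ((hred.trans ((hDe ▸ RCongr.of_equiv D (Equiv.sumAssoc Unit Unit κ)))).trans hD1))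
  exact EndsAgree.of_summand hα hW hfin (ih W fun i j => hDdeg _ _) hBn

/-- If `A₀ + X A₁` is invertible, so is `1 + X N` with `N = A₀⁻¹ A₁`, and `N` is nilpotent. If `N ≠
0`, choose `v = N w ≠ 0` with `N v = 0`. Then `A₁ v = 0` and `vᵀ A₀ v = vᵀ A₁ w = 0`, so `v` is
isotropic over `k[X]` with constant pairings; a plane splits off and the rank drops. If `N = 0`, the
pencil is constant. -/
theorem endsAgree_pencil (n : ℕ) :
    ∀ (τ : Type) [Fintype τ] [DecidableEq τ], Fintype.card τ = n → ∀ (B : Matrix τ τ k[X]),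
      (∀ i j, (B i j).natDegree ≤ 1) → EndsAgree B := by
  induction n using Nat.strong_induction_on with | _ n ih => ?_
  intro τ _ _ hτ B hB hBn
  let A₀ : Matrix τ τ k := B.map fun p => p.coeff 0
  let A₁ : Matrix τ τ k := B.map fun p => p.coeff 1
  have hpencil : B = A₀.map C + (X : k[X]) • A₁.map C := matrix_eq_pencil hB
  have hA₀' : B.map (evalRingHom 0) = A₀ := by
    ext i j
    simp [A₀, coeff_zero_eq_eval_zero]
  have hA₀ : SymNondeg A₀ := hA₀' ▸ hBn.map (evalRingHom 0)
  have hA₁ : A₁.IsSymm := hBn.1.map _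
  by_cases h1 : A₁ = 0
  · congr 1
    rw [hpencil, h1]
    ext i j
    simp
  · let N := A₀⁻¹ * A₁
    have hA₀N : A₀ * N = A₁ := by
      simp only [N]
      rw [← Matrix.mul_assoc, mul_nonsing_inv _ hA₀.2, Matrix.one_mul]
    have hN0 : N ≠ 0 := fun h => h1 (by rw [← hA₀N, h, Matrix.mul_zero])
    have hNnil : IsNilpotent N := by
      apply isNilpotent_of_isUnit_det
      have hdet : B = A₀.map C * (1 + (X : k[X]) • N.map C) := by
        rw [Matrix.mul_add, Matrix.mul_one, Matrix.mul_smul, ← Matrix.map_mul, hA₀N, ← hpencil]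
      have := hBn.2
      rw [hdet, det_mul] at this
      exact isUnit_of_mul_isUnit_right this
    obtain ⟨w, hw, hw'⟩ := exists_mem_ker_range_of_isNilpotent hNnil hN0
    set v := N *ᵥ w with hv
    have hv1 : A₁ *ᵥ v = 0 := by rw [← hA₀N, ← mulVec_mulVec, hw', mulVec_zero]
    have hv0 : v ⬝ᵥ A₀ *ᵥ v = 0 := by
      have : A₀ *ᵥ v = A₁ *ᵥ w := by rw [hv, mulVec_mulVec, hA₀N]
      rw [this, dotProduct_mulVec, ← mulVec_transpose, hA₁.eq, hv1, zero_dotProduct]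
    obtain ⟨κ, _, _, P, Q, hPQ, hQP, hcol, hrow⟩ := exists_isotropic_splitting hA₀ hw hv0
    have hcard : Fintype.card κ < n := by
      have := square_of_invertible Q P hQP hPQ
      simp at this
      omega
    refine EndsAgree.of_congr_splitting hB hPQ hQP ?_ (fun A hA => ih _ hcard κ rfl A hA) hBn
    have h00 : (Pᵀ * A₀ * P) *ᵥ Pi.single (Sum.inl ()) 1 = Pi.single (Sum.inr (Sum.inl ())) 1 := by
      rw [← mulVec_mulVec, hcol, ← mulVec_mulVec, hrow]
    have h11 : (Pᵀ * A₁ * P) *ᵥ Pi.single (Sum.inl ()) 1 = 0 := by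
      rw [← mulVec_mulVec, hcol, ← mulVec_mulVec, hv1, mulVec_zero]
    intro j
    have e0 := congrFun h00 j
    have e1 := congrFun h11 j
    rw [mulVec_single_one] at e0 e1
    have : (P.map C)ᵀ * B * P.map C =
        (Pᵀ * A₀ * P).map C + (X : k[X]) • (Pᵀ * A₁ * P).map C := by
      rw [hpencil]
      simp [Matrix.mul_add, Matrix.add_mul, Matrix.map_mul, transpose_map]
    rw [this]
    simp only [col_apply, Pi.single_apply, Pi.zero_apply] at e0 e1
    simp only [Matrix.add_apply, Matrix.smul_apply, map_apply, e0, e1]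
    split_ifs <;> simp

/-- Homotopy invariance of the stable class. -/
theorem endsAgree (B : Matrix τ τ k[X]) : EndsAgree B := by
  refine EndsAgree.of_pencils (fun τ _ _ B hB => endsAgree_pencil _ τ rfl B hB)
    (Finset.univ.sup fun ij : τ × τ => (B ij.1 ij.2).natDegree) τ B fun i j => ?_
  exact Finset.le_sup (f := fun ij : τ × τ => (B ij.1 ij.2).natDegree) (Finset.mem_univ (i, j))

end invariance
end NaiveP1
end

/-! ### Explicit homotopies and generation by the functions X/u -/

noncomputable section
namespace NaiveP1
open Polynomial

section homotopies
variable {k : Type*} [Field k]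

theorem map_C_map_eval (a : k) (P : k[X]) :
    (P.map (C : k →+* k[X])).map (evalRingHom a) = P := by
  have : (evalRingHom a).comp C = RingHom.id k := by ext; simp
  rw [Polynomial.map_map, this, Polynomial.map_id]

theorem PP.sound {f g : PtRat k} (h : Homotopic f g) : PP.mk f = PP.mk g := Quot.sound h

namespace PtRat
variable {R : Type*} [CommRing R]

/-- The function `A / b` with `b` an invertible constant. -/
def overConst (A : R[X]) (hA : A.Monic) (hd : 0 < A.degree) (b : Rˣ) : PtRat R :=
  ofCoprime A (C (b : R)) hA (degree_C_le.trans_lt hd) ⟨0, C (↑b⁻¹ : R), by rw [← C_mul]; simp⟩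

theorem bez_overConst (A : R[X]) (hA : A.Monic) (hd : 0 < A.degree) (b : Rˣ) :
    (overConst A hA hd b).bezU = 0 ∧ (overConst A hA hd b).bezV = C (↑b⁻¹ : R) :=
  bezout_unique _ (bezout _) (degree_bezV_lt _)
    (by change A * 0 + C (b : R) * C (↑b⁻¹ : R) = 1; rw [← C_mul]; simp)
    (degree_C_le.trans_lt hd)

/-- One step of the Euclidean algorithm. -/
theorem exists_eq_overConst_naiveSum (f : PtRat k) (hf : f.den ≠ 0) :
    ∃ (A : k[X]) (hA : A.Monic) (hd : 0 < A.degree) (b : kˣ) (g : PtRat k),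
      g.deg = f.den.natDegree ∧ f = (overConst A hA hd b).naiveSum g := by
  have hb : f.den.leadingCoeff ≠ 0 := leadingCoeff_ne_zero.2 hf
  let b : kˣ := Units.mk0 _ hb
  let A₂ : k[X] := f.den * C f.den.leadingCoeff⁻¹
  have hA₂ : A₂.Monic := monic_mul_leadingCoeff_inv hf
  have hbb : C (b : k) * C (↑b⁻¹ : k) = 1 := by rw [← C_mul]; simp
  have hden : f.den = C (b : k) * A₂ := by
    change f.den = C (b : k) * (f.den * C (↑b⁻¹ : k))
    linear_combination (-f.den) * hbb
  have hA₂d : A₂.degree = f.den.degree := degree_mul_leadingCoeff_inv _ hf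
  have hdiv := modByMonic_add_div f.num A₂
  have hcop : IsCoprime A₂ (C (-(b : k)) * (f.num %ₘ A₂)) := by
    obtain ⟨x, y, hxy⟩ := f.isCoprime
    refine ⟨x * (f.num /ₘ A₂) + y * C (b : k), -x * C (↑b⁻¹ : k), ?_⟩
    rw [C_neg]
    linear_combination hxy + x * hdiv - y * hden + x * (f.num %ₘ A₂) * hbb
  have hdeg : (C (-(b : k)) * (f.num %ₘ A₂)).degree < A₂.degree := by
    rw [← smul_eq_C_mul]
    exact (degree_smul_le _ _).trans_lt (degree_modByMonic_lt _ hA₂)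
  have hlt : A₂.degree < f.num.degree := by rw [hA₂d]; exact f.degree_lt
  have hA : (f.num /ₘ A₂).Monic := by
    have := leadingCoeff_divByMonic_of_monic hA₂ hlt.le
    rwa [f.monic.leadingCoeff] at this
  have hd : 0 < (f.num /ₘ A₂).degree := by
    rw [← natDegree_pos_iff_degree_pos, natDegree_divByMonic _ hA₂]
    exact Nat.sub_pos_of_lt (natDegree_lt_natDegree hA₂.ne_zero hlt)
  -- With `B = b A₂` and `A = Q A₂ + r`, the decomposition is `Q/b ⊕ A₂/(-b r)`.
  refine ⟨_, hA, hd, b, ofCoprime A₂ _ hA₂ hdeg hcop, natDegree_eq_of_degree_eq hA₂d, ?_⟩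
  ext1
  · rw [naiveSum_num, (bez_overConst _ _ _ _).2]
    change f.num = (f.num /ₘ A₂) * A₂ - C (↑b⁻¹ : k) * (C (-(b : k)) * (f.num %ₘ A₂))
    rw [C_neg]
    linear_combination -hdiv - (f.num %ₘ A₂) * hbb
  · rw [naiveSum_den, (bez_overConst _ _ _ _).1, zero_mul, add_zero]
    exact hden

/-- An invertible constant denominator is coprime to every numerator, so the segment from `A` to
`A'` is a homotopy; it stays monic because `A' - A` has smaller degree. -/
theorem mk_overConst {A A' : k[X]} (hA : A.Monic) (hd : 0 < A.degree) (hA' : A'.Monic)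
    (hd' : 0 < A'.degree) (h : A.degree = A'.degree) (b : kˣ) :
    PP.mk (overConst A hA hd b) = PP.mk (overConst A' hA' hd' b) := by
  have hlt : (C (X : k[X]) * (A' - A).map C).degree < (A.map (C : k →+* k[X])).degree := by
    rw [← smul_eq_C_mul, hA.degree_map]
    refine (degree_smul_le _ _).trans_lt (degree_map_le.trans_lt ?_)
    rw [h]
    exact degree_sub_lt_left h.symm hA'.ne_zero (by rw [hA.leadingCoeff, hA'.leadingCoeff])
  refine PP.sound ⟨overConst (A.map C + C X * (A' - A).map C) ((hA.map C).add_of_left hlt)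
    (by rwa [degree_add_eq_left_of_degree_lt hlt, hA.degree_map]) (Units.map (C : k →+* k[X]) b),
    ?_, ?_⟩
  · ext1
    · change (A.map C + C X * (A' - A).map C).map (evalRingHom 0) = A
      simp [map_C_map_eval, -Polynomial.map_sub]
    · change (C (C (b : k))).map (evalRingHom 0) = C (b : k)
      simp
  · ext1
    · change (A.map C + C X * (A' - A).map C).map (evalRingHom 1) = A'
      rw [Polynomial.map_add, Polynomial.map_mul, map_C_map_eval, map_C_map_eval]
      simp
    · change (C (C (b : k))).map (evalRingHom 1) = C (b : k)
      simp

/-- The function `Xᵐ⁺² / (b + c Xᵐ⁺¹)` with `b` an invertible constant. -/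
def powOver [Nontrivial R] (m : ℕ) (b : Rˣ) (c : R) : PtRat R :=
  ofCoprime (X ^ (m + 2)) (C (b : R) + C c * X ^ (m + 1)) (monic_X_pow _)
    (by
      rw [degree_X_pow]
      refine (degree_add_le _ _).trans_lt (max_lt ?_ ?_)
      · exact degree_C_le.trans_lt (by exact_mod_cast Nat.succ_pos _)
      · exact (degree_C_mul_X_pow_le _ _).trans_lt (by exact_mod_cast Nat.lt_succ_self _))
    (by
      refine IsCoprime.pow_left ?_
      have h1 : IsCoprime (X : R[X]) (C (b : R)) :=
        ⟨0, C (↑b⁻¹ : R), by rw [← C_mul]; simp⟩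
      have h2 : C (b : R) + C c * X ^ (m + 1) = C (b : R) + X * (C c * X ^ m) := by ring
      rw [h2]
      exact h1.add_mul_left_right _)

theorem powOver_map {S : Type*} [CommRing S] [Nontrivial R] [Nontrivial S] (φ : R →+* S) (m : ℕ)
    (b : Rˣ) (c : R) : (powOver m b c).map φ = powOver m (Units.map φ b) (φ c) := by
  ext1
  · change (X ^ (m + 2)).map φ = X ^ (m + 2)
    simp
  · change (C (b : R) + C c * X ^ (m + 1)).map φ = C (φ b) + C (φ c) * X ^ (m + 1)
    simp

/-- Any polynomial with invertible constant term is coprime to a power of `X`. The deformation makes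
the denominator nonconstant, so that Euclid's step can be applied to it. -/
theorem mk_overConst_X_pow (m : ℕ) (hd : 0 < (X ^ (m + 2) : k[X]).degree) (b : kˣ) :
    PP.mk (overConst (X ^ (m + 2)) (monic_X_pow _) hd b) = PP.mk (powOver m b 1) := by
  refine PP.sound ⟨powOver m (Units.map (C : k →+* k[X]) b) X, ?_, ?_⟩
  · rw [powOver_map]
    ext1
    · change (X ^ (m + 2) : k[X]) = X ^ (m + 2)
      rfl
    · change C ((C (b : k)).eval 0) + C ((X : k[X]).eval 0) * X ^ (m + 1) = C (b : k)
      simp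
  · rw [powOver_map]
    ext1
    · change (X ^ (m + 2) : k[X]) = X ^ (m + 2)
      rfl
    · change C ((C (b : k)).eval 1) + C ((X : k[X]).eval 1) * X ^ (m + 1) =
        C (b : k) + C 1 * X ^ (m + 1)
      simp

theorem natDegree_powOver_den (m : ℕ) (b : kˣ) : (powOver m b 1).den.natDegree = m + 1 := by
  change (C (b : k) + C 1 * X ^ (m + 1)).natDegree = _
  have : (C (b : k)).degree < (C (1 : k) * X ^ (m + 1)).degree := by
    rw [degree_C_mul_X_pow _ one_ne_zero]
    exact degree_C_le.trans_lt (by exact_mod_cast Nat.succ_pos m)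
  rw [natDegree_eq_of_degree_eq (degree_add_eq_right_of_degree_lt this),
    natDegree_C_mul_X_pow _ _ one_ne_zero]

theorem deg_powOver (m : ℕ) (b : kˣ) (c : k) : (powOver m b c).deg = m + 2 := natDegree_X_pow _

theorem overConst_X_pow_one (hd : 0 < (X ^ 1 : k[X]).degree) (b : kˣ) :
    overConst (X ^ 1) (monic_X_pow 1) hd b = lin b := by
  ext1
  · change (X ^ 1 : k[X]) = X
    exact pow_one _
  · change C (b : k) = C (b : k)
    rfl

theorem eq_infty_of_deg {f : PtRat k} (h : f.deg = 0) : f = infty := by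
  have hA : f.num = 1 := eq_one_of_monic_natDegree_zero f.monic h
  ext1
  · exact hA
  · have := f.degree_lt
    rw [hA, degree_one, Nat.WithBot.lt_zero_iff, degree_eq_bot] at this
    exact this

end PtRat

theorem PP.mk_naiveSum (f g : PtRat k) :
    (PP.mk f).naiveSum (PP.mk g) = PP.mk (f.naiveSum g) := rfl

/-- The class of `X / u₁ ⊕ ⋯ ⊕ X / uₙ`. -/
def word (l : List kˣ) : PP k :=
  l.foldr (fun u x => (PP.mk (PtRat.lin u)).naiveSum x) PP.zero

theorem word_cons (u : kˣ) (l : List kˣ) :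
    word (u :: l) = (PP.mk (PtRat.lin u)).naiveSum (word l) := rfl

theorem word_append (l l' : List kˣ) : word (l ++ l') = (word l).naiveSum (word l') := by
  induction l with
  | nil => exact ((isGradedBimonoid_PP k).zero_add _).symm
  | cons u l ih =>
    rw [List.cons_append, word_cons, ih, word_cons, (isGradedBimonoid_PP k).add_assoc]

-- Induction on the degree. A nonconstant denominator allows a Euclidean step. A constant one lets
-- the numerator be deformed to `Xⁿ`: this is a generator if `n = 1`, and for `n ≥ 2` the
-- denominator is then deformed to a nonconstant one.
open PtRat in
theorem exists_word (f : PtRat k) : ∃ l, word l = PP.mk f := by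
  induction hn : f.deg using Nat.strong_induction_on generalizing f with | _ n ih => ?_
  -- Both summands have positive degree, hence degree less than `n`.
  have step (f : PtRat k) (hf : f.deg = n) (hpos : 0 < f.den.natDegree) :
      ∃ l, word l = PP.mk f := by
    obtain ⟨A, hA, hd, b, g, hg, rfl⟩ := f.exists_eq_overConst_naiveSum
      (ne_zero_of_natDegree_gt hpos)
    rw [deg_naiveSum] at hf
    have hA0 : 0 < (overConst A hA hd b).deg := natDegree_pos_iff_degree_pos.2 hd
    obtain ⟨l, hl⟩ := ih _ (by omega) (overConst A hA hd b) rfl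
    obtain ⟨l', hl'⟩ := ih _ (by omega) g rfl
    exact ⟨l ++ l', by rw [word_append, hl, hl', PP.mk_naiveSum]⟩
  rcases Nat.eq_zero_or_pos f.den.natDegree with h0 | h0
  swap
  · exact step f hn h0
  rcases Nat.eq_zero_or_pos n with rfl | hpos
  · exact ⟨[], by rw [eq_infty_of_deg hn]; rfl⟩
  obtain ⟨b, hb⟩ := natDegree_eq_zero.1 h0
  have hd : 0 < f.num.degree := by
    rw [← hn] at hpos
    exact natDegree_pos_iff_degree_pos.1 hpos
  have hb0 : b ≠ 0 := by
    rintro rfl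
    have h1 : f.num = 1 := by
      obtain ⟨x, y, hxy⟩ := f.isCoprime
      rw [← hb, C_0, mul_zero, add_zero] at hxy
      exact f.monic.eq_one_of_isUnit (IsUnit.of_mul_eq_one_right _ hxy)
    rw [h1, degree_one] at hd
    exact lt_irrefl _ hd
  let b' : kˣ := Units.mk0 b hb0
  have hf : f = overConst f.num f.monic hd b' := by
    ext1
    · rfl
    · exact hb.symm
  have hXd : (X ^ n : k[X]).degree = f.num.degree := by rw [degree_X_pow, degree_num, hn]
  have hmk : PP.mk f = PP.mk (overConst (X ^ n) (monic_X_pow n) (by rwa [hXd]) b') := by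
    exact (congrArg PP.mk hf).trans (mk_overConst _ _ _ _ hXd.symm _)
  rw [hmk]
  rcases Nat.lt_or_ge n 2 with h2 | h2
  · obtain rfl : n = 1 := by omega
    refine ⟨[b'], ?_⟩
    rw [word_cons, overConst_X_pow_one]
    exact (isGradedBimonoid_PP k).add_zero _
  · obtain ⟨m, rfl⟩ : ∃ m, n = m + 2 := ⟨n - 2, by omega⟩
    rw [mk_overConst_X_pow]
    exact step _ (deg_powOver _ _ _) (by rw [natDegree_powOver_den]; omega)

/-! ### Functions of degree two and the relations between generators -/

section quadratic
variable {R S : Type*} [CommRing R] [CommRing S]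

/-- The function `(X² + pX + q) / (rX + s)` of degree two. -/
def quad [Nontrivial R] (p q r s : R) (h : IsUnit ((p * s - q * r) * r - s ^ 2)) : PtRat R :=
  PtRat.ofCoprime (X ^ 2 + (C p * X + C q)) (C r * X + C s)
    (monic_X_pow_add (degree_linear_le.trans_lt (by norm_num)))
    (by
      rw [degree_add_eq_left_of_degree_lt (p := X ^ 2), degree_X_pow]
      · exact degree_linear_le.trans_lt (by norm_num)
      · rw [degree_X_pow]
        exact degree_linear_le.trans_lt (by norm_num))
    (by
      obtain ⟨u, hu⟩ := h
      have h1 : C (u : R) * C (↑u⁻¹ : R) = 1 := by rw [← C_mul]; simp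
      have h2 : (C (u : R)) = (C p * C s - C q * C r) * C r - C s ^ 2 := by
        rw [hu]; simp
      -- Pseudo-division of `r² A` by `B`; the remainder is, up to sign, the given unit.
      refine ⟨-C r ^ 2 * C (↑u⁻¹ : R), (C r * X + C p * C r - C s) * C (↑u⁻¹ : R), ?_⟩
      linear_combination h1 - C (↑u⁻¹ : R) * h2)

theorem quad_map [Nontrivial R] [Nontrivial S] (φ : R →+* S) (p q r s : R)
    (h : IsUnit ((p * s - q * r) * r - s ^ 2)) :
    (quad p q r s h).map φ = quad (φ p) (φ q) (φ r) (φ s) (by simpa using h.map φ) := by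
  ext1
  · change (X ^ 2 + (C p * X + C q)).map φ = X ^ 2 + (C (φ p) * X + C (φ q))
    simp
  · change (C r * X + C s).map φ = C (φ r) * X + C (φ s)
    simp

/-- The class of the functions of degree two with Bézout form `[m, s; s, r]`. -/
def quadClass (m s r : k) : PP k :=
  open Classical in
  if h : m * r - s ^ 2 ≠ 0 then
    -- With `d = m r - s²`, the values `p = -s m / d` and `q = -m² / d` solve `p s - q r = m`
    -- without dividing by `r` or `s`. In the degenerate case the value is a dummy.
    PP.mk (quad (-s * m * (m * r - s ^ 2)⁻¹) (-m ^ 2 * (m * r - s ^ 2)⁻¹) r s (by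
      refine isUnit_iff_ne_zero.2 ?_
      convert h using 1
      field_simp
      ring))
  else PP.zero

/-- The Bézout matrix is `[p s - q r, s; s, r]`. Along the segment from `(p, q)` to `(p', q')` it is
constant, and so is the resultant. -/
theorem mk_quad_eq {p q p' q' r s : k} (h : IsUnit ((p * s - q * r) * r - s ^ 2))
    (h' : IsUnit ((p' * s - q' * r) * r - s ^ 2)) (hm : p * s - q * r = p' * s - q' * r) :
    PP.mk (quad p q r s h) = PP.mk (quad p' q' r s h') := by
  have hu : IsUnit (((C p + X * C (p' - p)) * C s - (C q + X * C (q' - q)) * C r) * C r -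
      C s ^ 2 : k[X]) := by
    convert h.map (C : k →+* k[X]) using 1
    have := congrArg (C : k → k[X]) hm
    simp only [C_sub, C_mul, C_pow] at this ⊢
    linear_combination (-X * C r) * this
  refine PP.sound ⟨quad _ _ _ _ hu, ?_, ?_⟩ <;> rw [quad_map] <;> congr 1 <;> simp

theorem mk_quad {p q r s : k} (h : IsUnit ((p * s - q * r) * r - s ^ 2)) :
    PP.mk (quad p q r s h) = quadClass (p * s - q * r) s r := by
  rw [quadClass, dif_pos h.ne_zero]
  refine mk_quad_eq _ _ ?_
  have := mul_inv_cancel₀ h.ne_zero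
  linear_combination (-(p * s - q * r)) * this

/-- Homotopies in degree two now come from families of symmetric 2×2 matrices of constant nonzero
determinant. -/
theorem quadClass_homotopy (m s r : k[X]) {d : k} (hd : d ≠ 0) (h : m * r - s ^ 2 = C d) :
    quadClass (m.eval 0) (s.eval 0) (r.eval 0) = quadClass (m.eval 1) (s.eval 1) (r.eval 1) := by
  have hm : (-s * m * C d⁻¹) * s - (-m ^ 2 * C d⁻¹) * r = m := by
    have : C d * C d⁻¹ = 1 := by rw [← C_mul, mul_inv_cancel₀ hd, C_1]
    linear_combination m * C d⁻¹ * h + m * this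
  have hu : IsUnit (((-s * m * C d⁻¹) * s - (-m ^ 2 * C d⁻¹) * r) * r - s ^ 2) := by
    rw [hm, h]
    exact isUnit_C.2 (isUnit_iff_ne_zero.2 hd)
  have key (a : k) : PP.mk ((quad _ _ _ _ hu).map (evalRingHom a)) =
      quadClass (m.eval a) (s.eval a) (r.eval a) := by
    rw [quad_map, mk_quad]
    congr 1
    have := congrArg (eval a) hm
    simpa using this
  rw [← key, ← key]
  exact PP.sound ⟨_, rfl, rfl⟩

/-- An elementary congruence is joined to the identity by replacing its parameter `t` by `t X`, at
constant determinant. -/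
theorem quadClass_shear₁ {m s r : k} (h : m * r - s ^ 2 ≠ 0) (t : k) :
    quadClass m s r = quadClass (m + 2 * t * s + t ^ 2 * r) (s + t * r) r := by
  have := quadClass_homotopy (C m + 2 * (C t * X) * C s + (C t * X) ^ 2 * C r)
    (C s + C t * X * C r) (C r) h (by simp only [C_sub, C_mul, C_pow]; ring)
  simpa using this

theorem quadClass_shear₂ {m s r : k} (h : m * r - s ^ 2 ≠ 0) (t : k) :
    quadClass m s r = quadClass m (s + t * m) (r + 2 * t * s + t ^ 2 * m) := by
  have := quadClass_homotopy (C m) (C s + C t * X * C m)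
    (C r + 2 * (C t * X) * C s + (C t * X) ^ 2 * C m) h (by simp only [C_sub, C_mul, C_pow]; ring)
  simpa using this

theorem lin_lin (u v : kˣ) :
    (PP.mk (PtRat.lin u)).naiveSum (PP.mk (PtRat.lin v)) = quadClass (v : k) 0 (u : k) := by
  have hu : IsUnit (((0 : k) * 0 - (-((↑u⁻¹ : k) * (v : k))) * u) * u - 0 ^ 2) := by
    have : ((0 : k) * 0 - (-((↑u⁻¹ : k) * (v : k))) * u) * u - 0 ^ 2 = v * u := by
      have := u.inv_mul
      linear_combination (v * u : k) * this
    rw [this]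
    exact v.isUnit.mul u.isUnit
  have h1 : (PtRat.lin u).naiveSum (PtRat.lin v) = quad _ _ _ _ hu := by
    ext1
    · rw [PtRat.lin_naiveSum_num]
      change (X * X - C (↑u⁻¹ : k) * C (v : k) : k[X]) =
        X ^ 2 + (C (0 : k) * X + C (-((↑u⁻¹ : k) * (v : k))))
      simp [sq, sub_eq_add_neg]
    · rw [PtRat.lin_naiveSum_den]
      change C (u : k) * X = C (u : k) * X + C 0
      simp
  refine (congrArg PP.mk h1).trans ((mk_quad hu).trans ?_)
  congr 1
  have := u.inv_mul
  linear_combination (v : k) * this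

/-- An invertible corner `r` clears the off-diagonal entry. -/
theorem quadClass_of_unit {m s : k} {r d : kˣ} (h : m * r - s ^ 2 = d) :
    quadClass m s (r : k) = (PP.mk (PtRat.lin r)).naiveSum (PP.mk (PtRat.lin (d / r))) := by
  rw [lin_lin, quadClass_shear₁ (by rw [h]; exact d.ne_zero) (-s * (↑r⁻¹ : k))]
  have := r.mul_inv
  congr 1
  · rw [Units.val_div_eq_div_val, ← h]
    have := r.ne_zero
    simp only [Units.val_inv_eq_inv_val]
    field_simp
    ring
  · linear_combination (-s) * this

/-- Shears generate `SL₂`, so the second basis vector, which gives the lower right entry, can be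
moved to the nonzero vector `(b, d)`. -/
theorem exists_quadClass_lin_lin (u v : kˣ) {b d : k} (hbd : b ≠ 0 ∨ d ≠ 0) :
    ∃ m s : k, m * (d ^ 2 * u + b ^ 2 * v) - s ^ 2 = u * v ∧
      quadClass (v : k) 0 (u : k) = quadClass m s (d ^ 2 * u + b ^ 2 * v) := by
  have huv : (v : k) * u - 0 ^ 2 ≠ 0 := by simp
  by_cases hb : b = 0
  · subst hb
    have hd : d ≠ 0 := by simpa using hbd
    have h1 : ((v : k) + 2 * ((1 - d) / d) * (0 + 1 * v) +
        ((1 - d) / d) ^ 2 * (u + 2 * 1 * 0 + 1 ^ 2 * v)) * (u + 2 * 1 * 0 + 1 ^ 2 * v) -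
        (0 + 1 * v + (1 - d) / d * (u + 2 * 1 * 0 + 1 ^ 2 * v)) ^ 2 ≠ 0 := by
      convert huv using 1
      ring
    -- The second basis vector moves from `(0, 1)` to `(1, 1)`, and the last shear takes it to `(0,
    -- d)`.
    have e := ((quadClass_shear₂ huv 1).trans (quadClass_shear₁ (by convert huv using 1; ring)
      ((1 - d) / d))).trans (quadClass_shear₂ h1 (-d))
    refine ⟨_, _, ?_, e.trans (congrArg (quadClass _ _) ?_)⟩
    · field_simp
      ring
    · field_simp
      ring
  -- The first basis vector becomes `(1, (d - 1)/b)`; adding `b` times it to `(0, 1)` gives `(b,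
  -- d)`.
  · have e := (quadClass_shear₁ huv ((d - 1) / b)).trans
      (quadClass_shear₂ (by convert huv using 1; ring) b)
    refine ⟨_, _, ?_, e.trans (congrArg (quadClass _ _) ?_)⟩
    · field_simp
      ring
    · field_simp
      ring

theorem lin_lin_eq_of_represents {u v c : kˣ} {b d : k} (h : d ^ 2 * u + b ^ 2 * v = c) :
    (PP.mk (PtRat.lin u)).naiveSum (PP.mk (PtRat.lin v)) =
      (PP.mk (PtRat.lin c)).naiveSum (PP.mk (PtRat.lin (u * v / c))) := by
  have hbd : b ≠ 0 ∨ d ≠ 0 := by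
    by_contra! h0
    rw [h0.1, h0.2] at h
    exact c.ne_zero (by rw [← h]; simp)
  obtain ⟨m, s, h1, h2⟩ := exists_quadClass_lin_lin u v hbd
  rw [h] at h1 h2
  rw [lin_lin, h2, quadClass_of_unit (d := u * v)]
  rw [h1, Units.val_mul]

/-- The Gram matrix can be brought to `[m, s; s, 0]` with `-s² = u v`. At constant determinant `m`
slides to 0, and then the other diagonal entry slides from 0 to `c`. -/
theorem lin_lin_eq_of_isotropic {u v : kˣ} {b d : k} (hbd : b ≠ 0 ∨ d ≠ 0)
    (h : d ^ 2 * u + b ^ 2 * v = 0) (c : kˣ) :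
    (PP.mk (PtRat.lin u)).naiveSum (PP.mk (PtRat.lin v)) =
      (PP.mk (PtRat.lin c)).naiveSum (PP.mk (PtRat.lin (u * v / c))) := by
  obtain ⟨m, s, h1, h2⟩ := exists_quadClass_lin_lin u v hbd
  rw [h] at h1 h2
  have hs : -s ^ 2 = ((u * v : kˣ) : k) := by rw [Units.val_mul, ← h1]; ring
  have h3 := quadClass_homotopy (C m * (1 - X)) (C s) 0 (Units.ne_zero (u * v))
    (by rw [← hs]; simp)
  have h4 := quadClass_homotopy 0 (C s) (C (c : k) * X) (Units.ne_zero (u * v))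
    (by rw [← hs]; simp)
  rw [lin_lin, h2]
  simp only [eval_mul, eval_C, eval_sub, eval_one, eval_X, eval_zero, sub_zero, mul_one, sub_self,
    mul_zero] at h3 h4
  rw [h3, h4, quadClass_of_unit (d := u * v)]
  rw [← hs]; ring

end quadratic
end homotopies
end NaiveP1
end

/-! ### The map induced by the Bézout form -/

noncomputable section
namespace NaiveP1
open Polynomial

section bezoutClass
variable {k : Type*} [Field k]

namespace PtRat

/-- The class of the Bézout form, with its determinant. -/
def toMWdet (f : PtRat k) : MWdet k where
  form := MWs.mk f.bezForm
  scalar := f.isUnit_det_bez.unit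
  disc_eq := rfl
  scalar_eq_one h := by
    have : IsEmpty (Fin f.deg) := by
      rw [show f.deg = 0 from h]
      infer_instance
    ext
    exact Matrix.det_isEmpty

theorem bez_map_congr {R : Type*} [CommRing R] (φ : R →+* k) (F : PtRat R) :
    Congr (F.bez.map φ) (F.map φ).bez := by
  refine Congr.of_equiv (finCongr (F.deg_map φ).symm) fun i j => ?_
  change φ ((F.bezPoly.coeff i).coeff j) = ((F.map φ).bezPoly.coeff i).coeff j
  rw [bezPoly_map, coeff_map, coe_mapRingHom, coeff_map]

theorem symNondeg_bez {R : Type*} [CommRing R] (F : PtRat R) : SymNondeg F.bez :=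
  ⟨F.bez_isSymm, F.isUnit_det_bez⟩

theorem det_bez_map {R : Type*} [CommRing R] (φ : R →+* k) (F : PtRat R) :
    (F.map φ).bez.det = φ F.bez.det := by
  rw [det_bez, det_bez, map_res, deg_map]
  simp

/-- The Bézout matrix of the homotopy is symmetric and invertible over the polynomial ring, and
specializes to the Bézout matrices of the two ends. -/
theorem toMWdet_eq_of_homotopic {f g : PtRat k} (h : Homotopic f g) : f.toMWdet = g.toMWdet := by
  obtain ⟨F, rfl, rfl⟩ := h
  refine MWdet.ext ?_ (Units.ext ?_)
  · have h0 : stClass (F.symNondeg_bez.map (evalRingHom 0)) =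
        MWs.mk (F.map (evalRingHom 0)).bezForm :=
      stClass_eq_mk _ (bez_map_congr _ F)
    have h1 : stClass (F.symNondeg_bez.map (evalRingHom 1)) =
        MWs.mk (F.map (evalRingHom 1)).bezForm :=
      stClass_eq_mk _ (bez_map_congr _ F)
    exact h0.symm.trans ((endsAgree F.bez F.symNondeg_bez).trans h1)
  · change (F.map (evalRingHom 0)).bez.det = (F.map (evalRingHom 1)).bez.det
    -- The determinant is a unit of a polynomial ring over a field, hence constant.
    obtain ⟨c, -, hc⟩ := Polynomial.isUnit_iff.1 F.isUnit_det_bez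
    rw [det_bez_map, det_bez_map, ← hc]
    simp

end PtRat

/-- The pair `(⟨u⟩, u)`. -/
def MWdet.rankOne (u : kˣ) : MWdet k where
  form := MWs.mk ⟨1, Matrix.diagonal fun _ => (u : k), Matrix.isSymm_diagonal _, by simp⟩
  scalar := u
  disc_eq := congrArg QuotientGroup.mk (Units.ext (by
    change Matrix.det (Matrix.diagonal fun _ : Fin 1 => (u : k)) = u
    simp))
  scalar_eq_one h := absurd h one_ne_zero

namespace PP

/-- The map induced by the Bézout form on homotopy classes. -/
def toMWdet : PP k → MWdet k := Quot.lift PtRat.toMWdet fun _ _ => PtRat.toMWdet_eq_of_homotopic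

theorem deg_toMWdet (x : PP k) : x.toMWdet.deg = x.deg := by
  induction x using Quot.inductionOn with | _ f => rfl

theorem toMWdet_zero : (zero : PP k).toMWdet = MWdet.zero := by
  have h : (PtRat.infty : PtRat k).deg = 0 := PtRat.deg_infty
  refine MWdet.ext (MWs.mk_eq_of_isometric (.of_equiv (finCongr h) fun i => ?_)) (Units.ext ?_)
  · exact absurd i.2 (h.le.trans (Nat.zero_le _)).not_gt
  · have : IsEmpty (Fin (PtRat.infty : PtRat k).deg) := by rw [h]; infer_instance
    exact Matrix.det_isEmpty

theorem toMWdet_lin_naiveSum (u : kˣ) (x : PP k) :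
    ((mk (PtRat.lin u)).naiveSum x).toMWdet = (MWdet.rankOne u).osum x.toMWdet := by
  induction x using Quot.inductionOn with | _ g => ?_
  refine MWdet.ext (MWs.mk_eq_of_isometric ?_) (Units.ext ?_)
  · exact (PtRat.isometric_lin_naiveSum u g).trans (SymForm.osum_congr_aux _ _).symm
  · exact PtRat.det_lin_naiveSum u g

theorem toMWdet_lin (u : kˣ) : (mk (PtRat.lin u)).toMWdet = MWdet.rankOne u := by
  have := toMWdet_lin_naiveSum u (zero : PP k)
  rwa [(isGradedBimonoid_PP k).add_zero, toMWdet_zero,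
    (isGradedBimonoid_MWdet k).add_zero] at this

/-- The left summand is a word, so associativity reduces to adding one `X/u` at a time on the left.
-/
theorem toMWdet_naiveSum (x y : PP k) :
    (x.naiveSum y).toMWdet = x.toMWdet.osum y.toMWdet := by
  induction x using Quot.inductionOn with | _ f => ?_
  obtain ⟨l, hl⟩ := exists_word f
  change ((mk f).naiveSum y).toMWdet = (mk f).toMWdet.osum _
  rw [← hl]
  clear hl
  induction l with
  | nil =>
    change ((zero : PP k).naiveSum y).toMWdet = (zero : PP k).toMWdet.osum _
    rw [(isGradedBimonoid_PP k).zero_add, toMWdet_zero, (isGradedBimonoid_MWdet k).zero_add]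
  | cons u l ih =>
    rw [word_cons, (isGradedBimonoid_PP k).add_assoc, toMWdet_lin_naiveSum, toMWdet_lin_naiveSum,
      ih, (isGradedBimonoid_MWdet k).add_assoc]

theorem toMWdet_one : (one : PP k).toMWdet = MWdet.one := by
  have h : (PtRat.ident : PtRat k) = PtRat.lin 1 := by
    ext1
    · rfl
    · change (1 : k[X]) = C ((1 : kˣ) : k)
      simp
  have h1 : MWdet.rankOne (1 : kˣ) = MWdet.one := by
    refine MWdet.ext (congrArg MWs.mk ?_) rfl
    rw [SymForm.one, SymForm.mk.injEq]
    exact ⟨rfl, heq_of_eq (by simp)⟩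
  rw [one, h, toMWdet_lin, h1]

/-- Matches the sign in `det_bez` with the exponents `n` and `m²` of the composition law. -/
theorem triangle_mul (m n : ℕ) :
    m * n * (m * n - 1) / 2 = n * (m * (m - 1) / 2) + m ^ 2 * (n * (n - 1) / 2) := by
  obtain ⟨a, ha⟩ : Even (m * (m - 1)) := Nat.even_mul_pred_self _
  obtain ⟨b, hb⟩ : Even (n * (n - 1)) := Nat.even_mul_pred_self _
  have h : m * n * (m * n - 1) = 2 * (n * a + m ^ 2 * b) := by
    rcases m with _ | m
    · simp at ha; simp [show a = 0 by omega]
    rcases n with _ | n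
    · simp at hb; simp [show b = 0 by omega]
    rw [Nat.add_sub_cancel] at ha hb
    have : (m + 1) * (n + 1) - 1 = m * n + m + n :=
      Nat.sub_eq_of_eq_add (by ring)
    rw [this]
    linear_combination (n + 1) * ha + (m + 1) ^ 2 * hb
  rw [h, ha, hb, ← two_mul, ← two_mul]
  simp

theorem toMWdet_comp (x y : PP k) : (x.comp y).toMWdet = x.toMWdet.comp y.toMWdet := by
  induction x using Quot.inductionOn with | _ f => ?_
  induction y using Quot.inductionOn with | _ g => ?_
  refine MWdet.ext (MWs.mk_eq_of_isometric ?_) (Units.ext ?_)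
  · exact (PtRat.isometric_comp f g).trans (SymForm.tensor_congr_aux _ _).symm
  · change (f.comp g).bez.det = f.bez.det ^ g.deg * g.bez.det ^ (f.deg ^ 2)
    rw [PtRat.det_bez, PtRat.det_bez, PtRat.det_bez, PtRat.res_comp, PtRat.deg_comp, triangle_mul,
      mul_pow, mul_pow, ← pow_mul, ← pow_mul, pow_add, mul_comm g.deg, mul_comm (f.deg ^ 2)]
    ring

end PP

end bezoutClass
end NaiveP1
end

/-! ### Stable diagonalization and surjectivity -/

noncomputable section
namespace NaiveP1
open Matrix

section diagonalForms
variable {k : Type*} [Field k]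

/-- The diagonal form `⟨u₁, …, uₙ⟩`. -/
def diagForm (l : List kˣ) : SymForm k where
  dim := l.length
  mat := diagonal fun i => (l.get i : k)
  symm := isSymm_diagonal _
  nondeg := by
    rw [det_diagonal]
    exact IsUnit.prod_univ_iff.2 fun i => (l.get i).isUnit

theorem mk_diagForm_cons (u : kˣ) (l : List kˣ) :
    MWs.mk (diagForm (u :: l)) = (MWdet.rankOne u).form.osum (MWs.mk (diagForm l)) := by
  symm
  refine MWs.mk_eq_of_isometric ((SymForm.osum_congr_aux _ _).trans ?_)
  let e : Fin 1 ⊕ Fin l.length ≃ Fin (l.length + 1) :=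
    finSumFinEquiv.trans (finCongr (add_comm _ _))
  have h0 (i : Fin 1) : e (Sum.inl i) = 0 := by
    ext; simp [e]
  have h1 (i : Fin l.length) : e (Sum.inr i) = i.succ := by
    ext; simp [e]
  have key (i j : Fin 1 ⊕ Fin l.length) :
      Matrix.fromBlocks (diagonal fun _ : Fin 1 => (u : k)) 0 0
        (diagonal fun i => (l.get i : k)) i j =
        (diagonal fun i => ((u :: l).get i : k) : Matrix (Fin (l.length + 1)) _ k) (e i) (e j) := by
    rcases i with i | i <;> rcases j with j | j
    · rw [h0, h0, Subsingleton.elim i j]; simp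
    · rw [h0, h1, diagonal_apply_ne _ (Fin.succ_ne_zero _).symm]; rfl
    · rw [h0, h1, diagonal_apply_ne _ (Fin.succ_ne_zero _)]; rfl
    · rw [h1, h1, fromBlocks_apply₂₂]
      simp [diagonal_apply]
  exact Congr.of_equiv e key

theorem toMWdet_word (l : List kˣ) :
    (word l).toMWdet.form = MWs.mk (diagForm l) ∧ (word l).toMWdet.scalar = l.prod := by
  induction l with
  | nil =>
    rw [show word ([] : List kˣ) = PP.zero from rfl, PP.toMWdet_zero]
    refine ⟨MWs.mk_eq_of_isometric ?_, rfl⟩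
    exact Congr.of_equiv (Equiv.refl (Fin 0)) fun i => i.elim0
  | cons u l ih =>
    rw [word_cons, PP.toMWdet_lin_naiveSum, mk_diagForm_cons, ← ih.1, List.prod_cons, ← ih.2]
    exact ⟨rfl, rfl⟩

theorem deg_word (l : List kˣ) : (word l).deg = l.length := by
  rw [← PP.deg_toMWdet, MWdet.deg, (toMWdet_word l).1]
  rfl

variable {ι κ : Type} [Fintype ι] [DecidableEq ι] [Fintype κ] [DecidableEq κ]

theorem RCongr.schur {A : Matrix ι ι k} (hA : SymNondeg A) (B : Matrix ι κ k)
    (W : Matrix κ κ k) :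
    RCongr (Matrix.fromBlocks A B Bᵀ W) (Matrix.fromBlocks A 0 0 (W - Bᵀ * A⁻¹ * B)) := by
  refine .of_isUnit (P := Matrix.fromBlocks 1 (A⁻¹ * B) 0 1) (by simp) ?_
  have h1 : (A⁻¹)ᵀ = A⁻¹ := by rw [transpose_nonsing_inv, hA.1]
  simp only [fromBlocks_transpose, transpose_one, transpose_zero, transpose_mul, h1,
    fromBlocks_multiply, Matrix.one_mul, Matrix.mul_one, Matrix.zero_mul, Matrix.mul_zero,
    add_zero, zero_add]
  rw [mul_nonsing_inv_cancel_left _ _ hA.2, Matrix.mul_assoc Bᵀ A⁻¹ A, nonsing_inv_mul _ hA.2,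
    Matrix.mul_one, ← Matrix.mul_assoc, add_sub_cancel]

/-- A nondegenerate subspace splits off; the Schur complement is the form on its orthogonal. -/
theorem SymNondeg.exists_schur {A : Matrix ι ι k} (hA : SymNondeg A) {σ : Type} [Fintype σ]
    [DecidableEq σ] (P : Matrix ι (σ ⊕ κ) k) (Q : Matrix (σ ⊕ κ) ι k) (h1 : P * Q = 1)
    (h2 : Q * P = 1) (h : IsUnit (Pᵀ * A * P).toBlocks₁₁.det) :
    ∃ (hS : SymNondeg (Pᵀ * A * P).toBlocks₁₁) (W : Matrix κ κ k) (hW : SymNondeg W),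
      stClass hA = (stClass hS).osum (stClass hW) := by
  set A' := Pᵀ * A * P with hA'
  have hc : RCongr A' A := ⟨P, Q, h1, h2, rfl⟩
  have hA'n : SymNondeg A' := .of_congr hc hA
  have hS : SymNondeg A'.toBlocks₁₁ := by
    refine ⟨?_, h⟩
    ext i j
    exact congrFun (congrFun hA'n.1 (Sum.inl i)) (Sum.inl j)
  have hB : A'.toBlocks₂₁ = A'.toBlocks₁₂ᵀ := by
    ext i j
    exact (congrFun (congrFun hA'n.1 (Sum.inr i)) (Sum.inl j)).symm
  have hs := RCongr.schur hS A'.toBlocks₁₂ A'.toBlocks₂₂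
  rw [← hB, fromBlocks_toBlocks] at hs
  have hn := hA'n.of_congr hs.symm
  have hW := hn.of_fromBlocks
  refine ⟨hS, _, hW, ?_⟩
  rw [← stClass_fromBlocks hS hW]
  exact stClass_congr _ _ (hc.symm.trans hs)

theorem exists_diagForm_of_anisotropic {A : Matrix ι ι k} (hA : SymNondeg A) {v : ι → k}
    (hv : v ⬝ᵥ A *ᵥ v ≠ 0)
    (ih : ∀ (κ : Type) [Fintype κ] [DecidableEq κ] (W : Matrix κ κ k) (hW : SymNondeg W),
      Fintype.card κ < Fintype.card ι → ∃ l, stClass hW = MWs.mk (diagForm l)) :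
    ∃ l, stClass hA = MWs.mk (diagForm l) := by
  have hv0 : v ≠ 0 := by rintro rfl; simp at hv
  obtain ⟨κ, _, _, P, Q, h1, h2, hP⟩ := exists_matrix_col hv0
  have hent : (Pᵀ * A * P).toBlocks₁₁ = diagonal fun _ => v ⬝ᵥ A *ᵥ v := by
    ext ⟨⟩ ⟨⟩
    change ((Pᵀ * A) * P) (Sum.inl ()) (Sum.inl ()) = _
    simp only [Matrix.mul_apply, transpose_apply, hP, diagonal_apply_eq, dotProduct, mulVec,
      Finset.sum_mul, Finset.mul_sum, mul_assoc]
    exact Finset.sum_comm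
  have hcard : Fintype.card κ < Fintype.card ι := by
    have : Fintype.card ι = Fintype.card (Unit ⊕ κ) := square_of_invertible P Q h1 h2
    rw [this]; simp
  obtain ⟨hS, W, hW, h⟩ := hA.exists_schur P Q h1 h2 (by rw [hent]; simpa using hv)
  obtain ⟨l, hl⟩ := ih κ W hW hcard
  refine ⟨Units.mk0 _ hv :: l, ?_⟩
  rw [mk_diagForm_cons, h, hl]
  congr 1
  refine stClass_eq_mk _ (Congr.of_equiv (Equiv.ofUnique Unit (Fin 1)) ?_)
  rintro ⟨⟩ ⟨⟩
  rw [hent]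
  rfl

/-- An anisotropic basis vector splits off as a line. An isotropic one lies in a metabolic plane,
which may stably be replaced by `[0, 1; 1, 1]`, whose second basis vector has value 1. This stable
replacement is what handles alternating forms in characteristic 2. -/
theorem exists_diagForm (n : ℕ) : ∀ (ι : Type) [Fintype ι] [DecidableEq ι] (A : Matrix ι ι k)
    (hA : SymNondeg A), Fintype.card ι = n → ∃ l, stClass hA = MWs.mk (diagForm l) := by
  induction n using Nat.strong_induction_on with | _ n ih => ?_
  intro ι _ _ A hA hn
  have ih' (κ : Type) [Fintype κ] [DecidableEq κ] (W : Matrix κ κ k) (hW : SymNondeg W)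
      (h : Fintype.card κ < n) : ∃ l, stClass hW = MWs.mk (diagForm l) := ih _ h κ W hW rfl
  rcases isEmpty_or_nonempty ι with hι | ⟨⟨i₀⟩⟩
  · exact ⟨[], stClass_eq_mk _ (Congr.of_equiv (Equiv.equivOfIsEmpty ι (Fin 0))
      fun i => isEmptyElim i)⟩
  let v : ι → k := Pi.single i₀ 1
  by_cases hv : v ⬝ᵥ A *ᵥ v = 0
  · have hv0 : v ≠ 0 := by simp [v]
    obtain ⟨κ, _, _, P, Q, h1, h2, hP, hPA⟩ := exists_isotropic_splitting hA hv0 hv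
    let e := Equiv.sumAssoc Unit Unit κ
    let P' : Matrix ι ((Unit ⊕ Unit) ⊕ κ) k := P.submatrix id e
    let Q' : Matrix ((Unit ⊕ Unit) ⊕ κ) ι k := Q.submatrix e id
    have h1' : P' * Q' = 1 := by rw [submatrix_mul_equiv, h1]; simp
    have h2' : Q' * P' = 1 := by
      rw [← submatrix_mul _ _ _ _ _ Function.bijective_id, h2]; simp
    have hn0 : SymNondeg (Pᵀ * A * P) := .of_congr ⟨P, Q, h1, h2, rfl⟩ hA
    have hcol : (Pᵀ * A * P) *ᵥ Pi.single (Sum.inl ()) 1 = Pi.single (Sum.inr (Sum.inl ())) 1 := by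
      rw [← mulVec_mulVec, hP, ← mulVec_mulVec, hPA]
    rw [mulVec_single_one] at hcol
    let M : Matrix Unit Unit k := of fun _ _ =>
      (Pᵀ * A * P) (Sum.inr (Sum.inl ())) (Sum.inr (Sum.inl ()))
    have hM : M.IsSymm := rfl
    have hblk : (P'ᵀ * A * P').toBlocks₁₁ = metab M := by
      have hsub : P'ᵀ * A * P' = (Pᵀ * A * P).submatrix e e := rfl
      ext (⟨⟩ | ⟨⟩) (⟨⟩ | ⟨⟩)
      · exact congrFun hcol (Sum.inl ())
      · exact (congrFun (congrFun hn0.1 _) _).symm.trans (congrFun hcol (Sum.inr (Sum.inl ())))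
      · exact congrFun hcol (Sum.inr (Sum.inl ()))
      · rfl
    obtain ⟨hS, W, hW, h⟩ := hA.exists_schur P' Q' h1' h2'
      (by rw [hblk]; exact (metab_symNondeg hM).2)
    have h1M : (1 : Matrix Unit Unit k).IsSymm := isSymm_one
    have hS' : stClass hS = stClass (metab_symNondeg h1M) := by
      rw [stClass_metab h1M, ← stClass_metab hM]
      congr 1
    rw [h, hS', ← stClass_fromBlocks]
    have hcard : Fintype.card ((Unit ⊕ Unit) ⊕ κ) = n := by
      rw [← hn]
      exact (square_of_invertible P' Q' h1' h2').symm
    refine exists_diagForm_of_anisotropic _ (v := Pi.single (Sum.inl (Sum.inr ())) 1) ?_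
      fun κ _ _ W hW h => ih' κ W hW (hcard ▸ h)
    simp [metab]
  · exact exists_diagForm_of_anisotropic hA hv fun κ _ _ W hW h => ih' κ W hW (hn ▸ h)

theorem exists_mk_diagForm (x : MWs k) : ∃ l, x = MWs.mk (diagForm l) := by
  induction x using Quotient.inductionOn with | _ b => ?_
  obtain ⟨l, hl⟩ := exists_diagForm _ (Fin b.dim) b.mat ⟨b.symm, b.nondeg⟩ rfl
  exact ⟨l, (stClass_eq_mk _ (.refl _)).symm.trans hl⟩

theorem MWdet.form_rankOne_mul_sq (u c : kˣ) :
    (MWdet.rankOne (c ^ 2 * u)).form = (MWdet.rankOne u).form := by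
  have key : Congr (diagonal fun _ : Fin 1 => ((c ^ 2 * u : kˣ) : k))
      (diagonal fun _ : Fin 1 => (u : k)) := by
    refine ⟨diagonal fun _ => (c : k), diagonal fun _ => (↑c⁻¹ : k), ?_, ?_, ?_⟩
    · simp
    · simp
    · rw [diagonal_transpose, diagonal_mul_diagonal, diagonal_mul_diagonal]
      congr 1
      ext
      push_cast
      ring
  exact MWs.mk_eq_of_isometric key

/-- A diagonal representative of the form has the right scalar up to a square, and that square is
absorbed into the first entry. In rank 0 there is no entry, but the scalar is 1 by definition. -/
theorem PP.toMWdet_surjective : Function.Surjective (PP.toMWdet (k := k)) := by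
  intro z
  obtain ⟨l, hl⟩ := exists_mk_diagForm z.form
  have hdisc := z.disc_eq
  have hw := toMWdet_word l
  rw [hl, ← hw.1, (word l).toMWdet.disc_eq, hw.2, QuotientGroup.eq, Subgroup.mem_square] at hdisc
  obtain ⟨c, hc⟩ := hdisc
  rw [inv_mul_eq_iff_eq_mul] at hc
  rcases l with _ | ⟨u, l⟩
  · refine ⟨word [], MWdet.ext (hw.1.trans hl.symm) (hw.2.trans ?_)⟩
    exact (z.scalar_eq_one (by rw [hl]; rfl)).symm
  · refine ⟨word ((c ^ 2 * u) :: l), MWdet.ext ?_ ?_⟩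
    · rw [(toMWdet_word _).1, hl, mk_diagForm_cons, mk_diagForm_cons, MWdet.form_rankOne_mul_sq]
    · rw [(toMWdet_word _).2, hc, List.prod_cons, List.prod_cons, sq]
      simp only [mul_assoc, mul_comm, mul_left_comm]

end diagonalForms
end NaiveP1
end

/-! ### A substitute for Witt cancellation -/

noncomputable section
namespace NaiveP1
open Matrix

section lagrangian
variable {k : Type*} [Field k]

/-- Forms on `V` and `W` which become isometric after adding the same form on `U` agree on a
subspace of `V × W` of dimension at least `dim V`. -/
theorem exists_subspace_of_stable_isometry {V W U : Type*} [AddCommGroup V] [Module k V]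
    [FiniteDimensional k V] [AddCommGroup W] [Module k W] [FiniteDimensional k W] [AddCommGroup U]
    [Module k U] [FiniteDimensional k U] (bV : LinearMap.BilinForm k V)
    (bW : LinearMap.BilinForm k W) (bU : LinearMap.BilinForm k U) (hU : bU.Nondegenerate)
    (P : V × U →ₗ[k] W) (P' : V × U →ₗ[k] U)
    (h : ∀ p q, bW (P p) (P q) + bU (P' p) (P' q) = bV p.1 q.1 + bU p.2 q.2) :
    ∃ L : Submodule k (V × W), Module.finrank k V ≤ Module.finrank k L ∧
      ∀ p ∈ L, bV p.1 p.1 = bW p.2 p.2 := by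
  let D : V × U →ₗ[k] U := P' - LinearMap.snd k V U
  let φ : V × U →ₗ[k] V × W := (LinearMap.fst k V U).prod P
  -- On `K` the isometry `(P, P')` preserves the `U`-component, so the two terms in `bU` cancel.
  let K := LinearMap.ker D
  have hK (p : V × U) (hp : p ∈ K) : P' p = p.2 := sub_eq_zero.1 hp
  refine ⟨K.map φ, ?_, ?_⟩
  · have h1 := LinearMap.finrank_range_add_finrank_ker (φ.domRestrict K)
    rw [LinearMap.range_domRestrict] at h1
    have h2 := LinearMap.finrank_range_add_finrank_ker D
    rw [Module.finrank_prod] at h2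
    have h3 := LinearMap.BilinForm.finrank_orthogonal hU (LinearMap.range D)
    have h4 := Submodule.finrank_le (LinearMap.range D)
    have hker (z : LinearMap.ker (φ.domRestrict K)) :
        (z : V × U).1 = 0 ∧ P z = 0 := Prod.ext_iff.1 z.2
    -- What `K` loses under `φ` consists of vectors of `U` fixed by the isometry, hence orthogonal
    -- to the range of `D`. That orthogonal has dimension `dim U - rank D`, while `dim K = dim V +
    -- dim U - rank D`.
    let ψ : LinearMap.ker (φ.domRestrict K) →ₗ[k] bU.orthogonal (LinearMap.range D) :=
      LinearMap.codRestrict _ (LinearMap.snd k V U ∘ₗ K.subtype ∘ₗ Submodule.subtype _) fun z => by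
        rw [LinearMap.BilinForm.mem_orthogonal_iff]
        rintro _ ⟨p, rfl⟩
        change bU (P' p - p.2) (z : V × U).2 = 0
        have := h p z
        rw [(hker z).1, (hker z).2, hK _ (z : K).2, map_zero, map_zero, zero_add, zero_add] at this
        rw [map_sub, LinearMap.sub_apply, this, sub_self]
    have hψ : Function.Injective ψ := by
      intro z w hzw
      have : (z : V × U).2 = (w : V × U).2 := congrArg Subtype.val hzw
      exact Subtype.ext (Subtype.ext (Prod.ext ((hker z).1.trans (hker w).1.symm) this))
    have h5 := LinearMap.finrank_le_finrank_of_injective hψ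
    change _ + Module.finrank k K = _ at h2
    omega
  · rintro _ ⟨p, hp, rfl⟩
    have := h p p
    rw [hK p hp] at this
    exact (add_right_cancel this).symm

theorem exists_subspace_of_congr {ι κ τ : Type*} [Fintype ι] [DecidableEq ι] [Fintype κ]
    [DecidableEq κ] [Fintype τ] [DecidableEq τ] {B : Matrix ι ι k} {C : Matrix κ κ k}
    {D : Matrix τ τ k} (hD : IsUnit D.det)
    (h : Congr (fromBlocks B 0 0 D) (fromBlocks C 0 0 D)) :
    ∃ L : Submodule k ((ι → k) × (κ → k)), Fintype.card ι ≤ Module.finrank k L ∧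
      ∀ p ∈ L, p.1 ⬝ᵥ B *ᵥ p.1 = p.2 ⬝ᵥ C *ᵥ p.2 := by
  obtain ⟨P, Q, -, -, hP⟩ := h
  have hU : (Matrix.toBilin' D).Nondegenerate :=
    LinearMap.BilinForm.nondegenerate_toBilin'_of_det_ne_zero' _ hD.ne_zero
  have hv (p : (ι → k) × (τ → k)) : P *ᵥ Sum.elim p.1 p.2 =
      Sum.elim (P.toBlocks₁₁ *ᵥ p.1 + P.toBlocks₁₂ *ᵥ p.2)
        (P.toBlocks₂₁ *ᵥ p.1 + P.toBlocks₂₂ *ᵥ p.2) := by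
    conv_lhs => rw [← fromBlocks_toBlocks P]
    rw [fromBlocks_mulVec]
    rfl
  obtain ⟨L, hL, hL'⟩ := exists_subspace_of_stable_isometry (Matrix.toBilin' B) (Matrix.toBilin' C)
    (Matrix.toBilin' D) hU (P.toBlocks₁₁.mulVecLin.coprod P.toBlocks₁₂.mulVecLin)
    (P.toBlocks₂₁.mulVecLin.coprod P.toBlocks₂₂.mulVecLin) fun p q => by
      have := congrArg (fun M => Sum.elim p.1 p.2 ⬝ᵥ M *ᵥ Sum.elim q.1 q.2) hP
      simp only [← mulVec_mulVec] at this
      rw [dotProduct_mulVec, vecMul_transpose, hv, hv, fromBlocks_mulVec, fromBlocks_mulVec] at this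
      simpa [Matrix.toBilin'_apply', sumElim_dotProduct_sumElim] using this
  exact ⟨L, by simpa using hL, fun p hp => by simpa [Matrix.toBilin'_apply'] using hL' p hp⟩

end lagrangian
end NaiveP1
end

/-! ### Rewriting of words and injectivity -/

noncomputable section
namespace NaiveP1
open Matrix

section classification
variable {k : Type*} [Field k]

/-- The quadratic form of `⟨u₁, …, uₙ⟩`. -/
def diagQuad (l : List kˣ) (x : Fin l.length → k) : k := ∑ i, (l.get i : k) * x i ^ 2

theorem diagQuad_cons (u : kˣ) (l : List kˣ) (x : Fin (u :: l).length → k) :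
    diagQuad (u :: l) x = u * x 0 ^ 2 + diagQuad l (fun i => x i.succ) :=
  Fin.sum_univ_succ _

theorem diagForm_apply_self (l : List kˣ) (x : Fin l.length → k) :
    x ⬝ᵥ (diagForm l).mat *ᵥ x = diagQuad l x := by
  change x ⬝ᵥ diagonal (fun i => (l.get i : k)) *ᵥ x = _
  simp only [dotProduct, mulVec_diagonal, diagQuad]
  exact Finset.sum_congr rfl fun i _ => by ring

theorem word_eq_of_represents {u v c : kˣ} {b d : k} (h : d ^ 2 * u + b ^ 2 * v = c)
    (l : List kˣ) : word (u :: v :: l) = word (c :: (u * v / c) :: l) := by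
  simp only [word_cons]
  rw [← (isGradedBimonoid_PP k).add_assoc, lin_lin_eq_of_represents h,
    (isGradedBimonoid_PP k).add_assoc]

theorem word_eq_of_isotropic {u v : kˣ} {b d : k} (hbd : b ≠ 0 ∨ d ≠ 0)
    (h : d ^ 2 * u + b ^ 2 * v = 0) (c : kˣ) (l : List kˣ) :
    word (u :: v :: l) = word (c :: (u * v / c) :: l) := by
  simp only [word_cons]
  rw [← (isGradedBimonoid_PP k).add_assoc, lin_lin_eq_of_isotropic hbd h c,
    (isGradedBimonoid_PP k).add_assoc]

/-- A word of length at least two can be rewritten to begin with any unit that its quadratic form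
represents, and with any unit at all if its quadratic form is isotropic. -/
theorem exists_word_cons (l : List kˣ) : ∀ (u v : kˣ) (x : Fin (u :: v :: l).length → k), x ≠ 0 →
    ∀ c : kˣ, diagQuad (u :: v :: l) x = c ∨ diagQuad (u :: v :: l) x = 0 →
      ∃ m, word (u :: v :: l) = word (c :: m) := by
  have hpair (u v : kˣ) (b d : k) (hbd : b ≠ 0 ∨ d ≠ 0) (c : kˣ) (t : List kˣ)
      (h : d ^ 2 * u + b ^ 2 * v = c ∨ d ^ 2 * u + b ^ 2 * v = 0) :
      ∃ m, word (u :: v :: t) = word (c :: m) :=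
    h.elim (fun h => ⟨_, word_eq_of_represents h t⟩) fun h => ⟨_, word_eq_of_isotropic hbd h c t⟩
  induction l with
  | nil =>
    intro u v x hx c hc
    have hq : diagQuad [u, v] x = x 0 ^ 2 * u + x 1 ^ 2 * v := by
      rw [diagQuad_cons, diagQuad_cons, diagQuad]
      simp only [List.length_nil, Finset.univ_eq_empty, Finset.sum_empty, add_zero]
      change (u : k) * x 0 ^ 2 + v * x 1 ^ 2 = _
      ring
    rw [hq] at hc
    refine hpair u v (x 1) (x 0) ?_ c [] hc
    by_contra! h0
    apply hx
    ext i
    change Fin 2 at i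
    fin_cases i
    · exact h0.2
    · exact h0.1
  | cons w l ih =>
    intro u v x hx c hc
    set y : Fin (v :: w :: l).length → k := fun i => x i.succ with hy
    rw [diagQuad_cons] at hc
    by_cases hy0 : y = 0
    · have hx0 : x 0 ≠ 0 := by
        intro h0
        apply hx
        ext i
        exact Fin.cases h0 (fun j => congrFun hy0 j) i
      refine hpair u v 0 (x 0) (.inr hx0) c _ ?_
      have : diagQuad (v :: w :: l) y = 0 := by rw [hy0]; simp [diagQuad]
      rw [this] at hc
      convert hc using 2 <;> ring
    -- If the tail is isotropic at `y`, it can start with any unit: `c` itself when `x 0 = 0`, and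
    -- otherwise 1, as the first letter alone then takes the required value. If `y` has a nonzero
    -- value, the tail can start with it, and the first two letters take the value of `x` at `(x 0,
    -- 1)`.
    · by_cases he : diagQuad (v :: w :: l) y = 0
      · rw [he] at hc
        by_cases hx0 : x 0 = 0
        · obtain ⟨m, hm⟩ := ih v w y hy0 c (.inr he)
          rw [word_cons, hm]
          exact hpair u c 1 0 (.inl one_ne_zero) c m (.inl (by ring))
        · obtain ⟨m, hm⟩ := ih v w y hy0 1 (.inr he)
          rw [word_cons, hm]
          refine hpair u 1 0 (x 0) (.inr hx0) c m ?_
          convert hc using 2 <;> ring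
      · obtain ⟨m, hm⟩ := ih v w y hy0 (Units.mk0 _ he) (.inl rfl)
        rw [word_cons, hm]
        refine hpair u _ 1 (x 0) (.inl one_ne_zero) c m ?_
        convert hc using 2 <;> rw [Units.val_mk0] <;> ring

/-- The two quadratic forms agree on a subspace `L` of dimension at least `n`. A nonzero value on
`L` is a common one. If they vanish on `L`, both are isotropic and any unit would do; 1 is taken. -/
theorem exists_common_value {l l' : List kˣ} (hl : 0 < l.length)
    (h : SymForm.StablyIsometric (diagForm l) (diagForm l')) :
    ∃ (c : kˣ) (x : Fin l.length → k) (y : Fin l'.length → k), x ≠ 0 ∧ y ≠ 0 ∧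
      (diagQuad l x = c ∨ diagQuad l x = 0) ∧ (diagQuad l' y = c ∨ diagQuad l' y = 0) := by
  have hlen : l.length = l'.length := h.dim_eq
  obtain ⟨d, h⟩ := h
  obtain ⟨L, hL, hL'⟩ := exists_subspace_of_congr d.nondeg
    ((SymForm.osum_congr_aux _ _).symm.trans (Congr.trans h (SymForm.osum_congr_aux _ _)))
  change Submodule k ((Fin l.length → k) × (Fin l'.length → k)) at L
  have hLq (p) (hp : p ∈ L) : diagQuad l p.1 = diagQuad l' p.2 := by
    rw [← diagForm_apply_self, ← diagForm_apply_self]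
    exact hL' p hp
  have hLn : l.length ≤ Module.finrank k L := (Fintype.card_fin _).symm.le.trans hL
  have hzero (l : List kˣ) : diagQuad l 0 = 0 := by simp [diagQuad]
  have hsingle (l : List kˣ) (i : Fin l.length) : diagQuad l (Pi.single i 1) ≠ 0 := by
    simp [diagQuad, Pi.single_apply]
  by_cases hne : ∃ p ∈ L, diagQuad l p.1 ≠ 0
  · obtain ⟨p, hp, hpc⟩ := hne
    refine ⟨Units.mk0 _ hpc, p.1, p.2, ?_, ?_, .inl rfl, .inl (hLq p hp).symm⟩
    · intro h0
      exact hpc (by rw [h0, hzero])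
    · intro h0
      exact hpc (by rw [hLq p hp, h0, hzero])
  push Not at hne
  -- Otherwise `L` is all of `0 × kⁿ` by dimension, yet a diagonal form is nonzero on basis vectors.
  have hx : ∃ p ∈ L, p.1 ≠ 0 := by
    by_contra! hall
    have hle : L ≤ LinearMap.range (LinearMap.inr k (Fin l.length → k) (Fin l'.length → k)) :=
      fun p hp => ⟨p.2, Prod.ext (hall p hp).symm rfl⟩
    have heq := Submodule.eq_of_le_of_finrank_le hle (by
      rw [LinearMap.finrank_range_of_inj LinearMap.inr_injective, Module.finrank_fin_fun]
      exact hlen.symm.le.trans hLn)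
    have hmem : (0, Pi.single ⟨0, hlen ▸ hl⟩ 1) ∈ L := by
      rw [heq]
      exact ⟨_, rfl⟩
    exact hsingle l' _ ((hLq _ hmem).symm.trans (hne _ hmem))
  have hy : ∃ p ∈ L, p.2 ≠ 0 := by
    by_contra! hall
    have hle : L ≤ LinearMap.range (LinearMap.inl k (Fin l.length → k) (Fin l'.length → k)) :=
      fun p hp => ⟨p.1, Prod.ext rfl (hall p hp).symm⟩
    have heq := Submodule.eq_of_le_of_finrank_le hle (by
      rw [LinearMap.finrank_range_of_inj LinearMap.inl_injective, Module.finrank_fin_fun]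
      exact hLn)
    have hmem : (Pi.single ⟨0, hl⟩ 1, 0) ∈ L := by
      rw [heq]
      exact ⟨_, rfl⟩
    exact hsingle l _ (hne _ hmem)
  obtain ⟨p, hp, hp1⟩ := hx
  obtain ⟨q, hq, hq2⟩ := hy
  exact ⟨1, p.1, q.2, hp1, hq2, .inr (hne p hp), .inr ((hLq q hq).symm.trans (hne q hq))⟩

/-- In length one the scalar is the letter. In greater length both words are rewritten to start with
the same `c`, and `(⟨c⟩, c)` cancels from the invariants because stable classes are cancellative. -/
theorem word_injective (n : ℕ) : ∀ l l' : List kˣ, l.length = n →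
    (word l).toMWdet = (word l').toMWdet → word l = word l' := by
  induction n with
  | zero =>
    intro l l' hl h
    have h' : l'.length = 0 := by
      rw [← deg_word, ← PP.deg_toMWdet, ← h, PP.deg_toMWdet, deg_word, hl]
    rw [List.length_eq_zero_iff.1 hl, List.length_eq_zero_iff.1 h']
  | succ n ih =>
    intro l l' hl h
    have hl' : l'.length = n + 1 := by
      rw [← deg_word, ← PP.deg_toMWdet, ← h, PP.deg_toMWdet, deg_word, hl]
    have hform : MWs.mk (diagForm l) = MWs.mk (diagForm l') := by
      rw [← (toMWdet_word l).1, h, (toMWdet_word l').1]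
    have hprod : l.prod = l'.prod := by
      rw [← (toMWdet_word l).2, h, (toMWdet_word l').2]
    rcases l with _ | ⟨u, _ | ⟨v, l⟩⟩
    · simp at hl
    · have hl1 : n + 1 = 1 := hl.symm
      rw [hl1] at hl'
      obtain ⟨u', rfl⟩ := List.length_eq_one_iff.1 hl'
      simp only [List.prod_singleton] at hprod
      rw [hprod]
    rcases l' with _ | ⟨u', _ | ⟨v', l'⟩⟩
    · simp at hl'
    · rw [← hl] at hl'
      simp at hl'
    obtain ⟨c, x, y, hx, hy, hxc, hyc⟩ := exists_common_value (by simp) (MWs.mk_eq_iff.1 hform)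
    obtain ⟨m, hm⟩ := exists_word_cons l u v x hx c hxc
    obtain ⟨m', hm'⟩ := exists_word_cons l' u' v' y hy c hyc
    rw [hm, hm', word_cons, word_cons, PP.toMWdet_lin_naiveSum, PP.toMWdet_lin_naiveSum] at h
    have hmn : m.length = n := by
      have := congrArg PP.deg hm
      rw [deg_word, deg_word, hl] at this
      simpa using this.symm
    rw [hm, hm', word_cons, word_cons, ih m m' hmn]
    have hf : (MWdet.rankOne c).form.osum (word m).toMWdet.form =
        (MWdet.rankOne c).form.osum (word m').toMWdet.form := congrArg MWdet.form h
    have hs : c * (word m).toMWdet.scalar = c * (word m').toMWdet.scalar := congrArg MWdet.scalar h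
    exact MWdet.ext (MWs.osum_left_cancel hf) (mul_left_cancel hs)

theorem PP.toMWdet_injective : Function.Injective (PP.toMWdet (k := k)) := by
  intro x y h
  induction x using Quot.inductionOn with | _ f => ?_
  induction y using Quot.inductionOn with | _ g => ?_
  obtain ⟨l, hl⟩ := exists_word f
  obtain ⟨l', hl'⟩ := exists_word g
  change (PP.mk f).toMWdet = (PP.mk g).toMWdet at h
  change PP.mk f = PP.mk g
  rw [← hl, ← hl'] at h ⊢
  exact word_injective _ l l' rfl h

variable (k) in
/-- The bijection induced by the Bézout form. -/
def PP.equivMWdet : PP k ≃ MWdet k :=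
  Equiv.ofBijective PP.toMWdet ⟨PP.toMWdet_injective, PP.toMWdet_surjective⟩

end classification
end NaiveP1
end

theorem theorem4p6 (k : Type*) [Field k] :
    -- both sides are graded bi-monoids
    IsGradedBimonoid (M := PP k) PP.deg PP.naiveSum PP.zero PP.comp PP.one ∧
    IsGradedBimonoid (M := MWdet k) MWdet.deg MWdet.osum MWdet.zero MWdet.comp MWdet.one ∧
    -- the Bézout form is symmetric, of determinant `± res`, and the resultant of a composite
    (∀ f : PtRat k, f.bez.IsSymm ∧ f.bez.det = (-1) ^ (f.deg * (f.deg - 1) / 2) * f.res) ∧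
    (∀ f g : PtRat k, (f.comp g).res = f.res ^ g.deg * g.res ^ (f.deg ^ 2)) ∧
    -- the map `f ↦ [Béz(f), det Béz(f)]` induces an isomorphism of graded bi-monoids
    ∃ Φ : PP k ≃ MWdet k,
      (∀ f : PtRat k, ∃ (hs : f.bez.IsSymm) (hd : IsUnit f.bez.det),
        (Φ (PP.mk f)).form = MWs.mk ⟨f.deg, f.bez, hs, hd⟩ ∧
        (Φ (PP.mk f)).scalar = hd.unit) ∧
      (∀ x, (Φ x).deg = x.deg) ∧
      (∀ x y, Φ (x.naiveSum y) = (Φ x).osum (Φ y)) ∧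
      Φ PP.zero = MWdet.zero ∧
      (∀ x y, Φ (x.comp y) = (Φ x).comp (Φ y)) ∧
      Φ PP.one = MWdet.one := by
  refine ⟨isGradedBimonoid_PP k, isGradedBimonoid_MWdet k, fun f => ⟨f.bez_isSymm, f.det_bez⟩,
    PtRat.res_comp, PP.equivMWdet k, fun f => ⟨f.bez_isSymm, f.isUnit_det_bez, rfl, rfl⟩,
    PP.deg_toMWdet, PP.toMWdet_naiveSum, PP.toMWdet_zero, PP.toMWdet_comp, PP.toMWdet_one⟩
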